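/- For finite graphs $F,G$ with $v(F)\le v(G)$ let $P(F,G)$ be the number of $v(F)$-element subsets of $V(G)$ that induce a subgraph isomorphic to $F$, and let $p(F,G)=P(F,G)/\binom{v(G)}{v(F)}$. Let $i(F,n)$ be the maximum of $P(F,G)$ over all graphs $G$ of order $n$, and $i(F)=\lim_{n\to\infty} i(F,n)/\binom{n}{v(F)}$. A graph is complete partite if non-adjacency is an equivalence relation on its vertices, whose classes are called its parts (any number of parts is allowed). For a real graph parameter $\lambda$ let $\lambda(n)$ be the maximum of $\lambda(G)$ over all graphs $G$ of order $n$, and $\lambda_{\max}=\lim_{n\to\infty}\lambda(n)$. For graphs $G,H$ of the same order $n$ put $\hat\delta_1(G,H)=\frac{2}{n^2}\min_\sigma |E(H)\bigtriangleup E(\sigma(G))|$, where $\sigma$ ranges over all bijections $V(G)\to V(H)$. The parameter $\lambda$ is *perfectly stable* if there is $C>0$ such that for every graph $G$ of order $n\ge C$ there is a complete partite graph $H$ of order $n$ with $\hat\delta_1(G,H)\le C(\lambda(n)-\lambda(G))$. A *maximiser* of $\lambda$ is a sequence $x_1\ge x_2\ge\dots\ge 0$ with $\sum_{i\ge1}x_i\le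 1$ for which there are complete partite graphs $H_k$ such that, as $k\to\infty$, $v(H_k)\to\infty$, $\lambda(H_k)\to\lambda_{\max}$ and, for every $i\ge1$, the $i$-th largest part of $H_k$ has $(x_i+o(1))\,v(H_k)$ vertices (a missing part has size $0$). **Theorem.** Let $s,t$ be non-negative integers with $st\ge 2$, let $K_{s,t}$ be the complete bipartite graph with parts of sizes $s$ and $t$, let $$f_{s,t}(\alpha)=\alpha^s(1-\alpha)^t+\alpha^t(1-\alpha)^s,$$ and let $M_{s,t}=\max_{x\in[1/2,1]}f_{s,t}(x)$ if $s\ne t$, and $M_{s,s}=\frac12\max_{x\in[1/2,1]}f_{s,s}(x)$. Then: 1. $p(K_{s,t},\cdot)$ is perfectly stable; 2. the limit $i(K_{s,t})$ exists and $i(K_{s,t})=\binom{s+t}{s}M_{s,t}$; 3. there is exactly one $\alpha\in[\frac12,1]$ that maximises $f_{s,t}$ over $[\frac12,1]$, and $p(K_{s,t},\cdot)$ has exactly one maximiser, namely $(\alpha,1-\alpha,0,0,\ldots)$. -/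

import Mathlib

open Filter Topology

/-- The number `P(F, G)` of `v(F)`-element vertex subsets of `G` that induce a subgraph
isomorphic to `F`. -/
noncomputable def inducedCount {W V : Type} [Fintype W] [Fintype V]
    (F : SimpleGraph W) (G : SimpleGraph V) : ℕ :=
  {X : Finset V | X.card = Fintype.card W ∧
    Nonempty (G.induce (X : Set V) ≃g F)}.ncard

/-- The induced density `p(F, G) = P(F, G) / (v(G) choose v(F))`. -/
noncomputable def inducedDensity {W V : Type} [Fintype W] [Fintype V]
    (F : SimpleGraph W) (G : SimpleGraph V) : ℝ :=
  (inducedCount F G : ℝ) / ((Fintype.card V).choose (Fintype.card W) : ℝ)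

/-- A real parameter of finite graphs; a graph of order `n` has vertex set `Fin n`. -/
abbrev GraphParameter : Type := ∀ n : ℕ, SimpleGraph (Fin n) → ℝ

/-- The graph parameter `p(F, ·)`. -/
noncomputable def densityParameter {W : Type} [Fintype W] (F : SimpleGraph W) :
    GraphParameter :=
  fun _ G => inducedDensity F G

/-- `lam(n)`, the maximum of `lam` over the (finitely many) graphs on `Fin n`. -/
noncomputable def maxValue (lam : GraphParameter) (n : ℕ) : ℝ :=
  ⨆ G : SimpleGraph (Fin n), lam n G

/-- `i(F, n)`, the maximum number of induced copies of `F` in a graph of order `n`. -/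
noncomputable def maxInducedCount {W : Type} [Fintype W] (F : SimpleGraph W) (n : ℕ) : ℕ :=
  ⨆ G : SimpleGraph (Fin n), inducedCount F G

/-- The inducibility `i(F) = lim i(F, n) / (n choose v(F))` exists and equals `c`. -/
def HasInducibility {W : Type} [Fintype W] (F : SimpleGraph W) (c : ℝ) : Prop :=
  Tendsto (fun n : ℕ => (maxInducedCount F n : ℝ) / (n.choose (Fintype.card W) : ℝ))
    atTop (𝓝 c)

/-- The edit distance: the minimum over all permutations `σ` of the vertex set of the number
of edges in the symmetric difference of `H` and `σ(G)`. -/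
noncomputable def editDistance {n : ℕ} (G H : SimpleGraph (Fin n)) : ℕ :=
  ⨅ σ : Equiv.Perm (Fin n), (symmDiff H.edgeSet (G.map σ).edgeSet).ncard

/-- The edit distance normalised by the factor `2 / n ^ 2`. -/
noncomputable def normalisedEditDistance {n : ℕ} (G H : SimpleGraph (Fin n)) : ℝ :=
  2 / (n : ℝ) ^ 2 * (editDistance G H : ℝ)

/-- Perfect stability of a graph parameter. Mathlib's `IsCompleteMultipartite` says that
non-adjacency is transitive, i.e. the graph is complete partite (with any number of parts). -/
def PerfectlyStable (lam : GraphParameter) : Prop :=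
  ∃ C : ℝ, 0 < C ∧ ∀ n : ℕ, C ≤ (n : ℝ) → ∀ G : SimpleGraph (Fin n),
    ∃ H : SimpleGraph (Fin n), H.IsCompleteMultipartite ∧
      normalisedEditDistance G H ≤ C * (maxValue lam n - lam n G)

/-- The number of vertices of colour `i`. -/
noncomputable def classSize {m : ℕ} (c : Fin m → ℕ) (i : ℕ) : ℕ :=
  {v : Fin m | c v = i}.ncard

/-- `c` exhibits `H` as a complete partite graph whose parts are the nonempty colour classes
of `c`, listed in order of non-increasing size. So `classSize c i` is the size of the
`(i + 1)`-st largest part of `H` (and `0` if `H` has at most `i` parts). -/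
def IsOrderedPartition {m : ℕ} (H : SimpleGraph (Fin m)) (c : Fin m → ℕ) : Prop :=
  (∀ v w, H.Adj v w ↔ c v ≠ c w) ∧ Antitone (classSize c)

/-- The space of sequences `x₁ ≥ x₂ ≥ ⋯ ≥ 0` with `∑ xᵢ ≤ 1`; here `x i` stands for the entry
with index `i + 1`. -/
def partiteLimitSpace : Set (ℕ → ℝ) :=
  {x | Antitone x ∧ (∀ i, 0 ≤ x i) ∧ Summable x ∧ ∑' i, x i ≤ 1}

/-- The set `OPT` of maximisers of `lam`: those `x` in the space above for which there are
complete partite graphs `H k` of order `N k → ∞` such that `lam (H k)` tends to the limit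
`lamMax` of `lam(n)`, and the proportion of vertices in the `(i + 1)`-st largest part of `H k`
tends to `x i`, for every `i`. -/
def maximisers (lam : GraphParameter) : Set (ℕ → ℝ) :=
  {x | x ∈ partiteLimitSpace ∧
    ∃ lamMax : ℝ, Tendsto (maxValue lam) atTop (𝓝 lamMax) ∧
    ∃ (N : ℕ → ℕ) (H : ∀ k, SimpleGraph (Fin (N k))) (c : ∀ k, Fin (N k) → ℕ),
      (∀ k, IsOrderedPartition (H k) (c k)) ∧
      Tendsto N atTop atTop ∧
      Tendsto (fun k => lam (N k) (H k)) atTop (𝓝 lamMax) ∧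
      ∀ i, Tendsto (fun k => (classSize (c k) i : ℝ) / (N k : ℝ)) atTop (𝓝 (x i))}

/-- `f_{s,t}(a) = a ^ s (1 - a) ^ t + a ^ t (1 - a) ^ s`. -/
def fKst (s t : ℕ) (a : ℝ) : ℝ := a ^ s * (1 - a) ^ t + a ^ t * (1 - a) ^ s

/-- `M_{s,t}`: the maximum of `f_{s,t}` over `[1/2, 1]` if `s ≠ t`, and half of it if `s = t`. -/
noncomputable def MKst (s t : ℕ) : ℝ :=
  if s = t then 1 / 2 * sSup (fKst s t '' Set.Icc (1 / 2) 1)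
  else sSup (fKst s t '' Set.Icc (1 / 2) 1)

/-- The sequence `(a, 1 - a, 0, 0, …)`. -/
def twoPartSequence (a : ℝ) : ℕ → ℝ
  | 0 => a
  | 1 => 1 - a
  | _ => 0

/-! Copies of `K_{s,t}` are counted as labelled maps and normalised by `n ^ (s + t)`. The upper
bound is Zykov symmetrisation. Two non-adjacent vertices of a copy lie on the same side, so
replacing one of two non-adjacent vertices by a clone of the other, in the right direction, loses no
copies (`card_copies_symmetrise`); hence some complete partite graph is optimal. Merging two parts,
neither larger than a third one, does not lower the density (`partiteDensity_merge`), so two parts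
suffice and the problem is to maximise `fKst`. Its maximum on `[1/2, 1]` is attained once, because
the critical equation written in `(1 - x) / x` is governed by a strictly monotone ratio
(`critical_point_unique`).

Perfect stability asks for a loss that is linear in the edit distance. Near an optimal bipartition
this comes from local edits. A vertex with many wrong adjacencies lies in too few copies, by a
margin of order `n ^ (s + t - 1)`, and is replaced by a clone of a better vertex, which changes at
most `2 n` ordered pairs. If there is no such vertex, correcting one wrong pair gains order `n ^ (s
+ t - 2)`. Either way the gain is proportional to the size of the edit (`exists_improvement`), and
maximising the number of copies minus a multiple of the distance to `G` turns this into a linear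
bound (`exists_linear_stability_of_close`).

A near-optimal graph far from all complete bipartite graphs is excluded by continuity:
symmetrisation moves in short steps towards a complete partite graph, which is nearly bipartite by a
compactness argument (`exists_nearSplit`), so some step starts at an intermediate distance, where
the local statement gives a contradiction (`exists_linear_stability`). The same compactness argument
determines the maximisers. -/

/-! ### Uniqueness of the optimal split. -/

theorem fKst_one_sub (s t : ℕ) (x : ℝ) : fKst s t (1 - x) = fKst s t x := by
  simp only [fKst, sub_sub_cancel]
  ring

theorem fKst_swap (s t : ℕ) : fKst s t = fKst t s := by
  funext x
  simp only [fKst]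
  ring

theorem continuous_fKst (s t : ℕ) : Continuous (fKst s t) := by
  unfold fKst
  fun_prop

/-- The density of copies of `K_{s,t}` through a vertex of the part of size `x` in the complete
bipartite graph with parts of sizes `x` and `1 - x`. -/
noncomputable def vertexDensity (s t : ℕ) (x : ℝ) : ℝ :=
  s * x ^ (s - 1) * (1 - x) ^ t + t * x ^ (t - 1) * (1 - x) ^ s

theorem hasDerivAt_fKst (s t : ℕ) (x : ℝ) :
    HasDerivAt (fKst s t) (vertexDensity s t x - vertexDensity s t (1 - x)) x := by
  have h1 : ∀ n : ℕ, HasDerivAt (fun y : ℝ => y ^ n) (n * x ^ (n - 1)) x := fun n =>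
    hasDerivAt_pow n x
  have h2 : ∀ n : ℕ, HasDerivAt (fun y : ℝ => (1 - y) ^ n) (-(n * (1 - x) ^ (n - 1))) x := by
    intro n
    have := ((hasDerivAt_id x).const_sub 1).fun_pow n
    simpa using this
  refine (((h1 s).fun_mul (h2 t)).fun_add ((h1 t).fun_mul (h2 s))).congr_deriv ?_
  simp only [vertexDensity, sub_sub_cancel]
  ring

/-- Euler's identity for the form `p ^ s * q ^ t + p ^ t * q ^ s`, whose partial derivatives at `(x,
1 - x)` are the two vertex densities. At a critical point these agree, so both equal `(s + t) * fKst
s t x`. -/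
theorem vertexDensity_euler {s t : ℕ} (hs : 1 ≤ s) (ht : 1 ≤ t) (x : ℝ) :
    x * vertexDensity s t x + (1 - x) * vertexDensity s t (1 - x) = (s + t) * fKst s t x := by
  obtain ⟨s, rfl⟩ := Nat.exists_eq_add_of_le' hs
  obtain ⟨t, rfl⟩ := Nat.exists_eq_add_of_le' ht
  simp only [vertexDensity, fKst, sub_sub_cancel, Nat.add_sub_cancel]
  push_cast
  ring

/-- Cross-multiplied monotonicity of `(r - r ^ (n + 1)) / (1 - r ^ (n + 2))`. Cancelling `1 - r`
reduces it to `S / (1 + r ^ (n + 1))` with `S = r + ⋯ + r ^ n`, and the terms of `S` are paired so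
that each pair has product `r ^ (n + 1)`. -/
theorem geometric_ratio_strictMono {n : ℕ} (hn : n ≠ 0) {r r' : ℝ} (h0 : 0 < r) (h : r < r')
    (h1 : r' < 1) :
    (r - r ^ (n + 1)) * (1 - r' ^ (n + 2)) < (r' - r' ^ (n + 1)) * (1 - r ^ (n + 2)) := by
  have geom : ∀ x : ℝ, (1 - x) * ∑ i ∈ Finset.range n, x ^ (i + 1) = x - x ^ (n + 1) := by
    intro x
    clear hn
    induction n with
    | zero => simp
    | succ n ih => rw [Finset.sum_range_succ, mul_add, ih]; ring
  have dbl : ∀ x : ℝ, 2 * ∑ i ∈ Finset.range n, x ^ (i + 1) =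
      ∑ i ∈ Finset.range n, (x ^ (i + 1) + x ^ (n - i)) := by
    intro x
    rw [Finset.sum_add_distrib, two_mul]
    congr 1
    rw [← Finset.sum_range_reflect]
    refine Finset.sum_congr rfl fun i hi => ?_
    rw [Finset.mem_range] at hi
    congr 1
    omega
  have key : (2 * ∑ i ∈ Finset.range n, r ^ (i + 1)) * (1 + r' ^ (n + 1)) <
      (2 * ∑ i ∈ Finset.range n, r' ^ (i + 1)) * (1 + r ^ (n + 1)) := by
    rw [dbl, dbl, Finset.sum_mul, Finset.sum_mul]
    refine Finset.sum_lt_sum_of_nonempty (by simpa using hn) fun i hi => ?_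
    rw [Finset.mem_range] at hi
    have e : ∀ x : ℝ, x ^ (n + 1) = x ^ (i + 1) * x ^ (n - i) := by
      intro x
      rw [← pow_add]
      congr 1
      omega
    rw [e, e]
    have hA := pow_lt_pow_left₀ h h0.le (n := i + 1) (by omega)
    have hB := pow_lt_pow_left₀ h h0.le (n := n - i) (by omega)
    have hA1 := pow_lt_one₀ (h0.trans h).le h1 (n := i + 1) (by omega)
    have hB1 := pow_lt_one₀ (h0.trans h).le h1 (n := n - i) (by omega)
    have hA0 := pow_pos h0 (i + 1)
    have hB0 := pow_pos h0 (n - i)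
    generalize r ^ (i + 1) = A at *
    generalize r ^ (n - i) = B at *
    generalize r' ^ (i + 1) = A' at *
    generalize r' ^ (n - i) = B' at *
    have h3 : B * B' < 1 := by nlinarith
    have h4 : A * A' < 1 := by nlinarith
    -- The two sides differ by exactly `(A' - A) * (1 - B * B') + (B' - B) * (1 - A * A')`.
    nlinarith [mul_pos (sub_pos.2 hA) (sub_pos.2 h3), mul_pos (sub_pos.2 hB) (sub_pos.2 h4)]
  have g1 := geom r
  have g2 := geom r'
  set S := ∑ i ∈ Finset.range n, r ^ (i + 1)
  set S' := ∑ i ∈ Finset.range n, r' ^ (i + 1)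
  have e1 : 1 - r ^ (n + 2) = (1 - r) * (1 + r ^ (n + 1) + S) := by
    linear_combination -g1
  have e2 : 1 - r' ^ (n + 2) = (1 - r') * (1 + r' ^ (n + 1) + S') := by
    linear_combination -g2
  rw [e1, e2, ← g1, ← g2]
  have : 0 < (1 - r) * (1 - r') := mul_pos (by linarith) (by linarith)
  nlinarith

/-- With `r = (1 - z) / z` and `d = t - s` the critical equation is `s * (1 - r ^ (d + 1)) = t * (r
- r ^ d)`. For `d ≤ 1` it has no root in `(0, 1)`; for `d ≥ 2` it prescribes the value of a strictly
increasing ratio. The point `1/2` must be excluded, being critical by symmetry. -/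
theorem critical_point_unique {s t : ℕ} (hs : 1 ≤ s) (hst : s ≤ t) {x y : ℝ} (hx : 1 / 2 < x)
    (hxy : x < y) (hy : y < 1)
    (h1 : vertexDensity s t x - vertexDensity s t (1 - x) = 0)
    (h2 : vertexDensity s t y - vertexDensity s t (1 - y) = 0) : False := by
  obtain ⟨d, rfl⟩ := Nat.exists_eq_add_of_le hst
  obtain ⟨s, rfl⟩ := Nat.exists_eq_add_of_le' hs
  have hs0 : (0 : ℝ) < (s : ℝ) + 1 := by positivity
  have ratio : ∀ z : ℝ, 1 / 2 < z → z < 1 →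
      vertexDensity (s + 1) (s + 1 + d) z - vertexDensity (s + 1) (s + 1 + d) (1 - z) = 0 →
      ((s : ℝ) + 1) * (1 - ((1 - z) / z) ^ (d + 1)) =
        (s + 1 + d) * ((1 - z) / z - ((1 - z) / z) ^ d) := by
    intro z hz hz1 h
    have hz0 : z ≠ 0 := by linarith
    have hz2 : 1 - z ≠ 0 := by linarith
    have e : (z * (1 - z)) ^ s * (((s : ℝ) + 1) * (1 - z) ^ (d + 1) - (s + 1 + d) * z * (1 - z) ^ d
        + (s + 1 + d) * z ^ d * (1 - z) - (s + 1) * z ^ (d + 1)) = 0 := by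
      rw [← h]
      simp only [vertexDensity, sub_sub_cancel, Nat.add_sub_cancel,
        show s + 1 + d - 1 = s + d by omega]
      push_cast
      rw [mul_pow]
      ring
    have e2 := (mul_eq_zero.1 e).resolve_left (pow_ne_zero _ (mul_ne_zero hz0 hz2))
    rw [div_pow, div_pow, pow_succ, pow_succ]
    rw [pow_succ, pow_succ] at e2
    have hP := pow_ne_zero d hz0
    generalize z ^ d = P at *
    generalize (1 - z) ^ d = Q at *
    field_simp
    linear_combination -e2
  have r1 := ratio x hx (hxy.trans hy) h1
  have r2 := ratio y (hx.trans hxy) hy h2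
  have hr0 : 0 < (1 - y) / y := div_pos (by linarith) (by linarith)
  have hrr : (1 - y) / y < (1 - x) / x := by
    rw [div_lt_div_iff₀ (by linarith) (by linarith)]
    nlinarith
  have hr1 : (1 - x) / x < 1 := by
    rw [div_lt_one (by linarith)]
    linarith
  generalize (1 - y) / y = r at *
  generalize (1 - x) / x = r' at *
  rcases d with _ | _ | n
  · simp only [zero_add, pow_one, pow_zero, Nat.cast_zero, add_zero] at r1
    nlinarith
  · have : r' ^ 2 = 1 := by
      have : ((s : ℝ) + 1) * (1 - r' ^ 2) = 0 := by rw [r1]; ring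
      have := (mul_eq_zero.1 this).resolve_left hs0.ne'
      linarith
    nlinarith
  · have := geometric_ratio_strictMono (n := n + 1) (by omega) hr0 hrr hr1
    have hp : (0 : ℝ) < s + 1 + ((n + 1 + 1 : ℕ) : ℝ) := by positivity
    have h3 : (s + 1 + ((n + 1 + 1 : ℕ) : ℝ)) * ((r - r ^ (n + 1 + 1)) * (1 - r' ^ (n + 1 + 2))) =
        (s + 1 + ((n + 1 + 1 : ℕ) : ℝ)) * ((r' - r' ^ (n + 1 + 1)) * (1 - r ^ (n + 1 + 2))) := by
      linear_combination -(1 - r' ^ (n + 1 + 2)) * r2 + (1 - r ^ (n + 1 + 2)) * r1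
    exact absurd (mul_left_cancel₀ hp.ne' h3) this.ne

/-- `a` is the point of `[1/2, 1]` at which `f_{s,t}` attains its maximum over `[0, 1]`; up to
the symmetry `x ↦ 1 - x` it is the only one. -/
structure IsOptimalSplit (s t : ℕ) (a : ℝ) : Prop where
  half_le : 1 / 2 ≤ a
  lt_one : a < 1
  le_max : ∀ x ∈ Set.Icc (0 : ℝ) 1, fKst s t x ≤ fKst s t a
  eq_or_eq : ∀ x ∈ Set.Icc (0 : ℝ) 1, fKst s t x = fKst s t a → x = a ∨ x = 1 - a
  pos : 0 < fKst s t a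
  vertexDensity_left : vertexDensity s t a = (s + t) * fKst s t a
  vertexDensity_right : vertexDensity s t (1 - a) = (s + t) * fKst s t a

/-- Of two maximisers `x < y` in `[1/2, 1]`, the point `y` is critical and Rolle's theorem gives
another critical point strictly between them. Rolle is needed because `x` itself may be the trivial
critical point `1/2`. -/
theorem exists_isOptimalSplit {s t : ℕ} (hs : 1 ≤ s) (hst : s ≤ t) :
    ∃ a, IsOptimalSplit s t a := by
  have hf0 : fKst s t 1 = 0 := by
    simp [fKst, show s ≠ 0 by omega, show t ≠ 0 by omega]
  have hfh : 0 < fKst s t (1 / 2) := by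
    unfold fKst
    positivity
  obtain ⟨a, ha, hmax⟩ := isCompact_Icc.exists_isMaxOn
    (Set.nonempty_Icc.2 (by norm_num : (1 / 2 : ℝ) ≤ 1)) (continuous_fKst s t).continuousOn
  have hfold : ∀ x ∈ Set.Icc (0 : ℝ) 1, fKst s t x ≤ fKst s t a := by
    intro x hx
    rcases le_total (1 / 2) x with h | h
    · exact hmax ⟨h, hx.2⟩
    · rw [← fKst_one_sub]
      exact hmax ⟨by linarith, by linarith [hx.1]⟩
  have hpos : 0 < fKst s t a := hfh.trans_le (hfold _ (by norm_num))
  have crit : ∀ x ∈ Set.Icc (1 / 2 : ℝ) 1, fKst s t x = fKst s t a →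
      x < 1 ∧ vertexDensity s t x - vertexDensity s t (1 - x) = 0 := by
    intro x hx he
    have hx1 : x < 1 := by
      refine lt_of_le_of_ne hx.2 ?_
      rintro rfl
      rw [hf0] at he
      exact hpos.ne he
    refine ⟨hx1, ?_⟩
    have hloc : IsLocalMax (fKst s t) x := by
      filter_upwards [Icc_mem_nhds (show (0 : ℝ) < x by linarith [hx.1]) hx1] with y hy
      rw [he]
      exact hfold y hy
    exact hloc.hasDerivAt_eq_zero (hasDerivAt_fKst s t x)
  have uniq_lt : ∀ x y, 1 / 2 ≤ x → x < y → y ≤ 1 → fKst s t x = fKst s t a →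
      fKst s t y = fKst s t a → False := by
    intro x y hx hxy hy hfx hfy
    obtain ⟨hy1, hcy⟩ := crit y ⟨by linarith, hy⟩ hfy
    obtain ⟨z, hz, hz0⟩ := exists_hasDerivAt_eq_zero hxy (continuous_fKst s t).continuousOn
      (hfx.trans hfy.symm) (fun z _ => hasDerivAt_fKst s t z)
    exact critical_point_unique hs hst (lt_of_le_of_lt hx hz.1) hz.2 hy1 hz0 hcy
  have uniq : ∀ x ∈ Set.Icc (1 / 2 : ℝ) 1, fKst s t x = fKst s t a → x = a := by
    intro x hx he
    rcases lt_trichotomy x a with h | h | h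
    · exact (uniq_lt x a hx.1 h ha.2 he rfl).elim
    · exact h
    · exact (uniq_lt a x ha.1 h hx.2 rfl he).elim
  have hc := (crit a ha rfl).2
  have he := vertexDensity_euler hs (hs.trans hst) a
  refine ⟨a, ha.1, (crit a ha rfl).1, hfold, ?_, hpos, by linear_combination he + (1 - a) * hc,
    by linear_combination he - a * hc⟩
  intro x hx he
  rcases le_total (1 / 2) x with h | h
  · exact Or.inl (uniq x ⟨h, hx.2⟩ he)
  · right
    have := uniq (1 - x) ⟨by linarith, by linarith [hx.1]⟩ (by rw [fKst_one_sub, he])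
    linarith

/-! ### Merging parts of a complete partite graph. -/

theorem add_pow_ge_three_terms {a b : ℝ} (ha : 0 ≤ a) (hb : 0 ≤ b) (n : ℕ) :
    a ^ (n + 2) + (n + 2) * a ^ (n + 1) * b + b ^ (n + 2) ≤ (a + b) ^ (n + 2) := by
  induction n with
  | zero => norm_num; nlinarith
  | succ n ih =>
    have h := mul_le_mul_of_nonneg_right ih (add_nonneg ha hb)
    have e1 : 0 ≤ (n + 2) * a ^ (n + 1) * b * b := by positivity
    have e2 : 0 ≤ b ^ (n + 2) * a := by positivity
    have e3 : (a ^ (n + 2) + (n + 2) * a ^ (n + 1) * b + b ^ (n + 2)) * (a + b) =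
        a ^ (n + 1 + 2) + ((n + 1 : ℕ) + 2) * a ^ (n + 1 + 1) * b + b ^ (n + 1 + 2) +
          (n + 2) * a ^ (n + 1) * b * b + b ^ (n + 2) * a := by
      push_cast
      ring
    rw [pow_succ (a + b) (n + 2)]
    linarith

/-- Merging parts of sizes `a` and `b` destroys the copies between them (left) and creates copies
with one side mixed in the merged part and the other side in the part of size `c` (right). Three
binomial terms suffice because `c ≥ a ≥ b`. The exception is genuine: for `K_{1,2}` and three equal
parts, merging two of them changes nothing. -/
theorem merge_gain {s t : ℕ} (hs : 1 ≤ s) (hst : s ≤ t) (ht : 2 ≤ t) {a b c : ℝ} (hb : 0 ≤ b)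
    (hba : b ≤ a) (hac : a ≤ c) :
    a ^ s * b ^ t + a ^ t * b ^ s ≤
        c ^ t * ((a + b) ^ s - a ^ s - b ^ s) + c ^ s * ((a + b) ^ t - a ^ t - b ^ t) ∧
      (0 < b → ¬ (s = 1 ∧ t = 2 ∧ a = b ∧ c = a) → a ^ s * b ^ t + a ^ t * b ^ s <
        c ^ t * ((a + b) ^ s - a ^ s - b ^ s) + c ^ s * ((a + b) ^ t - a ^ t - b ^ t)) := by
  have ha := hb.trans hba
  have hc := ha.trans hac
  obtain ⟨t, rfl⟩ := Nat.exists_eq_add_of_le' ht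
  have h1 := add_pow_ge_three_terms ha hb t
  have hbt : b ^ (t + 1) ≤ a ^ (t + 1) := pow_le_pow_left₀ hb hba _
  rcases Nat.eq_or_lt_of_le hs with rfl | hs2
  -- A side with a single vertex cannot be mixed, so only the second gain term survives.
  · simp only [pow_one, add_sub_cancel_left, sub_self, mul_zero, zero_add]
    have e1 : a * b ^ (t + 2) ≤ a ^ (t + 2) * b := by
      calc a * b ^ (t + 2) = a * b * b ^ (t + 1) := by ring
        _ ≤ a * b * a ^ (t + 1) := mul_le_mul_of_nonneg_left hbt (by positivity)
        _ = _ := by ring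
    have e2 : (t + 2) * (a ^ (t + 2) * b) ≤ a * ((a + b) ^ (t + 2) - a ^ (t + 2) - b ^ (t + 2)) := by
      calc (t + 2) * (a ^ (t + 2) * b) = a * ((t + 2) * a ^ (t + 1) * b) := by ring
        _ ≤ _ := mul_le_mul_of_nonneg_left (by linarith) ha
    have h0 : 0 ≤ (a + b) ^ (t + 2) - a ^ (t + 2) - b ^ (t + 2) := by
      have : 0 ≤ (t + 2) * a ^ (t + 1) * b := by positivity
      linarith
    have e3 := mul_le_mul_of_nonneg_right hac h0
    have e4 : 0 ≤ (t : ℝ) * (a ^ (t + 2) * b) := by positivity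
    refine ⟨by linarith, fun hb0 hne => ?_⟩
    have ha0 := hb0.trans_le hba
    by_cases ht0 : t = 0
    · subst ht0
      have h2 : 0 < (a + b) ^ (0 + 2) - a ^ (0 + 2) - b ^ (0 + 2) := by
        norm_num; nlinarith [mul_pos ha0 hb0]
      by_cases hab : a = b
      · have hca : a < c := lt_of_le_of_ne hac fun h => hne ⟨trivial, by norm_num, hab, h.symm⟩
        have := mul_lt_mul_of_pos_right hca h2
        linarith
      · have hlt : b < a := lt_of_le_of_ne hba (Ne.symm hab)
        have : a * b ^ (0 + 2) < a ^ (0 + 2) * b := by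
          have := mul_pos (mul_pos ha0 hb0) (sub_pos.2 hlt)
          norm_num; nlinarith
        linarith
    · have : 0 < (t : ℝ) * (a ^ (t + 2) * b) := by
        have : (0 : ℝ) < t := by exact_mod_cast Nat.pos_of_ne_zero ht0
        positivity
      linarith
  · obtain ⟨s, rfl⟩ := Nat.exists_eq_add_of_le' hs2
    have h2 := add_pow_ge_three_terms ha hb s
    have hbs : b ^ (s + 1) ≤ a ^ (s + 1) := pow_le_pow_left₀ hb hba _
    have hct : a ^ (t + 2) ≤ c ^ (t + 2) := pow_le_pow_left₀ ha hac _
    have hcs : a ^ (s + 2) ≤ c ^ (s + 2) := pow_le_pow_left₀ ha hac _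
    have f1 : 2 * (a ^ (t + 2) * b ^ (s + 2)) ≤
        c ^ (t + 2) * ((a + b) ^ (s + 2) - a ^ (s + 2) - b ^ (s + 2)) := by
      calc 2 * (a ^ (t + 2) * b ^ (s + 2)) = a ^ (t + 2) * (2 * (b ^ (s + 1)) * b) := by ring
        _ ≤ a ^ (t + 2) * ((s + 2) * a ^ (s + 1) * b) := by gcongr; linarith [Nat.cast_nonneg (α := ℝ) s]
        _ ≤ _ := mul_le_mul hct (by linarith) (by positivity) (by positivity)
    have f2 : 2 * (a ^ (s + 2) * b ^ (t + 2)) ≤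
        c ^ (s + 2) * ((a + b) ^ (t + 2) - a ^ (t + 2) - b ^ (t + 2)) := by
      calc 2 * (a ^ (s + 2) * b ^ (t + 2)) = a ^ (s + 2) * (2 * (b ^ (t + 1)) * b) := by ring
        _ ≤ a ^ (s + 2) * ((t + 2) * a ^ (t + 1) * b) := by gcongr; linarith [Nat.cast_nonneg (α := ℝ) t]
        _ ≤ _ := mul_le_mul hcs (by linarith) (by positivity) (by positivity)
    refine ⟨?_, fun hb0 _ => ?_⟩
    · have : 0 ≤ a ^ (s + 2) * b ^ (t + 2) := by positivity
      have : 0 ≤ a ^ (t + 2) * b ^ (s + 2) := by positivity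
      linarith
    · have ha0 := hb0.trans_le hba
      have : 0 < a ^ (s + 2) * b ^ (t + 2) := by positivity
      have : 0 < a ^ (t + 2) * b ^ (s + 2) := by positivity
      linarith

/-- The power sum of exponent `j` of a multiset of reals. -/
noncomputable def powSum (m : Multiset ℝ) (j : ℕ) : ℝ := (m.map (· ^ j)).sum

@[simp] theorem powSum_cons (a : ℝ) (m : Multiset ℝ) (j : ℕ) :
    powSum (a ::ₘ m) j = a ^ j + powSum m j := by
  simp [powSum]

@[simp] theorem powSum_zero (j : ℕ) : powSum 0 j = 0 := by
  simp [powSum]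

theorem powSum_nonneg {m : Multiset ℝ} (h : ∀ x ∈ m, 0 ≤ x) (j : ℕ) : 0 ≤ powSum m j := by
  refine Multiset.sum_nonneg fun y hy => ?_
  obtain ⟨x, hx, rfl⟩ := Multiset.mem_map.1 hy
  exact pow_nonneg (h x hx) j

/-- The density `∑_{i ≠ j} x_i ^ s x_j ^ t` of `K_{s,t}` in the complete partite graph whose part
sizes form the multiset `m`. -/
noncomputable def partiteDensity (s t : ℕ) (m : Multiset ℝ) : ℝ :=
  powSum m s * powSum m t - powSum m (s + t)

theorem partiteDensity_pair (s t : ℕ) (a b : ℝ) :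
    partiteDensity s t (a ::ₘ b ::ₘ 0) = a ^ s * b ^ t + a ^ t * b ^ s := by
  simp only [partiteDensity, powSum_cons, powSum_zero, pow_add]
  ring

theorem partiteDensity_zero_cons {s t : ℕ} (hs : 1 ≤ s) (ht : 1 ≤ t) (m : Multiset ℝ) :
    partiteDensity s t (0 ::ₘ m) = partiteDensity s t m := by
  simp [partiteDensity, show s ≠ 0 by omega, show t ≠ 0 by omega]

/-- The parts in `m` only add nonnegative multiples of `(a + b) ^ j - a ^ j - b ^ j` to the gain, so
the three-part computation decides. -/
theorem partiteDensity_merge {s t : ℕ} (hs : 1 ≤ s) (hst : s ≤ t) (ht : 2 ≤ t) {a b c : ℝ}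
    {m : Multiset ℝ} (hm : ∀ x ∈ m, 0 ≤ x) (hb : 0 ≤ b) (hba : b ≤ a) (hac : a ≤ c) :
    partiteDensity s t (c ::ₘ a ::ₘ b ::ₘ m) ≤ partiteDensity s t (c ::ₘ (a + b) ::ₘ m) ∧
      (0 < b → ¬ (s = 1 ∧ t = 2 ∧ a = b ∧ c = a) →
        partiteDensity s t (c ::ₘ a ::ₘ b ::ₘ m) < partiteDensity s t (c ::ₘ (a + b) ::ₘ m)) := by
  have key := merge_gain hs hst ht hb hba hac
  have ha := hb.trans hba
  have h1 := powSum_nonneg hm s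
  have h2 := powSum_nonneg hm t
  have d : ∀ n : ℕ, 1 ≤ n → 0 ≤ (a + b) ^ n - a ^ n - b ^ n := by
    intro n hn
    rcases Nat.eq_or_lt_of_le hn with rfl | hn
    · simp
    · obtain ⟨n, rfl⟩ := Nat.exists_eq_add_of_le' hn
      have := add_pow_ge_three_terms ha hb n
      have : 0 ≤ (n + 2) * a ^ (n + 1) * b := by positivity
      linarith
  have d1 := mul_nonneg h2 (d s hs)
  have d2 := mul_nonneg h1 (d t (by omega))
  have e : partiteDensity s t (c ::ₘ (a + b) ::ₘ m) - partiteDensity s t (c ::ₘ a ::ₘ b ::ₘ m) =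
      powSum m t * ((a + b) ^ s - a ^ s - b ^ s) + powSum m s * ((a + b) ^ t - a ^ t - b ^ t) +
      (c ^ t * ((a + b) ^ s - a ^ s - b ^ s) + c ^ s * ((a + b) ^ t - a ^ t - b ^ t)) -
      (a ^ s * b ^ t + a ^ t * b ^ s) := by
    simp only [partiteDensity, powSum_cons, pow_add _ s t]
    ring
  refine ⟨by linarith [key.1], fun hb0 hne => by linarith [key.2 hb0 hne]⟩

theorem Multiset.exists_max_cons {m : Multiset ℝ} (h : m ≠ 0) :
    ∃ c m', m = c ::ₘ m' ∧ ∀ x ∈ m', x ≤ c := by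
  obtain ⟨c, hc, hmax⟩ := m.toFinset.exists_max_image id
    (by simpa [Finset.nonempty_iff_ne_empty] using h)
  obtain ⟨m', rfl⟩ := Multiset.exists_cons_of_mem (Multiset.mem_toFinset.1 hc)
  exact ⟨c, m', rfl, fun x hx => hmax x (by simp [hx])⟩

theorem Multiset.exists_min_cons {m : Multiset ℝ} (h : m ≠ 0) :
    ∃ c m', m = c ::ₘ m' ∧ ∀ x ∈ m', c ≤ x := by
  obtain ⟨c, hc, hmin⟩ := m.toFinset.exists_min_image id
    (by simpa [Finset.nonempty_iff_ne_empty] using h)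
  obtain ⟨m', rfl⟩ := Multiset.exists_cons_of_mem (Multiset.mem_toFinset.1 hc)
  exact ⟨c, m', rfl, fun x hx => hmin x (by simp [hx])⟩

/-- Induction on the number of parts: while there are three, two parts other than a largest one are
merged, and two parts give a value of `fKst`. -/
theorem partiteDensity_le {s t : ℕ} (hs : 1 ≤ s) (hst : s ≤ t) (ht : 2 ≤ t) {α : ℝ}
    (hα : IsOptimalSplit s t α) {m : Multiset ℝ} (hm : ∀ x ∈ m, 0 ≤ x) (h1 : m.sum = 1) :
    partiteDensity s t m ≤ fKst s t α := by
  induction hn : m.card using Nat.strong_induction_on generalizing m with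
  | _ n ih =>
  subst hn
  by_cases h0 : m = 0
  · simp [h0] at h1
  obtain ⟨c, m, rfl, hc⟩ := Multiset.exists_max_cons h0
  rcases m.empty_or_exists_mem with rfl | ⟨a, ha⟩
  · have : partiteDensity s t (c ::ₘ 0) = 0 := by
      simp only [partiteDensity, powSum_cons, powSum_zero, pow_add]
      ring
    rw [this]
    exact hα.pos.le
  obtain ⟨m, rfl⟩ := Multiset.exists_cons_of_mem ha
  rcases m.empty_or_exists_mem with rfl | ⟨b, hb⟩
  · rw [partiteDensity_pair]
    simp only [Multiset.sum_cons, Multiset.sum_zero, add_zero] at h1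
    obtain rfl : a = 1 - c := by linarith
    have hc0 := hm c (by simp)
    have ha0 := hm (1 - c) (by simp)
    exact hα.le_max c ⟨hc0, by linarith⟩
  obtain ⟨m, rfl⟩ := Multiset.exists_cons_of_mem hb
  wlog hba : b ≤ a generalizing a b
  · rw [Multiset.cons_swap a b] at *
    exact this b a hc hm h1 ih h0 (by simp) (by simp) (le_of_not_ge hba)
  have hm' : ∀ x ∈ m, 0 ≤ x := fun x hx => hm x (by simp [hx])
  have ha0 := hm a (by simp)
  have hb0 := hm b (by simp)
  refine (partiteDensity_merge hs hst ht hm' hb0 hba (hc a (by simp))).1.trans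
    (ih (c ::ₘ (a + b) ::ₘ m).card ?_ ?_ ?_ rfl)
  · simp
  · intro x hx
    simp only [Multiset.mem_cons] at hx
    rcases hx with rfl | rfl | hx
    · exact hm x (by simp)
    · positivity
    · exact hm' x hx
  · simp only [Multiset.sum_cons] at h1 ⊢
    linarith

/-- The multiset `m` has two members that are `η`-close to `α` and `1 - α`. -/
def NearSplit (α η : ℝ) (m : Multiset ℝ) : Prop :=
  ∃ p q rest, m = p ::ₘ q ::ₘ rest ∧ |p - α| < η ∧ |q - (1 - α)| < η

/-- A strict merge would exceed the maximum, so the smallest part is empty. The exceptional case of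
`merge_gain`, three parts of size `1/3` for `K_{1,2}`, has density `2/9`, below the value `1/4` of
`fKst 1 2` at `1/2`. -/
theorem partiteDensity_triple_eq {s t : ℕ} (hs : 1 ≤ s) (hst : s ≤ t) (ht : 2 ≤ t) {α : ℝ}
    (hα : IsOptimalSplit s t α) {a b c : ℝ} (hb : 0 ≤ b) (hba : b ≤ a) (hac : a ≤ c)
    (h1 : c + a + b = 1) (he : partiteDensity s t (c ::ₘ a ::ₘ b ::ₘ 0) = fKst s t α) :
    c = α ∧ a = 1 - α ∨ a = α ∧ c = 1 - α := by
  have ha := hb.trans hba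
  have hc := ha.trans hac
  rcases hb.eq_or_lt with rfl | hb0
  · have e : fKst s t c = fKst s t α := by
      rw [← he, Multiset.cons_swap a 0, Multiset.cons_swap c 0,
        partiteDensity_zero_cons hs (by omega), partiteDensity_pair, fKst,
        show 1 - c = a by linarith]
    rcases hα.eq_or_eq c ⟨hc, by linarith⟩ e with h | h
    · left; constructor <;> linarith
    · right; constructor <;> linarith
  · exfalso
    by_cases hne : s = 1 ∧ t = 2 ∧ a = b ∧ c = a
    · obtain ⟨rfl, rfl, rfl, rfl⟩ := hne
      have : c = 1 / 3 := by linarith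
      subst this
      have h2 := hα.le_max (1 / 2) (by norm_num)
      rw [← he] at h2
      simp only [fKst, partiteDensity, powSum_cons, powSum_zero] at h2
      norm_num at h2
    · have h2 := (partiteDensity_merge hs hst ht (m := 0) (by simp) hb hba hac).2 hb0 hne
      have h3 := partiteDensity_le hs hst ht hα (m := c ::ₘ (a + b) ::ₘ 0) (by
        intro x hx
        simp only [Multiset.mem_cons, Multiset.notMem_zero, or_false] at hx
        rcases hx with rfl | rfl <;> positivity) (by simp; linarith)
      linarith

/-- Compactness: points of the simplex without two coordinates near `α` and `1 - α` form a compact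
set on which the continuous density stays strictly below its maximum. -/
theorem exists_nearSplit_of_triple {s t : ℕ} (hs : 1 ≤ s) (hst : s ≤ t) (ht : 2 ≤ t) {α : ℝ}
    (hα : IsOptimalSplit s t α) {η : ℝ} (hη : 0 < η) :
    ∃ δ > 0, ∀ x : Fin 3 → ℝ, (∀ i, 0 ≤ x i) → ∑ i, x i = 1 →
      fKst s t α - δ ≤ partiteDensity s t (x 0 ::ₘ x 1 ::ₘ x 2 ::ₘ 0) →
      NearSplit α η (x 0 ::ₘ x 1 ::ₘ x 2 ::ₘ 0) := by
  have perm : ∀ (x : Fin 3 → ℝ) (σ : Equiv.Perm (Fin 3)),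
      (x (σ 0) ::ₘ x (σ 1) ::ₘ x (σ 2) ::ₘ 0 : Multiset ℝ) = x 0 ::ₘ x 1 ::ₘ x 2 ::ₘ 0 := by
    intro x σ
    have h : ∀ y : Fin 3 → ℝ,
        (y 0 ::ₘ y 1 ::ₘ y 2 ::ₘ 0 : Multiset ℝ) = (Finset.univ : Finset (Fin 3)).val.map y := by
      intro y
      rfl
    rw [h x, ← Finset.map_univ_equiv σ, Finset.map_val, Multiset.map_map]
    exact h (x ∘ σ)
  have other : ∀ i j : Fin 3, i ≠ j → ∃ σ : Equiv.Perm (Fin 3), σ 0 = i ∧ σ 1 = j := by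
    decide
  set K : Set (Fin 3 → ℝ) := stdSimplex ℝ (Fin 3) ∩
    {x | ∀ i j, i ≠ j → η ≤ max |x i - α| |x j - (1 - α)|} with hK
  have hKc : IsCompact K := by
    refine (isCompact_stdSimplex ℝ (Fin 3)).inter_right ?_
    simp only [Set.ofPred_forall]
    refine isClosed_iInter fun i => isClosed_iInter fun j => isClosed_iInter fun _ => ?_
    exact isClosed_le (by fun_prop) (by fun_prop)
  have hcont : Continuous fun x : Fin 3 → ℝ => partiteDensity s t (x 0 ::ₘ x 1 ::ₘ x 2 ::ₘ 0) := by
    simp only [partiteDensity, powSum_cons, powSum_zero]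
    fun_prop
  have hnear : ∀ x : Fin 3 → ℝ, (∀ i, 0 ≤ x i) → ∑ i, x i = 1 → x ∉ K →
      NearSplit α η (x 0 ::ₘ x 1 ::ₘ x 2 ::ₘ 0) := by
    intro x hx0 hx1 hxK
    have : ¬ ∀ i j, i ≠ j → η ≤ max |x i - α| |x j - (1 - α)| := fun h => hxK ⟨⟨hx0, hx1⟩, h⟩
    push Not at this
    obtain ⟨i, j, hij, hlt⟩ := this
    obtain ⟨σ, rfl, rfl⟩ := other i j hij
    exact ⟨x (σ 0), x (σ 1), x (σ 2) ::ₘ 0, (perm x σ).symm, (le_max_left _ _).trans_lt hlt,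
      (le_max_right _ _).trans_lt hlt⟩
  have hlt : ∀ x ∈ K, partiteDensity s t (x 0 ::ₘ x 1 ::ₘ x 2 ::ₘ 0) < fKst s t α := by
    rintro x ⟨⟨hx0, hx1⟩, hxf⟩
    refine lt_of_le_of_ne (partiteDensity_le hs hst ht hα ?_ ?_) fun he => ?_
    · simp [hx0]
    · simpa [Fin.sum_univ_three, add_assoc] using hx1
    · obtain ⟨σ, hσ1, hσ2⟩ : ∃ σ : Equiv.Perm (Fin 3), x (σ 2) ≤ x (σ 1) ∧ x (σ 1) ≤ x (σ 0) := by
        have := Tuple.monotone_sort x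
        refine ⟨Fin.revPerm.trans (Tuple.sort x), this (by decide), this (by decide)⟩
      rw [← perm x σ] at he
      have hsum : x (σ 0) + x (σ 1) + x (σ 2) = 1 := by
        rw [← hx1, ← Equiv.sum_comp σ, Fin.sum_univ_three]
      rcases partiteDensity_triple_eq hs hst ht hα (hx0 _) hσ1 hσ2 hsum he with h | h
      · have := hxf (σ 0) (σ 1) (by simp)
        simp [h.1, h.2] at this
        linarith
      · have := hxf (σ 1) (σ 0) (by simp)
        simp [h.1, h.2] at this
        linarith
  rcases K.eq_empty_or_nonempty with hKe | hKne
  · refine ⟨1, one_pos, fun x hx0 hx1 _ => hnear x hx0 hx1 ?_⟩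
    simp [hKe]
  · obtain ⟨y, hy, hmax⟩ := hKc.exists_isMaxOn hKne hcont.continuousOn
    refine ⟨(fKst s t α - partiteDensity s t (y 0 ::ₘ y 1 ::ₘ y 2 ::ₘ 0)) / 2,
      by linarith [hlt y hy], fun x hx0 hx1 h => hnear x hx0 hx1 fun hxK => ?_⟩
    have := hmax hxK
    simp only [Set.mem_ofPred_eq] at this
    linarith [hlt y hy]

/-- For `η ≤ 1 - α` neither of the two distinguished members can be `0`, so an empty part may be
dropped. -/
theorem NearSplit.of_zero_cons {α η : ℝ} {m : Multiset ℝ} (hα : 1 / 2 ≤ α) (hη : η ≤ 1 - α)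
    (h : NearSplit α η (0 ::ₘ m)) : NearSplit α η m := by
  obtain ⟨p, q, rest, he, hp, hq⟩ := h
  have hp' := abs_lt.1 hp
  have hq' := abs_lt.1 hq
  have h0 : (0 : ℝ) ∈ p ::ₘ q ::ₘ rest := by simp [← he]
  simp only [Multiset.mem_cons] at h0
  rcases h0 with h0 | h0 | h0
  · linarith
  · linarith
  · obtain ⟨r, rfl⟩ := Multiset.exists_cons_of_mem h0
    refine ⟨p, q, r, ?_, hp, hq⟩
    rw [Multiset.cons_swap q, Multiset.cons_swap p] at he
    exact (Multiset.cons_inj_right 0).1 he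

/-- The point is that `δ` does not depend on the number of parts. With at least four parts the two
smallest, `b ≤ a`, are merged and induction finds the near pair. The merged part is not in that
pair: some part `v ≥ a` would remain outside it, and `v` is at least half of `a + b`, too much for
the leftover. Fewer parts are padded with zeros to three, where compactness applies. -/
theorem exists_nearSplit {s t : ℕ} (hs : 1 ≤ s) (hst : s ≤ t) (ht : 2 ≤ t) {α : ℝ}
    (hα : IsOptimalSplit s t α) {η : ℝ} (hη : 0 < η) :
    ∃ δ > 0, ∀ m : Multiset ℝ, (∀ x ∈ m, 0 ≤ x) → m.sum = 1 →
      fKst s t α - δ ≤ partiteDensity s t m → NearSplit α η m := by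
  -- The leftover outside the pair is below `2 * η`, and `2 * (2 * η) + η < 1 - α` is what rules out
  -- the merged part.
  wlog hη1 : η ≤ (1 - α) / 6 generalizing η
  · obtain ⟨δ, hδ, h⟩ := this (η := (1 - α) / 6) (by linarith [hα.lt_one]) le_rfl
    refine ⟨δ, hδ, fun m hm h1 h2 => ?_⟩
    obtain ⟨p, q, rest, he, hp, hq⟩ := h m hm h1 h2
    exact ⟨p, q, rest, he, hp.trans (lt_of_not_ge hη1), hq.trans (lt_of_not_ge hη1)⟩
  have hα1 := hα.half_le
  have hα2 := hα.lt_one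
  obtain ⟨δ, hδ, h3⟩ := exists_nearSplit_of_triple hs hst ht hα hη
  have card3 : ∀ m : Multiset ℝ, m.card = 3 → (∀ x ∈ m, 0 ≤ x) → m.sum = 1 →
      fKst s t α - δ ≤ partiteDensity s t m → NearSplit α η m := by
    intro m hm hm0 hm1 h
    obtain ⟨x, y, z, rfl⟩ := Multiset.card_eq_three.1 hm
    refine h3 ![x, y, z] ?_ ?_ h
    · intro i
      fin_cases i <;> exact hm0 _ (by simp)
    · simpa [Fin.sum_univ_three, add_assoc] using hm1
  have pad : ∀ m : Multiset ℝ, (∀ x ∈ m, 0 ≤ x) → m.sum = 1 →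
      fKst s t α - δ ≤ partiteDensity s t m → NearSplit α η (0 ::ₘ m) → NearSplit α η m :=
    fun m _ _ _ h => h.of_zero_cons hα1 (by linarith)
  have step : ∀ n, (∀ m : Multiset ℝ, m.card = n + 1 → (∀ x ∈ m, 0 ≤ x) → m.sum = 1 →
      fKst s t α - δ ≤ partiteDensity s t m → NearSplit α η m) →
      ∀ m : Multiset ℝ, m.card = n → (∀ x ∈ m, 0 ≤ x) → m.sum = 1 →
      fKst s t α - δ ≤ partiteDensity s t m → NearSplit α η m := by
    intro n ih m hn hm0 hm1 h
    refine pad m hm0 hm1 h (ih _ (by simp [hn]) ?_ (by simpa using hm1) ?_)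
    · simpa using hm0
    · rwa [partiteDensity_zero_cons hs (by omega)]
  have card2 := step 2 card3
  have card1 := step 1 card2
  have card0 := step 0 card1
  refine ⟨δ, hδ, fun m => ?_⟩
  induction hn : m.card using Nat.strong_induction_on generalizing m with
  | _ n ih =>
  subst hn
  intro hm0 hm1 h
  rcases (by omega : m.card = 0 ∨ m.card = 1 ∨ m.card = 2 ∨ m.card = 3 ∨ 4 ≤ m.card) with
    hc | hc | hc | hc | hc
  · exact card0 m hc hm0 hm1 h
  · exact card1 m hc hm0 hm1 h
  · exact card2 m hc hm0 hm1 h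
  · exact card3 m hc hm0 hm1 h
  obtain ⟨b, m, rfl, hb⟩ := Multiset.exists_min_cons (m := m) (by rintro rfl; simp at hc)
  obtain ⟨a, m, rfl, ha⟩ := Multiset.exists_min_cons (m := m) (by rintro rfl; simp at hc)
  obtain ⟨c, hcm⟩ : ∃ c, c ∈ m := Multiset.card_pos_iff_exists_mem.1 (by simp at hc; omega)
  have hba := hb a (by simp)
  have hb0 := hm0 b (by simp)
  have ha0 := hm0 a (by simp)
  have hm' : ∀ x ∈ m, 0 ≤ x := fun x hx => hm0 x (by simp [hx])
  have hmerge : fKst s t α - δ ≤ partiteDensity s t ((a + b) ::ₘ m) := by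
    obtain ⟨m, rfl⟩ := Multiset.exists_cons_of_mem hcm
    have := (partiteDensity_merge hs hst ht (m := m) (fun x hx => hm' x (by simp [hx])) hb0 hba
      (ha c (by simp))).1
    rw [Multiset.cons_swap (a + b) c]
    rw [Multiset.cons_swap b a, Multiset.cons_swap b c, Multiset.cons_swap a c] at h
    exact h.trans this
  have hsum : b + (a + m.sum) = 1 := by simpa using hm1
  obtain ⟨p, q, rest, he, hp, hq⟩ := ih _ (by simp) ((a + b) ::ₘ m) rfl
    (by
      intro x hx
      rcases Multiset.mem_cons.1 hx with rfl | hx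
      · positivity
      · exact hm' x hx)
    (by simp; linarith) hmerge
  have hp' := abs_lt.1 hp
  have hq' := abs_lt.1 hq
  have big : ∀ (z w : ℝ) (r : Multiset ℝ), a + b = z → m = w ::ₘ r → 2 * (1 - z - w) < z →
      False := by
    rintro z w r rfl rfl hz
    obtain ⟨v, hv⟩ : ∃ v, v ∈ r := Multiset.card_pos_iff_exists_mem.1 (by simp at hc; omega)
    have h1 := ha v (by simp [hv])
    have h2 : v ≤ r.sum := Multiset.single_le_sum (fun x hx => hm' x (by simp [hx])) v hv
    simp only [Multiset.sum_cons] at hsum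
    linarith
  have hmem : a + b ∈ p ::ₘ q ::ₘ rest := by simp [← he]
  simp only [Multiset.mem_cons] at hmem
  rcases hmem with hz | hz | hz
  · rw [hz] at he
    exact (big p q rest hz ((Multiset.cons_inj_right p).1 he) (by linarith)).elim
  · rw [hz, Multiset.cons_swap p q] at he
    exact (big q p rest hz ((Multiset.cons_inj_right q).1 he) (by linarith)).elim
  · obtain ⟨r, rfl⟩ := Multiset.exists_cons_of_mem hz
    rw [Multiset.cons_swap q, Multiset.cons_swap p] at he
    rw [(Multiset.cons_inj_right _).1 he]
    refine ⟨p, q, b ::ₘ a ::ₘ r, ?_, hp, hq⟩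
    rw [Multiset.cons_swap a p, Multiset.cons_swap b p, Multiset.cons_swap a q,
      Multiset.cons_swap b q]

/-! ### Vertices attached to an optimal bipartition. -/

/-- The density of copies of `K_{s,t}` through a vertex attached to proportions `a` and `b` of the
two parts, of sizes `x` and `1 - x`, of a complete bipartite graph. -/
noncomputable def attachDensity (s t : ℕ) (x a b : ℝ) : ℝ :=
  s * ((x - a) ^ (s - 1) * b ^ t + (1 - x - b) ^ (s - 1) * a ^ t) +
    t * ((x - a) ^ (t - 1) * b ^ s + (1 - x - b) ^ (t - 1) * a ^ s)

/-- Put `u = a / α` and `v = b / (1 - α)`. Bounding powers by first powers leaves multiples of `(1 -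
u) * v` and `(1 - v) * u` whose coefficients are the two vertex densities, both `(s + t) * fKst s t
α`. Moreover `(1 - u) * v + (1 - v) * u = 1 - ((1 - u) * (1 - v) + u * v)` is less than `1` unless
the attachment is that of a vertex of one of the parts. -/
theorem attachDensity_lt {s t : ℕ} (hs : 1 ≤ s) (hst : s ≤ t) (ht : 2 ≤ t) {α : ℝ}
    (hα : IsOptimalSplit s t α) {a b : ℝ} (ha0 : 0 ≤ a) (ha1 : a ≤ α) (hb0 : 0 ≤ b)
    (hb1 : b ≤ 1 - α) (h1 : ¬ (a = 0 ∧ b = 1 - α)) (h2 : ¬ (a = α ∧ b = 0)) :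
    attachDensity s t α a b < (s + t) * fKst s t α := by
  have hα0 : 0 < α := by linarith [hα.half_le]
  have hβ0 : 0 < 1 - α := by linarith [hα.lt_one]
  obtain ⟨u, rfl⟩ : ∃ u, a = α * u := ⟨a / α, by field_simp⟩
  obtain ⟨v, rfl⟩ : ∃ v, b = (1 - α) * v := ⟨b / (1 - α), by field_simp⟩
  have hu0 : 0 ≤ u := nonneg_of_mul_nonneg_right ha0 hα0
  have hv0 : 0 ≤ v := nonneg_of_mul_nonneg_right hb0 hβ0
  have hu1 : u ≤ 1 := by nlinarith
  have hv1 : v ≤ 1 := by nlinarith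
  have hu : 0 ≤ 1 - u := by linarith
  have hv : 0 ≤ 1 - v := by linarith
  have hx : 0 < (1 - u) * (1 - v) + u * v := by
    have n1 : 0 ≤ (1 - u) * (1 - v) := mul_nonneg hu hv
    have n2 : 0 ≤ u * v := mul_nonneg hu0 hv0
    refine (add_nonneg n1 n2).lt_of_ne fun h => ?_
    have e1 : (1 - u) * (1 - v) = 0 := by linarith
    have e2 : u * v = 0 := by linarith
    rcases mul_eq_zero.1 e2 with rfl | rfl
    · have : v = 1 := by linarith
      exact h1 ⟨by ring, by rw [this]; ring⟩
    · have : u = 1 := by linarith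
      exact h2 ⟨by rw [this]; ring, by ring⟩
  have pw : ∀ {y z : ℝ} (m n : ℕ), 0 ≤ y → y ≤ 1 → 0 ≤ z → z ≤ 1 → 1 ≤ m → 1 ≤ n →
      y ^ m * z ^ n ≤ y * z := by
    intro y z m n hy hy1 hz hz1 hm hn
    exact mul_le_mul (pow_le_of_le_one hy hy1 (by omega)) (pow_le_of_le_one hz hz1 (by omega))
      (by positivity) hy
  have hg1 := hα.vertexDensity_left
  have hg2 := hα.vertexDensity_right
  simp only [vertexDensity, sub_sub_cancel] at hg1 hg2
  have hpos : 0 < (s + t) * fKst s t α := by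
    have := hα.pos
    have : (0 : ℝ) < s := by exact_mod_cast hs
    positivity
  have hαβ : 1 - α ≤ α := by linarith [hα.half_le]
  have e : attachDensity s t α (α * u) ((1 - α) * v) =
      s * (α ^ (s - 1) * (1 - α) ^ t * ((1 - u) ^ (s - 1) * v ^ t) +
        (1 - α) ^ (s - 1) * α ^ t * ((1 - v) ^ (s - 1) * u ^ t)) +
      t * (α ^ (t - 1) * (1 - α) ^ s * ((1 - u) ^ (t - 1) * v ^ s) +
        (1 - α) ^ (t - 1) * α ^ s * ((1 - v) ^ (t - 1) * u ^ s)) := by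
    have f1 : α - α * u = α * (1 - u) := by ring
    have f2 : 1 - α - (1 - α) * v = (1 - α) * (1 - v) := by ring
    simp only [attachDensity, f1, f2, mul_pow]
    ring
  rw [e]
  generalize fKst s t α = M at *
  generalize 1 - α = β at *
  have q1 := pw (t - 1) s hu (by linarith) hv0 hv1 (by omega) hs
  have q2 := pw (t - 1) s hv (by linarith) hu0 hu1 (by omega) hs
  have r1 := mul_le_mul_of_nonneg_left q1 (show 0 ≤ (t : ℝ) * (α ^ (t - 1) * β ^ s) by positivity)
  have r2 := mul_le_mul_of_nonneg_left q2 (show 0 ≤ (t : ℝ) * (β ^ (t - 1) * α ^ s) by positivity)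
  have hM := mul_pos hpos hx
  rcases Nat.eq_or_lt_of_le hs with rfl | hs2
  -- For `s = 1` the factors with exponent `s - 1` disappear, which leaves an extra `(α ^ t + β ^ t)
  -- * (u * v)`; it is absorbed because `β < t * α` gives `α ^ t + β ^ t < (1 + t) * M`.
  · simp only [Nat.sub_self, pow_zero, one_mul, Nat.cast_one, pow_one] at *
    have hβt : β ^ t = β ^ (t - 1) * β := by rw [← pow_succ]; congr 1; omega
    have hlt : α ^ t + β ^ t < (1 + t) * M := by
      rw [← hg2, hβt]
      have h2t : (2 : ℝ) ≤ t := by exact_mod_cast ht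
      have : 0 < β ^ (t - 1) := by positivity
      have := mul_pos this (show 0 < t * α - β by nlinarith)
      nlinarith
    have r3 := mul_le_mul_of_nonneg_left (pow_le_of_le_one hv0 hv1 (show t ≠ 0 by omega))
      (show 0 ≤ β ^ t by positivity)
    have r4 := mul_le_mul_of_nonneg_left (pow_le_of_le_one hu0 hu1 (show t ≠ 0 by omega))
      (show 0 ≤ α ^ t by positivity)
    have key : β ^ t * v + α ^ t * u + (t * (α ^ (t - 1) * β) * ((1 - u) * v) +
        t * (β ^ (t - 1) * α) * ((1 - v) * u)) =
        (1 + t) * M * ((1 - u) * v + (1 - v) * u) + (α ^ t + β ^ t) * (u * v) := by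
      linear_combination (1 - u) * v * hg1 + (1 - v) * u * hg2
    have hX : (α ^ t + β ^ t) * (u * v) ≤ (1 + t) * M * (u * v) :=
      mul_le_mul_of_nonneg_right hlt.le (by positivity)
    rcases (mul_nonneg hu0 hv0).eq_or_lt with h0 | h0
    · nlinarith
    · rcases (mul_nonneg hu hv).eq_or_lt with h3 | h3
      · have := mul_lt_mul_of_pos_right hlt h0
        nlinarith
      · nlinarith [mul_pos hpos h3]
  · have q3 := pw (s - 1) t hu (by linarith) hv0 hv1 (by omega) (by omega)
    have q4 := pw (s - 1) t hv (by linarith) hu0 hu1 (by omega) (by omega)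
    have r3 := mul_le_mul_of_nonneg_left q3 (show 0 ≤ (s : ℝ) * (α ^ (s - 1) * β ^ t) by positivity)
    have r4 := mul_le_mul_of_nonneg_left q4 (show 0 ≤ (s : ℝ) * (β ^ (s - 1) * α ^ t) by positivity)
    have key : s * (α ^ (s - 1) * β ^ t) * ((1 - u) * v) + s * (β ^ (s - 1) * α ^ t) * ((1 - v) * u) +
        (t * (α ^ (t - 1) * β ^ s) * ((1 - u) * v) + t * (β ^ (t - 1) * α ^ s) * ((1 - v) * u)) =
        (s + t) * M * ((1 - u) * v + (1 - v) * u) := by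
      linear_combination (1 - u) * v * hg1 + (1 - v) * u * hg2
    linarith

/-- Uniform form of `attachDensity_lt`. The two conditions with `γ` say that the vertex has wrong
degree at least `γ` whichever part it is put into. -/
theorem exists_attachDensity_le {s t : ℕ} (hs : 1 ≤ s) (hst : s ≤ t) (ht : 2 ≤ t) {α : ℝ}
    (hα : IsOptimalSplit s t α) {γ : ℝ} (hγ : 0 < γ) :
    ∃ c > 0, ∀ x a b : ℝ, |x - α| ≤ c → 0 ≤ x → x ≤ 1 → 0 ≤ a → a ≤ x → 0 ≤ b → b ≤ 1 - x →
      γ ≤ a + (1 - x - b) → γ ≤ (x - a) + b →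
      attachDensity s t x a b ≤ (s + t) * fKst s t α - c := by
  set K : Set (ℝ × ℝ × ℝ) := Set.Icc 0 1 ∩ {z | z.2.1 ≤ z.1 ∧ z.2.2 ≤ 1 - z.1 ∧
    γ ≤ z.2.1 + (1 - z.1 - z.2.2) ∧ γ ≤ (z.1 - z.2.1) + z.2.2} with hK
  have hKc : IsCompact K := by
    refine isCompact_Icc.inter_right ?_
    simp only [Set.ofPred_and]
    refine (isClosed_le (by fun_prop) (by fun_prop)).inter ((isClosed_le (by fun_prop)
      (by fun_prop)).inter ((isClosed_le (by fun_prop) (by fun_prop)).inter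
        (isClosed_le (by fun_prop) (by fun_prop))))
  -- For `x ≠ α` the deficit may be negative; truncating it at `0` and adding `|x - α|` gives a
  -- continuous function that is positive on all of `K`.
  set h : ℝ × ℝ × ℝ → ℝ := fun z =>
    |z.1 - α| + max 0 ((s + t) * fKst s t α - attachDensity s t z.1 z.2.1 z.2.2) with hh
  have hcont : Continuous h := by
    simp only [hh, attachDensity]
    fun_prop
  have hpos : ∀ z ∈ K, 0 < h z := by
    rintro ⟨x, a, b⟩ ⟨⟨hz0, hz1⟩, h1, h2, h3, h4⟩
    simp only [Prod.le_def, Prod.fst_zero, Prod.snd_zero, Prod.fst_one, Prod.snd_one] at hz0 hz1 h1 h2 h3 h4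
    by_cases hx : x = α
    · subst hx
      have := attachDensity_lt hs hst ht hα hz0.2.1 h1 hz0.2.2 h2
        (by rintro ⟨rfl, rfl⟩; linarith) (by rintro ⟨rfl, rfl⟩; linarith)
      exact add_pos_of_nonneg_of_pos (abs_nonneg _) (lt_max_of_lt_right (sub_pos.2 this))
    · exact add_pos_of_pos_of_nonneg (abs_pos.2 (sub_ne_zero.2 hx)) (le_max_left _ _)
  have main : ∃ c > 0, ∀ z ∈ K, c ≤ h z := by
    rcases K.eq_empty_or_nonempty with hKe | hKne
    · exact ⟨1, one_pos, by simp [hKe]⟩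
    · obtain ⟨y, hy, hmin⟩ := hKc.exists_isMinOn hKne hcont.continuousOn
      exact ⟨h y, hpos y hy, fun z hz => hmin hz⟩
  obtain ⟨c, hc, hmain⟩ := main
  refine ⟨c / 3, by positivity, fun x a b hx hx0 hx1 ha0 ha1 hb0 hb1 h1 h2 => ?_⟩
  have := hmain (x, a, b) ⟨⟨⟨hx0, ha0, hb0⟩, ⟨hx1, ha1.trans hx1, by simp; linarith⟩⟩,
    ha1, hb1, h1, h2⟩
  simp only [hh] at this
  rcases max_cases 0 ((s + t) * fKst s t α - attachDensity s t x a b) with ⟨h3, _⟩ | ⟨h3, _⟩ <;>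
    rw [h3] at this <;> linarith

/-! ### Labelled copies and their number in complete partite graphs. -/

section Copies

variable {ι V : Type} [Fintype ι] [Fintype V]

open Classical in
/-- The injective maps from the vertex set of the complete bipartite graph with sides given by `l`
onto induced copies of that graph in `G`. -/
noncomputable def copies (l : ι → Bool) (G : SimpleGraph V) : Finset (ι → V) :=
  Finset.univ.filter fun φ => φ.Injective ∧ ∀ p q, G.Adj (φ p) (φ q) ↔ l p ≠ l q

theorem mem_copies {l : ι → Bool} {G : SimpleGraph V} {φ : ι → V} :
    φ ∈ copies l G ↔ φ.Injective ∧ ∀ p q, G.Adj (φ p) (φ q) ↔ l p ≠ l q := by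
  simp [copies]

/-- Labelled copies with a given image form one free orbit under precomposition with automorphisms
of `F`, so every fibre of `φ ↦ image φ` has the same size. -/
theorem card_copies_eq {l : ι → Bool} {F : SimpleGraph ι} (hF : ∀ p q, F.Adj p q ↔ l p ≠ l q)
    (G : SimpleGraph V) :
    (copies l G).card = inducedCount F G * (copies l F).card := by
  classical
  have himg : inducedCount F G = ((copies l G).image fun φ => Finset.univ.image φ).card := by
    rw [inducedCount, ← Set.ncard_coe_finset]
    congr 1
    ext X
    simp only [Set.mem_ofPred_eq, Finset.coe_image, Set.mem_image, Finset.mem_coe, mem_copies]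
    constructor
    · rintro ⟨-, ⟨e⟩⟩
      refine ⟨fun p => (e.symm p : V), ⟨fun p q h => e.symm.injective (Subtype.ext h), fun p q => ?_⟩,
        ?_⟩
      · rw [← hF, ← e.symm.map_adj_iff]
        rfl
      · ext v
        simp only [Finset.mem_image, Finset.mem_univ, true_and]
        constructor
        · rintro ⟨p, rfl⟩
          exact (e.symm p).2
        · intro hv
          exact ⟨e ⟨v, hv⟩, by simp⟩
    · rintro ⟨φ, ⟨hφ, hadj⟩, rfl⟩
      refine ⟨by rw [Finset.card_image_of_injective _ hφ, Finset.card_univ], ⟨?_⟩⟩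
      refine (RelIso.symm ⟨Equiv.ofBijective
        (fun p => ⟨φ p, by simp⟩ : ι → ((Finset.univ.image φ : Finset V) : Set V))
        ⟨fun p q h => hφ (congrArg Subtype.val h), ?_⟩, ?_⟩)
      · rintro ⟨v, hv⟩
        simp only [Finset.coe_image, Finset.coe_univ, Set.image_univ, Set.mem_range] at hv
        obtain ⟨p, rfl⟩ := hv
        exact ⟨p, rfl⟩
      · intro p q
        rw [hF, ← hadj]
        rfl
  rw [himg, Finset.card_eq_sum_card_image (fun φ => Finset.univ.image φ) (copies l G),
    Finset.sum_const_nat]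
  intro X hX
  obtain ⟨φ, hφ, rfl⟩ := Finset.mem_image.1 hX
  rw [mem_copies] at hφ
  symm
  refine Finset.card_bij (fun ψ _ => φ ∘ ψ) ?_ ?_ ?_
  · intro ψ hψ
    rw [mem_copies] at hψ
    rw [Finset.mem_filter, mem_copies]
    refine ⟨⟨hφ.1.comp hψ.1, fun p q => ?_⟩, ?_⟩
    · rw [← hψ.2, hF]
      exact hφ.2 _ _
    · have : Function.Surjective ψ := Finite.surjective_of_injective hψ.1
      rw [← Finset.image_image, Finset.image_univ_of_surjective this]
  · intro ψ _ ψ' _ h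
    funext p
    exact hφ.1 (congrFun h p)
  · intro ψ hψ
    rw [Finset.mem_filter, mem_copies] at hψ
    have : ∀ p, ∃ q, φ q = ψ p := by
      intro p
      have : ψ p ∈ Finset.univ.image φ := by rw [← hψ.2]; simp
      simpa using this
    choose χ hχ using this
    refine ⟨χ, ?_, funext hχ⟩
    rw [mem_copies]
    refine ⟨fun p q h => hψ.1.1 (by rw [← hχ, ← hχ, h]), fun p q => ?_⟩
    rw [← hψ.1.2, hF, ← hχ, ← hχ, hφ.2]

end Copies

/-- The sides of the complete bipartite graph on `Fin s ⊕ Fin t`. -/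
def bipSide (s t : ℕ) : Fin s ⊕ Fin t → Bool := Sum.isLeft

@[simp] theorem bipSide_inl {s t : ℕ} (i : Fin s) : bipSide s t (Sum.inl i) = true := rfl

@[simp] theorem bipSide_inr {s t : ℕ} (i : Fin t) : bipSide s t (Sum.inr i) = false := rfl

theorem completeBipartiteGraph_adj_iff_bipSide (s t : ℕ) (p q : Fin s ⊕ Fin t) :
    (completeBipartiteGraph (Fin s) (Fin t)).Adj p q ↔ bipSide s t p ≠ bipSide s t q := by
  rcases p with p | p <;> rcases q with q | q <;> simp [completeBipartiteGraph]

section Multipartite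

variable {V κ : Type} [Fintype V] [DecidableEq κ]

/-- Each side of a copy lies in one colour class, since non-adjacent vertices share a colour.
Sorting copies by the colours of one base vertex on each side, which needs `s, t ≥ 1`, makes every
fibre a product of two sets of injections. -/
theorem card_copies_multipartite {s t : ℕ} (hs : 1 ≤ s) (ht : 1 ≤ t) {G : SimpleGraph V}
    {c : V → κ} (hG : ∀ v w, G.Adj v w ↔ c v ≠ c w) {I : Finset κ} (hI : ∀ v, c v ∈ I) :
    (copies (bipSide s t) G).card = ∑ z ∈ I.offDiag,
      ((Finset.univ.filter fun v => c v = z.1).card.descFactorial s) *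
        ((Finset.univ.filter fun v => c v = z.2).card.descFactorial t) := by
  classical
  set p₀ : Fin s ⊕ Fin t := Sum.inl ⟨0, hs⟩
  set q₀ : Fin s ⊕ Fin t := Sum.inr ⟨0, ht⟩
  rw [Finset.card_eq_sum_card_fiberwise (f := fun φ => (c (φ p₀), c (φ q₀))) (t := I.offDiag)]
  · refine Finset.sum_congr rfl fun z hz => ?_
    obtain ⟨i, j⟩ := z
    rw [Finset.mem_offDiag] at hz
    have hij : i ≠ j := hz.2.2
    have hcard : ∀ (i : κ) (r : ℕ), (Finset.univ.filter fun v => c v = i).card.descFactorial r =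
        Fintype.card (Fin r ↪ {v // c v = i}) := by
      intro i r
      rw [Fintype.card_embedding_eq, Fintype.card_fin, Fintype.card_subtype]
    simp only [hcard]
    rw [← Fintype.card_prod, ← Fintype.card_coe]
    have hmem : ∀ φ, φ ∈ (copies (bipSide s t) G).filter
        (fun φ => (c (φ p₀), c (φ q₀)) = (i, j)) ↔ φ.Injective ∧
        (∀ a, c (φ (Sum.inl a)) = i) ∧ ∀ b, c (φ (Sum.inr b)) = j := by
      intro φ
      rw [Finset.mem_filter, mem_copies, Prod.mk.injEq]
      constructor
      · rintro ⟨⟨hinj, h⟩, h1, h2⟩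
        refine ⟨hinj, fun a => ?_, fun b => ?_⟩
        · rw [← h1]
          by_contra hne
          have := (h (Sum.inl a) p₀).1 ((hG _ _).2 hne)
          simp [p₀] at this
        · rw [← h2]
          by_contra hne
          have := (h (Sum.inr b) q₀).1 ((hG _ _).2 hne)
          simp [q₀] at this
      · rintro ⟨hinj, h1, h2⟩
        refine ⟨⟨hinj, ?_⟩, h1 _, h2 _⟩
        rintro (p | p) (q | q) <;> rw [hG] <;> simp [h1, h2, hij, hij.symm]
    refine Fintype.card_congr
      { toFun := fun φ => (⟨fun a => ⟨φ.1 (Sum.inl a), ((hmem _).1 φ.2).2.1 a⟩, fun a b h =>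
            Sum.inl_injective (((hmem _).1 φ.2).1 (congrArg Subtype.val h))⟩,
          ⟨fun a => ⟨φ.1 (Sum.inr a), ((hmem _).1 φ.2).2.2 a⟩, fun a b h =>
            Sum.inr_injective (((hmem _).1 φ.2).1 (congrArg Subtype.val h))⟩)
        invFun := fun f => ⟨Sum.elim (fun a => (f.1 a : V)) (fun b => (f.2 b : V)), (hmem _).2
          ⟨?_, fun a => (f.1 a).2, fun b => (f.2 b).2⟩⟩
        left_inv := ?_
        right_inv := ?_ }
    · rw [Sum.elim_injective]
      refine ⟨Subtype.val_injective.comp f.1.injective, Subtype.val_injective.comp f.2.injective,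
        fun a b h => hij ?_⟩
      rw [← (f.1 a).2, h, (f.2 b).2]
    · rintro ⟨φ, hφ⟩
      apply Subtype.ext
      funext x
      rcases x with x | x <;> rfl
    · rintro ⟨f, g⟩
      rfl
  · intro φ hφ
    have hφ' := mem_copies.1 hφ
    simp only [Finset.coe_offDiag, Set.mem_offDiag, Finset.mem_coe]
    refine ⟨hI _, hI _, (hG _ _).1 ((hφ'.2 p₀ q₀).2 (by simp [p₀, q₀]))⟩

theorem sum_offDiag_pow_mul_pow (I : Finset κ) (x : κ → ℝ) (s t : ℕ) :
    ∑ z ∈ I.offDiag, x z.1 ^ s * x z.2 ^ t = partiteDensity s t (I.val.map x) := by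
  have h : ∀ j, powSum (I.val.map x) j = ∑ i ∈ I, x i ^ j := by
    intro j
    rw [powSum, Multiset.map_map]
    rfl
  rw [partiteDensity, h, h, h, Finset.sum_mul_sum, ← Finset.sum_product', ← Finset.diag_union_offDiag,
    Finset.sum_union (Finset.disjoint_diag_offDiag I)]
  simp [pow_add]

/-- The proportions of vertices in the colour classes of `c` with colours in `I`. -/
noncomputable def classProportions (c : V → κ) (I : Finset κ) : Multiset ℝ :=
  I.val.map fun i => ((Finset.univ.filter fun v => c v = i).card : ℝ) / Fintype.card V

theorem classProportions_nonneg (c : V → κ) (I : Finset κ) :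
    ∀ x ∈ classProportions c I, 0 ≤ x := by
  intro x hx
  obtain ⟨i, -, rfl⟩ := Multiset.mem_map.1 hx
  positivity

theorem sum_classProportions [Nonempty V] {c : V → κ} {I : Finset κ} (hI : ∀ v, c v ∈ I) :
    (classProportions c I).sum = 1 := by
  have : (classProportions c I).sum =
      ∑ i ∈ I, ((Finset.univ.filter fun v => c v = i).card : ℝ) / Fintype.card V := rfl
  rw [this, ← Finset.sum_div, ← Nat.cast_sum, ← Finset.card_eq_sum_card_fiberwise
    (f := c) (s := Finset.univ) (t := I) (fun v _ => hI v), Finset.card_univ]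
  exact div_self (by exact_mod_cast Fintype.card_ne_zero)

theorem card_copies_multipartite_le {s t : ℕ} (hs : 1 ≤ s) (ht : 1 ≤ t) [Nonempty V]
    {G : SimpleGraph V} {c : V → κ} (hG : ∀ v w, G.Adj v w ↔ c v ≠ c w) {I : Finset κ}
    (hI : ∀ v, c v ∈ I) :
    ((copies (bipSide s t) G).card : ℝ) ≤
      (Fintype.card V : ℝ) ^ (s + t) * partiteDensity s t (classProportions c I) := by
  have hn : (Fintype.card V : ℝ) ≠ 0 := by exact_mod_cast Fintype.card_ne_zero
  rw [card_copies_multipartite hs ht hG hI, classProportions, ← sum_offDiag_pow_mul_pow,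
    Finset.mul_sum, Nat.cast_sum]
  refine Finset.sum_le_sum fun z _ => ?_
  push_cast
  rw [div_pow, div_pow, pow_add]
  calc _ ≤ ((Finset.univ.filter fun v => c v = z.1).card : ℝ) ^ s *
        ((Finset.univ.filter fun v => c v = z.2).card : ℝ) ^ t := by
        gcongr <;> exact_mod_cast Nat.descFactorial_le_pow _ _
    _ = _ := by field_simp

end Multipartite

/-- The number of automorphisms of `K_{s,t}`. -/
theorem card_copies_self {s t : ℕ} (hs : 1 ≤ s) (ht : 1 ≤ t) :
    (copies (bipSide s t) (completeBipartiteGraph (Fin s) (Fin t))).card =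
      (if s = t then 2 else 1) * (s.factorial * t.factorial) := by
  rw [card_copies_multipartite hs ht (completeBipartiteGraph_adj_iff_bipSide s t)
    (I := Finset.univ) (by simp)]
  have h1 : (Finset.univ.filter fun v : Fin s ⊕ Fin t => bipSide s t v = true).card = s := by
    rw [Finset.card_filter, Fintype.sum_sum_type]
    simp
  have h2 : (Finset.univ.filter fun v : Fin s ⊕ Fin t => bipSide s t v = false).card = t := by
    rw [Finset.card_filter, Fintype.sum_sum_type]
    simp
  have h3 : (Finset.univ : Finset Bool).offDiag = {(true, false), (false, true)} := by decide
  rw [h3, Finset.sum_pair (by simp), h1, h2, Nat.descFactorial_self, Nat.descFactorial_self]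
  split_ifs with h
  · subst h
    rw [Nat.descFactorial_self]
    ring
  -- The exchanged term vanishes, since the larger side does not embed into the smaller one.
  · rcases lt_or_gt_of_ne h with h | h
    · rw [Nat.descFactorial_of_lt h]
      ring
    · rw [Nat.descFactorial_of_lt h]
      ring

/-- The complete bipartite graph with parts `A` and `Aᶜ`. -/
def splitGraph {V : Type} (A : Finset V) : SimpleGraph V where
  Adj v w := ¬ (v ∈ A ↔ w ∈ A)
  symm := ⟨fun _ _ h h' => h h'.symm⟩
  loopless := ⟨fun _ h => h Iff.rfl⟩

@[simp] theorem splitGraph_adj {V : Type} {A : Finset V} {v w : V} :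
    (splitGraph A).Adj v w ↔ ¬ (v ∈ A ↔ w ∈ A) := Iff.rfl

theorem card_copies_splitGraph {V : Type} [Fintype V] [DecidableEq V] {s t : ℕ} (hs : 1 ≤ s)
    (ht : 1 ≤ t) (A : Finset V) :
    (copies (bipSide s t) (splitGraph A)).card =
      A.card.descFactorial s * Aᶜ.card.descFactorial t +
        Aᶜ.card.descFactorial s * A.card.descFactorial t := by
  rw [card_copies_multipartite hs ht (c := fun v => decide (v ∈ A)) (I := Finset.univ)
    (by simp) (fun _ => Finset.mem_univ _)]
  have h1 : (Finset.univ.filter fun v : V => decide (v ∈ A) = true) = A := by ext; simp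
  have h2 : (Finset.univ.filter fun v : V => decide (v ∈ A) = false) = Aᶜ := by ext; simp
  have h3 : (Finset.univ : Finset Bool).offDiag = {(true, false), (false, true)} := by decide
  rw [h3, Finset.sum_pair (by simp), h1, h2]

theorem card_copies_splitGraph_le {V : Type} [Fintype V] [Nonempty V] {s t : ℕ} (hs : 1 ≤ s)
    (ht : 1 ≤ t) (A : Finset V) :
    ((copies (bipSide s t) (splitGraph A)).card : ℝ) ≤
      (Fintype.card V : ℝ) ^ (s + t) * fKst s t ((A.card : ℝ) / Fintype.card V) := by
  classical
  have hn : (Fintype.card V : ℝ) ≠ 0 := by exact_mod_cast Fintype.card_ne_zero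
  have hc : ((Aᶜ.card : ℕ) : ℝ) = Fintype.card V - A.card := by
    rw [Finset.card_compl, Nat.cast_sub (Finset.card_le_univ A)]
  have e : (Fintype.card V : ℝ) ^ (s + t) * fKst s t ((A.card : ℝ) / Fintype.card V) =
      (A.card : ℝ) ^ s * (Aᶜ.card : ℝ) ^ t + (Aᶜ.card : ℝ) ^ s * (A.card : ℝ) ^ t := by
    rw [hc, fKst, one_sub_div hn, div_pow, div_pow, div_pow, div_pow, pow_add]
    field_simp
  rw [e, card_copies_splitGraph hs ht]
  push_cast
  gcongr <;> exact_mod_cast Nat.descFactorial_le_pow _ _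

/-! ### Edit distance in ordered pairs, cloning and symmetrisation. -/

section Edits

variable {V : Type} [Fintype V]

open Classical in
/-- The ordered pairs of vertices on whose adjacency `G` and `H` disagree. -/
noncomputable def diffPairs (G H : SimpleGraph V) : Finset (V × V) :=
  Finset.univ.filter fun z => ¬ (G.Adj z.1 z.2 ↔ H.Adj z.1 z.2)

theorem mem_diffPairs {G H : SimpleGraph V} {x y : V} :
    (x, y) ∈ diffPairs G H ↔ ¬ (G.Adj x y ↔ H.Adj x y) := by
  simp [diffPairs]

theorem diffPairs_comm (G H : SimpleGraph V) : diffPairs G H = diffPairs H G := by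
  ext ⟨x, y⟩
  rw [mem_diffPairs, mem_diffPairs]
  tauto

theorem diffPairs_self (G : SimpleGraph V) : diffPairs G G = ∅ := by
  ext ⟨x, y⟩
  simp [mem_diffPairs]

theorem eq_of_diffPairs_eq_empty {G H : SimpleGraph V} (h : diffPairs G H = ∅) : G = H := by
  ext x y
  by_contra hne
  have := mem_diffPairs.2 hne
  simp [h] at this

theorem card_diffPairs_triangle (G H K : SimpleGraph V) :
    (diffPairs G K).card ≤ (diffPairs G H).card + (diffPairs H K).card := by
  classical
  refine (Finset.card_le_card ?_).trans (Finset.card_union_le _ _)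
  rintro ⟨x, y⟩ h
  rw [Finset.mem_union, mem_diffPairs, mem_diffPairs]
  rw [mem_diffPairs] at h
  tauto

theorem card_diffPairs_le_of_forall_ne {G H : SimpleGraph V} {u : V}
    (h : ∀ x y, x ≠ u → y ≠ u → (G.Adj x y ↔ H.Adj x y)) :
    (diffPairs G H).card ≤ 2 * Fintype.card V := by
  classical
  have : diffPairs G H ⊆ ({u} ×ˢ Finset.univ) ∪ (Finset.univ ×ˢ {u}) := by
    rintro ⟨x, y⟩ hxy
    rw [mem_diffPairs] at hxy
    by_contra hne
    simp only [Finset.mem_union, Finset.mem_product, Finset.mem_singleton, Finset.mem_univ,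
      and_true, true_and, not_or] at hne
    exact hxy (h x y hne.1 hne.2)
  refine (Finset.card_le_card this).trans ((Finset.card_union_le _ _).trans ?_)
  simp [two_mul]

end Edits

section Clone

variable {ι V : Type} [Fintype ι] [Fintype V]

open Classical in
/-- The copies that use the vertex `u`. -/
noncomputable def copiesThrough (l : ι → Bool) (G : SimpleGraph V) (u : V) : Finset (ι → V) :=
  (copies l G).filter fun φ => ∃ p, φ p = u

open Classical in
/-- The copies that use both vertices `u` and `v`. -/
noncomputable def copiesThroughPair (l : ι → Bool) (G : SimpleGraph V) (u v : V) :
    Finset (ι → V) :=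
  (copies l G).filter fun φ => (∃ p, φ p = u) ∧ ∃ p, φ p = v

theorem card_diffPairs_replaceVertex [DecidableEq V] (G : SimpleGraph V) (u v : V) :
    (diffPairs G (G.replaceVertex v u)).card ≤ 2 * Fintype.card V :=
  card_diffPairs_le_of_forall_ne fun _ _ hx hy => (G.adj_replaceVertex_iff_of_ne v hx hy).symm

/-- Here `u` becomes a clone of `v`. Copies avoiding `u` are unaffected, and exchanging `u` with `v`
turns copies of `G` through `v` but not `u` into copies of the new graph through `u` but not `v`. -/
theorem card_copies_clone [DecidableEq V] (l : ι → Bool) (G : SimpleGraph V) {u v : V} (huv : u ≠ v) :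
    (copies l G).card + (copiesThrough l G v).card +
        (copiesThroughPair l (G.replaceVertex v u) u v).card ≤
      (copies l (G.replaceVertex v u)).card + (copiesThrough l G u).card +
        (copiesThroughPair l G u v).card := by
  classical
  set G' := G.replaceVertex v u with hG'
  have split : ∀ H : SimpleGraph V, (copies l H).card =
      ((copies l H).filter fun φ => ¬ ∃ p, φ p = u).card + (copiesThrough l H u).card := by
    intro H
    have e : copiesThrough l H u = (copies l H).filter fun φ => ∃ p, φ p = u := by
      ext
      simp [copiesThrough]
    rw [e, add_comm, Finset.card_filter_add_card_filter_not]
  have split2 : ∀ (H : SimpleGraph V) (x y : V), (copiesThrough l H x).card =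
      ((copies l H).filter fun φ => (∃ p, φ p = x) ∧ ¬ ∃ p, φ p = y).card +
        (copiesThroughPair l H x y).card := by
    intro H x y
    have e1 : copiesThrough l H x = (copies l H).filter fun φ => ∃ p, φ p = x := by
      ext
      simp [copiesThrough]
    have e2 : copiesThroughPair l H x y =
        (copies l H).filter fun φ => (∃ p, φ p = x) ∧ ∃ p, φ p = y := by
      ext
      simp [copiesThroughPair]
    rw [e1, e2, ← Finset.card_filter_add_card_filter_not (fun φ : ι → V => ∃ p, φ p = y),
      Finset.filter_filter, Finset.filter_filter, add_comm]
  have pcomm : copiesThroughPair l G v u = copiesThroughPair l G u v := by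
    ext φ
    simp [copiesThroughPair, and_comm]
  have h0 : ((copies l G).filter fun φ => ¬ ∃ p, φ p = u) =
      (copies l G').filter fun φ => ¬ ∃ p, φ p = u := by
    ext φ
    simp only [Finset.mem_filter, mem_copies]
    refine and_congr_left fun h => and_congr_right fun _ => forall_congr' fun p =>
      forall_congr' fun q => ?_
    push Not at h
    rw [hG', G.adj_replaceVertex_iff_of_ne v (h p) (h q)]
  have h1 : ((copies l G).filter fun φ => (∃ p, φ p = v) ∧ ¬ ∃ p, φ p = u).card ≤
      ((copies l G').filter fun φ => (∃ p, φ p = u) ∧ ¬ ∃ p, φ p = v).card := by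
    refine Finset.card_le_card_of_injOn (fun φ => Equiv.swap u v ∘ φ) ?_ ?_
    · intro φ hφ
      simp only [Finset.coe_filter, Set.mem_ofPred_eq, mem_copies, not_exists] at hφ ⊢
      obtain ⟨⟨hinj, hadj⟩, ⟨p, hp⟩, hu⟩ := hφ
      have key : ∀ x y, x ≠ u → y ≠ u →
          (G'.Adj (Equiv.swap u v x) (Equiv.swap u v y) ↔ G.Adj x y) := by
        intro x y hx hy
        by_cases hxv : x = v <;> by_cases hyv : y = v
        · simp [hxv, hyv]
        · subst hxv
          rw [Equiv.swap_apply_right, Equiv.swap_apply_of_ne_of_ne hy hyv, hG',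
            G.adj_replaceVertex_iff_of_ne_right x hy]
        · subst hyv
          rw [Equiv.swap_apply_right, Equiv.swap_apply_of_ne_of_ne hx hxv, hG',
            SimpleGraph.adj_comm, G.adj_replaceVertex_iff_of_ne_right y hx, SimpleGraph.adj_comm]
        · rw [Equiv.swap_apply_of_ne_of_ne hx hxv, Equiv.swap_apply_of_ne_of_ne hy hyv, hG',
            G.adj_replaceVertex_iff_of_ne v hx hy]
      refine ⟨⟨(Equiv.injective _).comp hinj, fun q r => ?_⟩, ⟨p, by simp [hp]⟩, fun q hq => ?_⟩
      · rw [← hadj]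
        exact key _ _ (hu q) (hu r)
      · refine hu q ((Equiv.swap u v).injective ?_)
        rw [Equiv.swap_apply_left]
        exact hq
    · intro φ _ ψ _ h
      funext p
      exact (Equiv.swap u v).injective (congrFun h p)
  have e1 := split G
  have e2 := split G'
  have e3 := split2 G u v
  have e4 := split2 G v u
  have e5 := split2 G' u v
  rw [pcomm] at e4
  rw [h0] at e1
  omega

/-- Two non-adjacent vertices of a copy are on the same side and have the same neighbours in it. So
copies through both survive the cloning, and the pair terms of `card_copies_clone` can be dropped.
-/
theorem card_copies_symmetrise [DecidableEq V] (l : ι → Bool) (G : SimpleGraph V) {u v : V} (huv : u ≠ v)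
    (hadj : ¬ G.Adj u v) :
    (copies l G).card + (copiesThrough l G v).card ≤
      (copies l (G.replaceVertex v u)).card + (copiesThrough l G u).card := by
  classical
  have h := card_copies_clone l G huv
  have : (copiesThroughPair l G u v).card ≤
      (copiesThroughPair l (G.replaceVertex v u) u v).card := by
    refine Finset.card_le_card fun φ hφ => ?_
    simp only [copiesThroughPair, Finset.mem_filter, mem_copies] at hφ ⊢
    refine ⟨⟨hφ.1.1, fun a b => ?_⟩, hφ.2⟩
    obtain ⟨⟨hinj, hφ⟩, ⟨p, hp⟩, q, hq⟩ := hφ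
    have hpq : l p = l q := by
      by_contra hne
      exact hadj (by rw [← hp, ← hq]; exact (hφ p q).2 hne)
    have tw : ∀ r, G.Adj u (φ r) ↔ G.Adj v (φ r) := by
      intro r
      rw [← hp, ← hq, hφ, hφ, hpq]
    rw [← hφ]
    by_cases ha : φ a = u <;> by_cases hb : φ b = u
    · simp [ha, hb]
    · rw [ha, G.adj_replaceVertex_iff_of_ne_right v hb, tw]
    · rw [hb, SimpleGraph.adj_comm, G.adj_replaceVertex_iff_of_ne_right v ha, ← tw,
        SimpleGraph.adj_comm]
    · rw [G.adj_replaceVertex_iff_of_ne v ha hb]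
  omega

open Classical in
/-- The vertices with the same neighbourhood as `v`. -/
noncomputable def twins (G : SimpleGraph V) (v : V) : Finset V :=
  Finset.univ.filter fun w => ∀ z, G.Adj v z ↔ G.Adj w z

theorem mem_twins {G : SimpleGraph V} {v w : V} : w ∈ twins G v ↔ ∀ z, G.Adj v z ↔ G.Adj w z := by
  simp [twins]

/-- The number of ordered pairs of vertices with equal neighbourhoods. -/
noncomputable def twinCount (G : SimpleGraph V) : ℕ := ∑ v, (twins G v).card

/-- This is the tie-breaking potential, the sum of the squares of the twin class sizes: `u` leaves
its class for one that is at least as large, and other vertices remain twins if they were. -/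
theorem twinCount_lt_replaceVertex [DecidableEq V] {G : SimpleGraph V} {u v : V} (huv : v ∉ twins G u)
    (hle : (twins G u).card ≤ (twins G v).card) :
    twinCount G < twinCount (G.replaceVertex v u) := by
  classical
  set G' := G.replaceVertex v u with hG'
  have hne : u ≠ v := by
    rintro rfl
    exact huv (mem_twins.2 fun _ => Iff.rfl)
  have key : ∀ x y, x ≠ u → y ≠ u → y ∈ twins G x → y ∈ twins G' x := by
    intro x y hx hy h
    rw [mem_twins] at h ⊢
    intro z
    by_cases hz : z = u
    · subst hz
      rw [hG', SimpleGraph.adj_comm, G.adj_replaceVertex_iff_of_ne_right v hx, SimpleGraph.adj_comm,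
        h, SimpleGraph.adj_comm (G.replaceVertex v z), G.adj_replaceVertex_iff_of_ne_right v hy, SimpleGraph.adj_comm]
    · rw [hG', G.adj_replaceVertex_iff_of_ne v hx hz, G.adj_replaceVertex_iff_of_ne v hy hz, h]
  have hclone : ∀ z, G'.Adj u z ↔ G'.Adj v z := by
    intro z
    by_cases hz : z = u
    · subst hz
      simp only [SimpleGraph.irrefl, false_iff]
      exact G.not_adj_replaceVertex_same v z
    · rw [hG', G.adj_replaceVertex_iff_of_ne_right v hz, G.adj_replaceVertex_iff_of_ne v hne.symm hz]
  have hsymm : ∀ (H : SimpleGraph V) x y, y ∈ twins H x → x ∈ twins H y :=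
    fun H x y h => mem_twins.2 fun z => (mem_twins.1 h z).symm
  have htr : ∀ x, x ∈ twins G v → x ≠ u → x ∈ twins G' u := by
    intro x h hx
    have := mem_twins.1 (key v x hne.symm hx h)
    exact mem_twins.2 fun z => (hclone z).trans (this z)
  have huv' : u ∉ twins G v := fun h => huv (hsymm _ _ _ h)
  -- twins of `u` lose `u`, twins of `v` gain it
  have hu : (twins G v).card + 1 ≤ (twins G' u).card := by
    rw [← Finset.card_insert_of_notMem huv']
    refine Finset.card_le_card fun x hx => ?_
    rcases Finset.mem_insert.1 hx with rfl | hx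
    · exact mem_twins.2 fun _ => Iff.rfl
    · exact htr x hx fun h => huv' (h ▸ hx)
  have hother : ∀ x, x ≠ u → (twins G x).card + (if x ∈ twins G v then 1 else 0) ≤
      (twins G' x).card + (if x ∈ twins G u then 1 else 0) := by
    intro x hx
    have hsub : (twins G x).erase u ⊆ twins G' x := fun y hy =>
      key x y hx (Finset.ne_of_mem_erase hy) (Finset.mem_of_mem_erase hy)
    by_cases h1 : x ∈ twins G v
    · have hxu : u ∉ twins G x := fun h =>
        huv' (mem_twins.2 fun z => (mem_twins.1 h1 z).trans (mem_twins.1 h z))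
      have h2 : x ∉ twins G u := fun h => hxu (hsymm _ _ _ h)
      rw [Finset.erase_eq_of_notMem hxu] at hsub
      rw [if_pos h1, if_neg h2, ← Finset.card_insert_of_notMem hxu]
      refine Finset.card_le_card (Finset.insert_subset ?_ hsub)
      exact hsymm _ _ _ (htr x h1 hx)
    · rw [if_neg h1]
      by_cases h2 : x ∈ twins G u
      · rw [if_pos h2]
        have h3 := hsymm _ _ _ h2
        have := Finset.card_le_card hsub
        rw [Finset.card_erase_of_mem h3] at this
        omega
      · have hxu : u ∉ twins G x := fun h => h2 (hsymm _ _ _ h)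
        rw [Finset.erase_eq_of_notMem hxu] at hsub
        simpa [h2] using Finset.card_le_card hsub
  have hsum := Finset.sum_le_sum (s := Finset.univ.erase u) fun x hx =>
    hother x (Finset.ne_of_mem_erase hx)
  rw [Finset.sum_add_distrib, Finset.sum_add_distrib] at hsum
  have c1 : ∑ x ∈ Finset.univ.erase u, (if x ∈ twins G v then 1 else 0) = (twins G v).card := by
    rw [← Finset.card_filter]
    congr 1
    ext x
    simp only [Finset.mem_filter, Finset.mem_erase, Finset.mem_univ, and_true,
      and_iff_right_iff_imp]
    rintro h rfl
    exact huv' h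
  have c2 : ∑ x ∈ Finset.univ.erase u, (if x ∈ twins G u then 1 else 0) ≤ (twins G u).card := by
    rw [← Finset.card_filter]
    exact Finset.card_le_card fun x hx => (Finset.mem_filter.1 hx).2
  have s1 : ∀ H : SimpleGraph V, twinCount H =
      ∑ x ∈ Finset.univ.erase u, (twins H x).card + (twins H u).card := fun H =>
    (Finset.sum_erase_add _ _ (Finset.mem_univ u)).symm
  rw [s1, s1]
  omega

/-- A symmetrisation step at a graph that is not complete partite. -/
theorem exists_symmetrisation_step (l : ι → Bool) {G : SimpleGraph V}
    (hG : ¬ G.IsCompleteMultipartite) :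
    ∃ G' : SimpleGraph V, (diffPairs G G').card ≤ 2 * Fintype.card V ∧
      (copies l G).card ≤ (copies l G').card ∧
      ((copies l G).card = (copies l G').card → twinCount G < twinCount G') := by
  classical
  obtain ⟨u, v, w, huv, hvw, huw⟩ : ∃ u v w, ¬ G.Adj u v ∧ ¬ G.Adj v w ∧ G.Adj u w := by
    by_contra! h
    exact hG ⟨fun u v w h1 h2 => h u v w h1 h2⟩
  have hne : u ≠ v := by
    rintro rfl
    exact hvw huw
  have ht : v ∉ twins G u := fun h => hvw ((mem_twins.1 h w).1 huw)
  have ht' : u ∉ twins G v := fun h => hvw ((mem_twins.1 h w).2 huw)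
  have h1 := card_copies_symmetrise l G hne huv
  have h2 := card_copies_symmetrise l G hne.symm (fun h => huv h.symm)
  have d1 := card_diffPairs_replaceVertex G u v
  have d2 := card_diffPairs_replaceVertex G v u
  -- The vertex in more copies is cloned; on a tie, the one with at least as many twins.
  rcases lt_trichotomy (copiesThrough l G u).card (copiesThrough l G v).card with h | h | h
  · exact ⟨_, d1, by omega, fun _ => by omega⟩
  · rcases le_total (twins G u).card (twins G v).card with h3 | h3
    · exact ⟨_, d1, by omega, fun _ => twinCount_lt_replaceVertex ht h3⟩
    · exact ⟨_, d2, by omega, fun _ => twinCount_lt_replaceVertex ht' h3⟩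
  · exact ⟨_, d2, by omega, fun _ => by omega⟩

end Clone

/-! ### Counting maps with prescribed values. -/

section MapCounting

/-- A union bound; the index `x` will be a pair of positions in the pattern. -/
theorem card_le_of_cover {Φ X : Type} [Fintype X] (S : Finset Φ) (P : X → Φ → Prop) {b : ℝ}
    (hcov : ∀ φ ∈ S, ∃ x, P x φ)
    (hb : ∀ (x : X) (S' : Finset Φ), (∀ φ ∈ S', φ ∈ S ∧ P x φ) → (S'.card : ℝ) ≤ b) :
    (S.card : ℝ) ≤ Fintype.card X * b := by
  classical
  have hsub : S ⊆ Finset.univ.biUnion fun x => S.filter (P x) := by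
    intro φ hφ
    obtain ⟨x, hx⟩ := hcov φ hφ
    exact Finset.mem_biUnion.2 ⟨x, Finset.mem_univ x, Finset.mem_filter.2 ⟨hφ, hx⟩⟩
  calc (S.card : ℝ) ≤ ∑ x, ((S.filter (P x)).card : ℝ) := by
        exact_mod_cast (Finset.card_le_card hsub).trans Finset.card_biUnion_le
    _ ≤ ∑ _x : X, b := Finset.sum_le_sum fun x _ => hb x _ fun φ hφ => Finset.mem_filter.1 hφ
    _ = _ := by simp

variable {ι V : Type} [Fintype ι] [Fintype V]

/-- An element of `T` fixes the values at `m` positions and the others are free. The factor `n ^ m`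
in the denominator avoids a subtraction in the exponent. -/
theorem card_maps_le [Nonempty V] {α : Type} {m : ℕ} {j : Fin m → ι} (hj : j.Injective)
    (T : Finset α) (g : α → Fin m → V) (S : Finset (ι → V))
    (hS : ∀ φ ∈ S, ∃ a ∈ T, ∀ i, φ (j i) = g a i) :
    (S.card : ℝ) ≤ T.card / (Fintype.card V : ℝ) ^ m * (Fintype.card V : ℝ) ^ Fintype.card ι := by
  classical
  have hn : (0 : ℝ) < Fintype.card V := by exact_mod_cast Fintype.card_pos
  set κ := {i : ι // i ∉ Set.range j}
  have hκ : Fintype.card κ + m = Fintype.card ι := by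
    rw [Fintype.card_subtype_compl fun i => i ∈ Set.range j]
    have h1 : Fintype.card {i // i ∈ Set.range j} = m := by
      have := Set.card_range_of_injective hj
      rw [Fintype.card_fin] at this
      exact this
    have h2 : m ≤ Fintype.card ι := by
      simpa using Fintype.card_le_of_injective j hj
    omega
  choose f hfT hf using hS
  have hle : S.card ≤ (T ×ˢ (Finset.univ : Finset (κ → V))).card := by
    rw [← Finset.card_attach]
    refine Finset.card_le_card_of_injOn (fun φ => (f φ.1 φ.2, fun i : κ => φ.1 i)) ?_ ?_
    · rintro ⟨φ, hφ⟩ -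
      simp [hfT φ hφ]
    · rintro ⟨φ, hφ⟩ - ⟨ψ, hψ⟩ - h
      simp only [Prod.mk.injEq] at h
      refine Subtype.ext (funext fun i => ?_)
      by_cases hi : i ∈ Set.range j
      · obtain ⟨a, rfl⟩ := hi
        exact (hf φ hφ a).trans ((congrFun (congrArg g h.1) a).trans (hf ψ hψ a).symm)
      · exact congrFun h.2 ⟨i, hi⟩
  rw [Finset.card_product, Finset.card_univ, Fintype.card_fun] at hle
  have hle' : (S.card : ℝ) ≤ T.card * (Fintype.card V : ℝ) ^ Fintype.card κ := by
    exact_mod_cast hle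
  refine hle'.trans (le_of_eq ?_)
  rw [← hκ, pow_add]
  field_simp

variable [Nonempty V]

theorem card_maps_one_one_le {p q : ι} (hpq : p ≠ q) (u v : V) (S : Finset (ι → V))
    (hS : ∀ φ ∈ S, φ p = u ∧ φ q = v) :
    (S.card : ℝ) ≤ 1 / (Fintype.card V : ℝ) ^ 2 * (Fintype.card V : ℝ) ^ Fintype.card ι := by
  have hj : Function.Injective ![p, q] := by
    intro i j h
    fin_cases i <;> fin_cases j <;> simp_all
  have := card_maps_le hj ({()} : Finset Unit) (fun _ => ![u, v]) S fun φ hφ =>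
    ⟨(), by simp, fun i => by fin_cases i; exacts [(hS φ hφ).1, (hS φ hφ).2]⟩
  simpa using this

theorem card_maps_pair_le {q r : ι} (hqr : q ≠ r) (T : Finset (V × V)) (S : Finset (ι → V))
    (hS : ∀ φ ∈ S, (φ q, φ r) ∈ T) :
    (S.card : ℝ) ≤ T.card / (Fintype.card V : ℝ) ^ 2 * (Fintype.card V : ℝ) ^ Fintype.card ι := by
  have hj : Function.Injective ![q, r] := by
    intro i j h
    fin_cases i <;> fin_cases j <;> simp_all
  exact card_maps_le hj T (fun z => ![z.1, z.2]) S fun φ hφ =>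
    ⟨_, hS φ hφ, fun i => by fin_cases i <;> rfl⟩

theorem card_maps_one_pair_le {p q r : ι} (hpq : p ≠ q) (hpr : p ≠ r) (hqr : q ≠ r) (u : V)
    (T : Finset (V × V)) (S : Finset (ι → V)) (hS : ∀ φ ∈ S, φ p = u ∧ (φ q, φ r) ∈ T) :
    (S.card : ℝ) ≤ T.card / (Fintype.card V : ℝ) ^ 3 * (Fintype.card V : ℝ) ^ Fintype.card ι := by
  have hj : Function.Injective ![p, q, r] := by
    intro i j h
    fin_cases i <;> fin_cases j <;> simp_all
  exact card_maps_le hj T (fun z => ![u, z.1, z.2]) S fun φ hφ =>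
    ⟨_, (hS φ hφ).2, fun i => by fin_cases i; exacts [(hS φ hφ).1, rfl, rfl]⟩

theorem card_maps_one_one_mem_le {p q r : ι} (hpq : p ≠ q) (hpr : p ≠ r) (hqr : q ≠ r) (u v : V)
    (T : Finset V) (S : Finset (ι → V)) (hS : ∀ φ ∈ S, φ p = u ∧ φ q = v ∧ φ r ∈ T) :
    (S.card : ℝ) ≤ T.card / (Fintype.card V : ℝ) ^ 3 * (Fintype.card V : ℝ) ^ Fintype.card ι := by
  have hj : Function.Injective ![p, q, r] := by
    intro i j h
    fin_cases i <;> fin_cases j <;> simp_all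
  exact card_maps_le hj T (fun z => ![u, v, z]) S fun φ hφ =>
    ⟨_, (hS φ hφ).2.2, fun i => by fin_cases i; exacts [(hS φ hφ).1, (hS φ hφ).2.1, rfl]⟩

theorem card_maps_one_one_pair_le {p q r r' : ι} (hpq : p ≠ q) (hpr : p ≠ r) (hqr : q ≠ r)
    (hpr' : p ≠ r') (hqr' : q ≠ r') (hrr' : r ≠ r') (u v : V)
    (T : Finset (V × V)) (S : Finset (ι → V))
    (hS : ∀ φ ∈ S, φ p = u ∧ φ q = v ∧ (φ r, φ r') ∈ T) :
    (S.card : ℝ) ≤ T.card / (Fintype.card V : ℝ) ^ 4 * (Fintype.card V : ℝ) ^ Fintype.card ι := by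
  have hj : Function.Injective ![p, q, r, r'] := by
    intro i j h
    fin_cases i <;> fin_cases j <;> simp_all
  exact card_maps_le hj T (fun z => ![u, v, z.1, z.2]) S fun φ hφ =>
    ⟨_, (hS φ hφ).2.2, fun i => by
      fin_cases i; exacts [(hS φ hφ).1, (hS φ hφ).2.1, rfl, rfl]⟩

end MapCounting

section CopyBounds

variable {ι V : Type} [Fintype ι] [Fintype V] [Nonempty V]

/-- A copy in `G` that is not one in `H` contains a pair on which the graphs differ. So the density
of copies is Lipschitz in the edit distance. -/
theorem card_copies_le_add (l : ι → Bool) (G H : SimpleGraph V) :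
    ((copies l G).card : ℝ) ≤ (copies l H).card + (Fintype.card ι : ℝ) ^ 2 *
      ((diffPairs G H).card / (Fintype.card V : ℝ) ^ 2 *
        (Fintype.card V : ℝ) ^ Fintype.card ι) := by
  classical
  have hsub : copies l G ⊆ copies l H ∪ (copies l G \ copies l H) := by
    intro φ hφ
    by_cases h : φ ∈ copies l H <;> simp [h, hφ]
  have h1 : ((copies l G).card : ℝ) ≤ (copies l H).card + (copies l G \ copies l H).card := by
    exact_mod_cast (Finset.card_le_card hsub).trans (Finset.card_union_le _ _)
  refine h1.trans (add_le_add_right ?_ _)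
  have := card_le_of_cover (X := ι × ι) (copies l G \ copies l H)
    (fun z φ => (φ z.1, φ z.2) ∈ diffPairs G H)
    (b := (diffPairs G H).card / (Fintype.card V : ℝ) ^ 2 *
      (Fintype.card V : ℝ) ^ Fintype.card ι) ?_ ?_
  · rw [Fintype.card_prod] at this
    push_cast at this
    rwa [sq]
  · intro φ hφ
    simp only [Finset.mem_sdiff, mem_copies, not_and, not_forall] at hφ
    obtain ⟨p, q, hpq⟩ := hφ.2 hφ.1.1
    refine ⟨(p, q), mem_diffPairs.2 fun h => hpq ?_⟩
    rw [← h, hφ.1.2]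
  · rintro ⟨q, r⟩ S' hS'
    by_cases hqr : q = r
    · subst hqr
      have : S' = ∅ := by
        refine Finset.eq_empty_of_forall_notMem fun φ hφ => ?_
        have := mem_diffPairs.1 (hS' φ hφ).2
        simp at this
      rw [this]
      simp only [Finset.card_empty, Nat.cast_zero]
      positivity
    · exact card_maps_pair_le hqr _ _ fun φ hφ => (hS' φ hφ).2

theorem card_copiesThroughPair_le (l : ι → Bool) (G : SimpleGraph V) {u v : V} (huv : u ≠ v) :
    ((copiesThroughPair l G u v).card : ℝ) ≤ (Fintype.card ι : ℝ) ^ 2 *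
      (1 / (Fintype.card V : ℝ) ^ 2 * (Fintype.card V : ℝ) ^ Fintype.card ι) := by
  have := card_le_of_cover (X := ι × ι) (copiesThroughPair l G u v)
    (fun z φ => φ z.1 = u ∧ φ z.2 = v)
    (b := 1 / (Fintype.card V : ℝ) ^ 2 * (Fintype.card V : ℝ) ^ Fintype.card ι) ?_ ?_
  · rw [Fintype.card_prod] at this
    push_cast at this
    rwa [sq]
  · intro φ hφ
    simp only [copiesThroughPair, Finset.mem_filter] at hφ
    obtain ⟨-, ⟨p, hp⟩, q, hq⟩ := hφ
    exact ⟨(p, q), hp, hq⟩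
  · rintro ⟨p, q⟩ S' hS'
    by_cases hpq : p = q
    · subst hpq
      have : S' = ∅ := Finset.eq_empty_of_forall_notMem fun φ hφ =>
        huv ((hS' φ hφ).2.1.symm.trans (hS' φ hφ).2.2)
      rw [this]
      simp only [Finset.card_empty, Nat.cast_zero]
      positivity
    · exact card_maps_one_one_le hpq u v _ fun φ hφ => (hS' φ hφ).2

/-- Some vertex lies in at least the average number of copies. -/
theorem exists_card_copiesThrough_ge (l : ι → Bool) (G : SimpleGraph V) :
    ∃ v, Fintype.card ι * (copies l G).card ≤ Fintype.card V * (copiesThrough l G v).card := by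
  classical
  have hsum : ∑ v, (copiesThrough l G v).card = Fintype.card ι * (copies l G).card := by
    have h1 : ∀ v, (copiesThrough l G v).card =
        ∑ φ ∈ copies l G, if v ∈ Finset.univ.image φ then 1 else 0 := by
      intro v
      rw [← Finset.card_filter]
      congr 1
      ext φ
      simp [copiesThrough]
    simp only [h1]
    rw [Finset.sum_comm, mul_comm]
    refine Finset.sum_const_nat fun φ hφ => ?_
    rw [← Finset.card_filter, Finset.filter_univ_mem,
      Finset.card_image_of_injective _ (mem_copies.1 hφ).1, Finset.card_univ]
  obtain ⟨v, -, hv⟩ := Finset.exists_max_image Finset.univ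
    (fun v => (copiesThrough l G v).card) Finset.univ_nonempty
  refine ⟨v, ?_⟩
  rw [← hsum, ← smul_eq_mul, ← Finset.card_univ]
  exact Finset.sum_le_card_nsmul _ _ _ fun w hw => hv w hw

end CopyBounds

/-! ### Copies through a vertex of a nearly bipartite graph. -/

section VertexBound

variable {V : Type}

open Classical in
/-- The proportion of the vertices lying in `A` and adjacent to `v`. -/
noncomputable def nbrProportion [Fintype V] (G : SimpleGraph V) (A : Finset V) (v : V) : ℝ :=
  ((A.filter fun w => G.Adj v w).card : ℝ) / Fintype.card V

theorem prod_ite_eq_one_left {κ : Type} [Fintype κ] [DecidableEq κ] (a : κ) (c : ℕ) :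
    ∏ i : κ, (if i = a then 1 else c) = c ^ (Fintype.card κ - 1) := by
  rw [Finset.prod_ite, Finset.prod_const_one, one_mul, Finset.prod_const]
  congr 1
  rw [Finset.filter_not, Finset.filter_eq' Finset.univ a, if_pos (Finset.mem_univ a),
    Finset.card_sdiff_of_subset (Finset.subset_univ _), Finset.card_univ, Finset.card_singleton]

/-- A bound for the number of maps that send `p` to `v`, the rest of the side of `p` to `X` and the
other side to `Y`. -/
theorem card_maps_rooted {s t : ℕ} (p : Fin s ⊕ Fin t) (v : V) (X Y : Finset V)
    (S : Finset (Fin s ⊕ Fin t → V))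
    (hS : ∀ φ ∈ S, φ p = v ∧ (∀ r, r ≠ p → bipSide s t r = bipSide s t p → φ r ∈ X) ∧
      ∀ r, bipSide s t r ≠ bipSide s t p → φ r ∈ Y) :
    S.card ≤ if bipSide s t p then X.card ^ (s - 1) * Y.card ^ t
      else X.card ^ (t - 1) * Y.card ^ s := by
  classical
  have hsub : S ⊆ Fintype.piFinset fun r =>
      if r = p then {v} else if bipSide s t r = bipSide s t p then X else Y := by
    intro φ hφ
    obtain ⟨h1, h2, h3⟩ := hS φ hφ
    rw [Fintype.mem_piFinset]
    intro r
    split_ifs with h h'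
    · simpa [h] using h1
    · exact h2 r h h'
    · exact h3 r h'
  refine (Finset.card_le_card hsub).trans (le_of_eq ?_)
  rw [Fintype.card_piFinset, Fintype.prod_sum_type]
  rcases p with p | p
  · have := prod_ite_eq_one_left p X.card
    simp only [Fintype.card_fin] at this
    simp [← this, apply_ite Finset.card]
  · have := prod_ite_eq_one_left p X.card
    simp only [Fintype.card_fin] at this
    simp [← this, apply_ite Finset.card, mul_comm]

/-- Away from `p`, the side and the membership in `A` are two 2-colourings that separate the same
pairs, so they agree up to exchanging the colours. -/
theorem exists_side_of_copy [Fintype V] {s t : ℕ} (hst : 3 ≤ s + t) {G : SimpleGraph V} {A : Finset V}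
    {φ : Fin s ⊕ Fin t → V} (hφ : φ ∈ copies (bipSide s t) G) (p : Fin s ⊕ Fin t)
    (hgood : ∀ q r, q ≠ p → r ≠ p → q ≠ r → (φ q, φ r) ∉ diffPairs G (splitGraph A)) :
    (∀ r, r ≠ p → (φ r ∈ A ↔ bipSide s t r = bipSide s t p)) ∨
      ∀ r, r ≠ p → (φ r ∉ A ↔ bipSide s t r = bipSide s t p) := by
  have key : ∀ q r, q ≠ p → r ≠ p →
      ((φ q ∈ A ↔ φ r ∈ A) ↔ (bipSide s t q = bipSide s t r)) := by
    intro q r hq hr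
    by_cases hqr : q = r
    · simp [hqr]
    · have := hgood q r hq hr hqr
      rw [mem_diffPairs, not_not, (mem_copies.1 hφ).2, splitGraph_adj, not_iff_not] at this
      exact this.symm
  obtain ⟨r₀, hr₀⟩ : ∃ r₀, r₀ ≠ p := by
    have : 1 < Fintype.card (Fin s ⊕ Fin t) := by simp; omega
    exact Fintype.exists_ne_of_one_lt_card this p
  have bool : ∀ a b c : Bool, (a = b ↔ (a = c ↔ b = c)) := by decide
  by_cases h : (φ r₀ ∈ A ↔ bipSide s t r₀ = bipSide s t p)
  · left
    intro r hr
    have := key r r₀ hr hr₀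
    have := bool (bipSide s t r) (bipSide s t r₀) (bipSide s t p)
    tauto
  · right
    intro r hr
    have := key r r₀ hr hr₀
    have := bool (bipSide s t r) (bipSide s t r₀) (bipSide s t p)
    tauto

/-- Copies with a wrong pair away from the root make up the error term. In any other copy either the
rest of the side of `p` lies among the non-neighbours of `v` in `A` (proportion `x - a`) and the
other side among its neighbours in `Aᶜ` (proportion `b`), or the same holds with `A` and `Aᶜ`
exchanged. -/
theorem card_copies_rooted_le [Fintype V] [Nonempty V] [DecidableEq V] {s t : ℕ} (hst : 3 ≤ s + t) (G : SimpleGraph V)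
    (A : Finset V) (v : V) (p : Fin s ⊕ Fin t) (S : Finset (Fin s ⊕ Fin t → V))
    (hS : ∀ φ ∈ S, φ ∈ copies (bipSide s t) G ∧ φ p = v) {x a b : ℝ}
    (hx : x = A.card / Fintype.card V) (ha : a = nbrProportion G A v)
    (hb : b = nbrProportion G Aᶜ v) :
    (S.card : ℝ) ≤ (if bipSide s t p then
        (x - a) ^ (s - 1) * b ^ t + (1 - x - b) ^ (s - 1) * a ^ t
      else (x - a) ^ (t - 1) * b ^ s + (1 - x - b) ^ (t - 1) * a ^ s) / Fintype.card V *
        (Fintype.card V : ℝ) ^ (s + t) + ((s : ℝ) + t) ^ 2 *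
      ((diffPairs G (splitGraph A)).card / (Fintype.card V : ℝ) ^ 3 *
        (Fintype.card V : ℝ) ^ (s + t)) := by
  have hn : (0 : ℝ) < Fintype.card V := by exact_mod_cast Fintype.card_pos
  set n : ℝ := (Fintype.card V : ℝ) with hn_def
  classical
  set W := diffPairs G (splitGraph A)
  set S₀ := S.filter fun φ => ∃ q r, q ≠ p ∧ r ≠ p ∧ q ≠ r ∧ (φ q, φ r) ∈ W
  set S₁ := S.filter fun φ => ∀ r, r ≠ p → (φ r ∈ A ↔ bipSide s t r = bipSide s t p)
  set S₂ := S.filter fun φ => ∀ r, r ≠ p → (φ r ∉ A ↔ bipSide s t r = bipSide s t p)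
  have hcov : S ⊆ S₀ ∪ (S₁ ∪ S₂) := by
    intro φ hφ
    simp only [S₀, S₁, S₂, Finset.mem_union, Finset.mem_filter, hφ, true_and]
    by_cases h : ∃ q r, q ≠ p ∧ r ≠ p ∧ q ≠ r ∧ (φ q, φ r) ∈ W
    · exact Or.inl h
    · right
      push Not at h
      exact exists_side_of_copy hst (hS φ hφ).1 p h
  have hcard : (S.card : ℝ) ≤ S₀.card + (S₁.card + S₂.card) := by
    exact_mod_cast (Finset.card_le_card hcov).trans ((Finset.card_union_le _ _).trans
      (Nat.add_le_add_left (Finset.card_union_le _ _) _))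
  have h0 : (S₀.card : ℝ) ≤ ((s : ℝ) + t) ^ 2 * (W.card / n ^ 3 * n ^ (s + t)) := by
    have := card_le_of_cover (X := (Fin s ⊕ Fin t) × (Fin s ⊕ Fin t)) S₀
      (fun z φ => z.1 ≠ p ∧ z.2 ≠ p ∧ z.1 ≠ z.2 ∧ (φ z.1, φ z.2) ∈ W)
      (b := W.card / n ^ 3 * n ^ (s + t)) ?_ ?_
    · simpa [sq] using this
    · intro φ hφ
      obtain ⟨q, r, h⟩ := (Finset.mem_filter.1 hφ).2
      exact ⟨(q, r), h⟩
    · rintro ⟨q, r⟩ S' hS'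
      rcases S'.eq_empty_or_nonempty with rfl | ⟨φ, hφ⟩
      · simp only [Finset.card_empty, Nat.cast_zero]
        positivity
      · obtain ⟨h1, h2, h3, -⟩ := (hS' φ hφ).2
        have := card_maps_one_pair_le (Ne.symm h1) (Ne.symm h2) h3 v W S' fun ψ hψ =>
          ⟨(hS ψ (Finset.mem_filter.1 (hS' ψ hψ).1).1).2, (hS' ψ hψ).2.2.2.2⟩
        simpa using this
  have hadj : ∀ φ ∈ S, ∀ r, G.Adj v (φ r) ↔ bipSide s t r ≠ bipSide s t p := by
    intro φ hφ r
    rw [← (hS φ hφ).2, (mem_copies.1 (hS φ hφ).1).2, ne_comm]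
  have cX : ∀ B : Finset V, ((B.filter fun w => ¬ G.Adj v w).card : ℝ) =
      n * (B.card / n - nbrProportion G B v) := by
    intro B
    have := Finset.card_filter_add_card_filter_not (s := B) (fun w => G.Adj v w)
    have : ((B.filter fun w => G.Adj v w).card : ℝ) + (B.filter fun w => ¬ G.Adj v w).card =
        B.card := by exact_mod_cast this
    rw [nbrProportion, ← hn_def, mul_sub, mul_div_cancel₀ _ hn.ne', mul_div_cancel₀ _ hn.ne']
    have e : (B.filter fun w => G.Adj v w) = @Finset.filter V (fun w => G.Adj v w)
        (fun w => Classical.propDecidable _) B := by congr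
    rw [← e]
    linarith
  have cY : ∀ B : Finset V, ((B.filter fun w => G.Adj v w).card : ℝ) = n * nbrProportion G B v := by
    intro B
    rw [nbrProportion, ← hn_def, mul_div_cancel₀ _ hn.ne']
  have hxc : (Aᶜ.card : ℝ) / n = 1 - x := by
    rw [hx, Finset.card_compl, Nat.cast_sub (Finset.card_le_univ A), sub_div, ← hn_def,
      div_self hn.ne']
  have h1 := card_maps_rooted p v (A.filter fun w => ¬ G.Adj v w) (Aᶜ.filter fun w => G.Adj v w)
    S₁ (by
      intro φ hφ
      obtain ⟨hφS, hside⟩ := Finset.mem_filter.1 hφ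
      refine ⟨(hS φ hφS).2, fun r hr he => ?_, fun r he => ?_⟩
      · rw [Finset.mem_filter, hadj φ hφS]
        exact ⟨(hside r hr).2 he, by simpa using he⟩
      · rw [Finset.mem_filter, hadj φ hφS, Finset.mem_compl]
        refine ⟨fun h => he ((hside r ?_).1 h), he⟩
        rintro rfl
        exact he rfl)
  have h2 := card_maps_rooted p v (Aᶜ.filter fun w => ¬ G.Adj v w) (A.filter fun w => G.Adj v w)
    S₂ (by
      intro φ hφ
      obtain ⟨hφS, hside⟩ := Finset.mem_filter.1 hφ
      refine ⟨(hS φ hφS).2, fun r hr he => ?_, fun r he => ?_⟩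
      · rw [Finset.mem_filter, hadj φ hφS, Finset.mem_compl]
        exact ⟨(hside r hr).2 he, by simpa using he⟩
      · rw [Finset.mem_filter, hadj φ hφS]
        refine ⟨by_contra fun h => he ((hside r ?_).1 h), he⟩
        rintro rfl
        exact he rfl)
  have h1' : (S₁.card : ℝ) ≤ _ := Nat.cast_le.2 h1
  have h2' : (S₂.card : ℝ) ≤ _ := Nat.cast_le.2 h2
  push_cast at h1' h2'
  rw [cX, cY, ← hx, ← ha, ← hb] at h1'
  rw [cX, cY, hxc, ← ha, ← hb] at h2'
  have e : ∀ (i j : ℕ) (y z : ℝ), 1 ≤ i → (n * y) ^ (i - 1) * (n * z) ^ j =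
      y ^ (i - 1) * z ^ j / n * n ^ (i + j) := by
    intro i j y z hi
    obtain ⟨i, rfl⟩ := Nat.exists_eq_add_of_le' hi
    rw [Nat.add_sub_cancel]
    field_simp
    ring
  refine hcard.trans ?_
  rw [add_comm (S₀.card : ℝ)]
  refine add_le_add ?_ h0
  rcases p with p | p
  · have hs : 1 ≤ s := by have := p.2; omega
    simp only [bipSide_inl, if_true] at h1' h2' ⊢
    rw [e _ _ _ _ hs] at h1' h2'
    calc _ ≤ _ := add_le_add h1' h2'
      _ = _ := by ring
  · have ht : 1 ≤ t := by have := p.2; omega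
    simp only [bipSide_inr, Bool.false_eq_true, if_false] at h1' h2' ⊢
    rw [e _ _ _ _ ht, add_comm t s] at h1' h2'
    calc _ ≤ _ := add_le_add h1' h2'
      _ = _ := by ring

theorem card_copiesThrough_le [Fintype V] [Nonempty V] [DecidableEq V] {s t : ℕ} (hst : 3 ≤ s + t)
    (G : SimpleGraph V) (A : Finset V) (v : V) :
    ((copiesThrough (bipSide s t) G v).card : ℝ) ≤
      (attachDensity s t (A.card / Fintype.card V) (nbrProportion G A v) (nbrProportion G Aᶜ v) +
        ((s : ℝ) + t) ^ 3 * ((diffPairs G (splitGraph A)).card / (Fintype.card V : ℝ) ^ 2)) /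
        Fintype.card V * (Fintype.card V : ℝ) ^ (s + t) := by
  have hn : (0 : ℝ) < Fintype.card V := by exact_mod_cast Fintype.card_pos
  classical
  have hsub : copiesThrough (bipSide s t) G v ⊆ Finset.univ.biUnion fun p =>
      (copies (bipSide s t) G).filter fun φ => φ p = v := by
    intro φ hφ
    simp only [copiesThrough, Finset.mem_filter] at hφ
    obtain ⟨h, p, hp⟩ := hφ
    simp only [Finset.mem_biUnion, Finset.mem_univ, true_and, Finset.mem_filter]
    exact ⟨p, h, hp⟩
  have hle : ((copiesThrough (bipSide s t) G v).card : ℝ) ≤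
      ∑ p, (((copies (bipSide s t) G).filter fun φ => φ p = v).card : ℝ) := by
    exact_mod_cast (Finset.card_le_card hsub).trans Finset.card_biUnion_le
  refine hle.trans ((Finset.sum_le_sum fun p _ => card_copies_rooted_le hst G A v p _
    (fun φ hφ => Finset.mem_filter.1 hφ) rfl rfl rfl).trans (le_of_eq ?_))
  rw [Fintype.sum_sum_type]
  simp only [bipSide_inl, bipSide_inr, if_true, Bool.false_eq_true, if_false, Finset.sum_const,
    Finset.card_univ, Fintype.card_fin, nsmul_eq_mul, attachDensity]
  field_simp
  ring

end VertexBound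

/-! ### Wrong degrees with respect to an optimal partition. -/

section WrongDegree

variable {V : Type} [Fintype V]

open Classical in
/-- The vertices `w` such that `G` and `H` disagree on the adjacency of `v` and `w`. -/
noncomputable def diffNbrs (G H : SimpleGraph V) (v : V) : Finset V :=
  Finset.univ.filter fun w => (v, w) ∈ diffPairs G H

theorem mem_diffNbrs {G H : SimpleGraph V} {v w : V} :
    w ∈ diffNbrs G H v ↔ ¬ (G.Adj v w ↔ H.Adj v w) := by
  simp [diffNbrs, mem_diffPairs]

/-- Pairs are ordered, so every wrong neighbour of `v` counts twice. -/
theorem card_diffPairs_eq [DecidableEq V] (G H : SimpleGraph V) (v : V) :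
    (diffPairs G H).card =
      ((diffPairs G H).filter fun z => z.1 ≠ v ∧ z.2 ≠ v).card + 2 * (diffNbrs G H v).card := by
  have h1 : (diffPairs G H).filter (fun z => ¬ (z.1 ≠ v ∧ z.2 ≠ v)) =
      ((diffNbrs G H v).image fun w => (v, w)) ∪ (diffNbrs G H v).image fun w => (w, v) := by
    ext ⟨x, y⟩
    simp only [Finset.mem_filter, Finset.mem_union, Finset.mem_image, Prod.mk.injEq, mem_diffNbrs,
      mem_diffPairs]
    constructor
    · rintro ⟨h, h'⟩
      by_cases hx : x = v
      · subst hx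
        exact Or.inl ⟨y, h, rfl, rfl⟩
      · have hy : y = v := by tauto
        subst hy
        exact Or.inr ⟨x, by rwa [G.adj_comm, H.adj_comm], rfl, rfl⟩
    · rintro (⟨w, h, rfl, rfl⟩ | ⟨w, h, rfl, rfl⟩)
      · simpa using h
      · rw [G.adj_comm, H.adj_comm]
        simpa using h
  have hdisj : Disjoint ((diffNbrs G H v).image fun w => (v, w))
      ((diffNbrs G H v).image fun w => (w, v)) := by
    rw [Finset.disjoint_left]
    rintro ⟨x, y⟩ h1 h2
    simp only [Finset.mem_image, Prod.mk.injEq, mem_diffNbrs] at h1 h2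
    obtain ⟨w, hw, rfl, rfl⟩ := h1
    obtain ⟨w', -, -, rfl⟩ := h2
    simp at hw
  rw [← Finset.card_filter_add_card_filter_not (s := diffPairs G H)
    (fun z => z.1 ≠ v ∧ z.2 ≠ v), h1, Finset.card_union_of_disjoint hdisj,
    Finset.card_image_of_injective _ (fun _ _ h => (Prod.mk.inj h).2),
    Finset.card_image_of_injective _ (fun _ _ h => (Prod.mk.inj h).1)]
  ring

theorem splitGraph_compl [DecidableEq V] (A : Finset V) : splitGraph Aᶜ = splitGraph A := by
  ext x y
  simp only [splitGraph_adj, Finset.mem_compl]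
  tauto

/-- Moving a vertex to the other part of an optimal partition does not reduce its wrong degree. -/
theorem card_diffNbrs_le_of_optimal [DecidableEq V] {G : SimpleGraph V} {A : Finset V}
    (hA : ∀ A', (diffPairs G (splitGraph A)).card ≤ (diffPairs G (splitGraph A')).card) (v : V) :
    (diffNbrs G (splitGraph A) v).card ≤
      ((diffNbrs G (splitGraph A) v)ᶜ.erase v).card := by
  set A' := symmDiff A {v} with hA'
  have hv : v ∈ A' ↔ v ∉ A := by simp [hA', Finset.mem_symmDiff]
  have hne : ∀ w, w ≠ v → (w ∈ A' ↔ w ∈ A) := by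
    intro w hw
    simp [hA', Finset.mem_symmDiff, hw]
  have h := hA A'
  rw [card_diffPairs_eq G _ v, card_diffPairs_eq G (splitGraph A') v] at h
  have e1 : (diffPairs G (splitGraph A)).filter (fun z => z.1 ≠ v ∧ z.2 ≠ v) =
      (diffPairs G (splitGraph A')).filter fun z => z.1 ≠ v ∧ z.2 ≠ v := by
    ext ⟨x, y⟩
    simp only [Finset.mem_filter, mem_diffPairs, splitGraph_adj]
    refine and_congr_left fun hz => ?_
    rw [hne x hz.1, hne y hz.2]
  have e2 : diffNbrs G (splitGraph A') v = (diffNbrs G (splitGraph A) v)ᶜ.erase v := by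
    ext w
    rw [Finset.mem_erase, Finset.mem_compl, mem_diffNbrs, mem_diffNbrs, splitGraph_adj,
      splitGraph_adj]
    by_cases hw : w = v
    · simp [hw]
    · rw [hv, hne w hw]
      tauto
  rw [e1, e2] at h
  omega

theorem card_diffNbrs_of_mem [DecidableEq V] [Nonempty V] {G : SimpleGraph V} {A : Finset V}
    (v : V) : ((diffNbrs G (splitGraph A) v).card : ℝ) = Fintype.card V *
      if v ∈ A then nbrProportion G A v + (1 - A.card / Fintype.card V - nbrProportion G Aᶜ v)
      else A.card / Fintype.card V - nbrProportion G A v + nbrProportion G Aᶜ v := by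
  classical
  have hn : (Fintype.card V : ℝ) ≠ 0 := by exact_mod_cast Fintype.card_ne_zero
  have hc : ((Aᶜ.card : ℕ) : ℝ) = Fintype.card V - A.card := by
    rw [Finset.card_compl, Nat.cast_sub (Finset.card_le_univ A)]
  have c1 : ∀ B : Finset V, ((B.filter fun w => G.Adj v w).card : ℝ) =
      Fintype.card V * nbrProportion G B v := by
    intro B
    rw [nbrProportion, mul_div_cancel₀ _ hn]
  have c2 : ∀ B : Finset V, ((B.filter fun w => ¬ G.Adj v w).card : ℝ) =
      B.card - Fintype.card V * nbrProportion G B v := by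
    intro B
    rw [← c1, eq_sub_iff_add_eq', ← Nat.cast_add, Finset.card_filter_add_card_filter_not]
  split_ifs with hv
  · have : diffNbrs G (splitGraph A) v =
        (A.filter fun w => G.Adj v w) ∪ Aᶜ.filter fun w => ¬ G.Adj v w := by
      ext w
      simp only [mem_diffNbrs, splitGraph_adj, Finset.mem_union, Finset.mem_filter,
        Finset.mem_compl]
      tauto
    rw [this, Finset.card_union_of_disjoint (Finset.disjoint_filter_filter disjoint_compl_right)]
    push_cast
    rw [c1, c2, hc]
    field_simp
  · have : diffNbrs G (splitGraph A) v =
        (Aᶜ.filter fun w => G.Adj v w) ∪ A.filter fun w => ¬ G.Adj v w := by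
      ext w
      simp only [mem_diffNbrs, splitGraph_adj, Finset.mem_union, Finset.mem_filter,
        Finset.mem_compl]
      tauto
    rw [this, Finset.card_union_of_disjoint (Finset.disjoint_filter_filter disjoint_compl_left)]
    push_cast
    rw [c1, c2]
    field_simp
    ring

/-- The two quantities add up to `1`. One is the normalised wrong degree of `v`, and the other, its
complement, is no smaller because moving `v` across does not improve the partition. -/
theorem le_of_optimal_of_le_card_diffNbrs [DecidableEq V] [Nonempty V] {G : SimpleGraph V}
    {A : Finset V}
    (hA : ∀ A', (diffPairs G (splitGraph A)).card ≤ (diffPairs G (splitGraph A')).card) {v : V}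
    {γ : ℝ} (hv : γ * Fintype.card V ≤ (diffNbrs G (splitGraph A) v).card) :
    γ ≤ nbrProportion G A v + (1 - A.card / Fintype.card V - nbrProportion G Aᶜ v) ∧
      γ ≤ A.card / Fintype.card V - nbrProportion G A v + nbrProportion G Aᶜ v := by
  have hn : (0 : ℝ) < Fintype.card V := by exact_mod_cast Fintype.card_pos
  have h1 := card_diffNbrs_of_mem (G := G) (A := A) v
  have h2 : ((diffNbrs G (splitGraph A) v).card : ℝ) ≤
      Fintype.card V - (diffNbrs G (splitGraph A) v).card := by
    have : (diffNbrs G (splitGraph A) v).card ≤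
        Fintype.card V - (diffNbrs G (splitGraph A) v).card := by
      rw [← Finset.card_compl]
      exact (card_diffNbrs_le_of_optimal hA v).trans (Finset.card_erase_le)
    have h3 : (diffNbrs G (splitGraph A) v).card ≤ Fintype.card V := Finset.card_le_univ _
    rw [← Nat.cast_sub h3]
    exact_mod_cast this
  rw [h1, mul_comm] at hv
  have h4 := le_of_mul_le_mul_left hv hn
  rw [h1] at h2
  split_ifs at h2 h4
  · exact ⟨h4, by nlinarith⟩
  · exact ⟨by nlinarith, h4⟩

end WrongDegree

/-! ### Correcting a single wrong pair. -/

section Flip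

variable {V : Type}

open Classical in
/-- The graph `G` with the adjacency of `u` and `v` changed to that in `H`. -/
noncomputable def adjustPair (G H : SimpleGraph V) (u v : V) : SimpleGraph V where
  Adj x y := if x = u ∧ y = v ∨ x = v ∧ y = u then H.Adj x y else G.Adj x y
  symm := ⟨fun x y h => by
    by_cases h1 : x = u ∧ y = v ∨ x = v ∧ y = u
    · have h2 : y = u ∧ x = v ∨ y = v ∧ x = u := by tauto
      rw [if_pos h1] at h
      rw [if_pos h2]
      exact h.symm
    · have h2 : ¬ (y = u ∧ x = v ∨ y = v ∧ x = u) := by tauto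
      rw [if_neg h1] at h
      rw [if_neg h2]
      exact h.symm⟩
  loopless := ⟨fun x h => by
    split_ifs at h
    · exact H.loopless.irrefl x h
    · exact G.loopless.irrefl x h⟩

theorem adjustPair_adj_of_not {G H : SimpleGraph V} {u v x y : V}
    (h : ¬ (x = u ∧ y = v ∨ x = v ∧ y = u)) : (adjustPair G H u v).Adj x y ↔ G.Adj x y := by
  simp only [adjustPair, if_neg h]

theorem adjustPair_adj (G H : SimpleGraph V) (u v : V) :
    (adjustPair G H u v).Adj u v ↔ H.Adj u v := by
  simp [adjustPair]

theorem diffPairs_adjustPair_subset [Fintype V] (G H : SimpleGraph V) (u v : V) :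
    diffPairs (adjustPair G H u v) H ⊆ diffPairs G H := by
  rintro ⟨x, y⟩ hxy
  rw [mem_diffPairs] at hxy ⊢
  by_cases h : x = u ∧ y = v ∨ x = v ∧ y = u
  · simp [adjustPair, if_pos h] at hxy
  · rwa [adjustPair_adj_of_not h] at hxy

theorem card_diffPairs_adjustPair_le [Fintype V] (G H : SimpleGraph V) (u v : V) :
    (diffPairs G (adjustPair G H u v)).card ≤ 2 := by
  classical
  have : diffPairs G (adjustPair G H u v) ⊆ {(u, v), (v, u)} := by
    rintro ⟨x, y⟩ hxy
    rw [mem_diffPairs] at hxy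
    by_contra h
    simp only [Finset.mem_insert, Finset.mem_singleton, Prod.mk.injEq] at h
    exact hxy (adjustPair_adj_of_not h).symm
  exact (Finset.card_le_card this).trans Finset.card_le_two

theorem card_copies_adjustPair [Fintype V] {ι : Type} [Fintype ι] (l : ι → Bool) (G H : SimpleGraph V)
    (u v : V) :
    (copies l (adjustPair G H u v)).card + (copiesThroughPair l G u v).card =
      (copies l G).card + (copiesThroughPair l (adjustPair G H u v) u v).card := by
  classical
  have split : ∀ K : SimpleGraph V, (copies l K).card = (copiesThroughPair l K u v).card +
      ((copies l K).filter fun φ => ¬ ((∃ p, φ p = u) ∧ ∃ p, φ p = v)).card := by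
    intro K
    have e : copiesThroughPair l K u v =
        (copies l K).filter fun φ => (∃ p, φ p = u) ∧ ∃ p, φ p = v := by
      ext
      simp [copiesThroughPair]
    rw [e, Finset.card_filter_add_card_filter_not]
  have h : ((copies l G).filter fun φ => ¬ ((∃ p, φ p = u) ∧ ∃ p, φ p = v)) =
      (copies l (adjustPair G H u v)).filter fun φ => ¬ ((∃ p, φ p = u) ∧ ∃ p, φ p = v) := by
    ext φ
    simp only [Finset.mem_filter, mem_copies]
    refine and_congr_left fun h => and_congr_right fun _ => forall_congr' fun p =>
      forall_congr' fun q => ?_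
    rw [adjustPair_adj_of_not]
    rintro (⟨h1, h2⟩ | ⟨h1, h2⟩)
    · exact h ⟨⟨p, h1⟩, q, h2⟩
    · exact h ⟨⟨q, h2⟩, p, h1⟩
  have h1 := split G
  have h2 := split (adjustPair G H u v)
  rw [h] at h1
  omega

/-- Adjacency in a copy and in `splitGraph A` both mean having different colours, and among three
vertices two such relations determine the third. So a third vertex of a copy through the wrong pair
is a wrong neighbour of `u` or `v`, which leaves at most `2 * γ * n` choices for it. -/
theorem card_copiesThroughPair_wrong_le [Fintype V] [Nonempty V] {s t : ℕ} (hst : 3 ≤ s + t)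
    {G : SimpleGraph V} {A : Finset V} {u v : V} (huv : (u, v) ∈ diffPairs G (splitGraph A))
    {γ : ℝ} (hγ : ∀ w, ((diffNbrs G (splitGraph A) w).card : ℝ) ≤ γ * Fintype.card V) :
    ((copiesThroughPair (bipSide s t) G u v).card : ℝ) ≤ ((s : ℝ) + t) ^ 2 *
      (2 * γ / (Fintype.card V : ℝ) ^ 2 * (Fintype.card V : ℝ) ^ (s + t)) := by
  classical
  have hn : (0 : ℝ) < Fintype.card V := by exact_mod_cast Fintype.card_pos
  have hγ0 : 0 ≤ γ := by
    have := (Nat.cast_nonneg _).trans (hγ u)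
    exact nonneg_of_mul_nonneg_left this hn
  have := card_le_of_cover (X := (Fin s ⊕ Fin t) × (Fin s ⊕ Fin t))
    (copiesThroughPair (bipSide s t) G u v) (fun z φ => φ z.1 = u ∧ φ z.2 = v)
    (b := 2 * γ / (Fintype.card V : ℝ) ^ 2 * (Fintype.card V : ℝ) ^ (s + t)) ?_ ?_
  · simpa [sq] using this
  · intro φ hφ
    simp only [copiesThroughPair, Finset.mem_filter] at hφ
    obtain ⟨-, ⟨p, hp⟩, q, hq⟩ := hφ
    exact ⟨(p, q), hp, hq⟩
  · rintro ⟨p, q⟩ S' hS'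
    rcases S'.eq_empty_or_nonempty with rfl | ⟨φ₀, hφ₀⟩
    · simp only [Finset.card_empty, Nat.cast_zero]
      positivity
    have hpq : p ≠ q := by
      rintro rfl
      have h := (hS' φ₀ hφ₀).2
      have : u = v := h.1.symm.trans h.2
      subst this
      simp [mem_diffPairs] at huv
    obtain ⟨r, hr⟩ : ∃ r, r ∉ ({p, q} : Finset (Fin s ⊕ Fin t)) := by
      by_contra! h
      have h1 := Finset.card_le_card (fun r _ => h r : Finset.univ ⊆ ({p, q} : Finset _))
      rw [Finset.card_univ, Fintype.card_sum, Fintype.card_fin, Fintype.card_fin] at h1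
      have := h1.trans Finset.card_le_two
      omega
    simp only [Finset.mem_insert, Finset.mem_singleton, not_or] at hr
    have hT : ((diffNbrs G (splitGraph A) u ∪ diffNbrs G (splitGraph A) v).card : ℝ) ≤
        2 * γ * Fintype.card V := by
      have : ((diffNbrs G (splitGraph A) u ∪ diffNbrs G (splitGraph A) v).card : ℝ) ≤
          (diffNbrs G (splitGraph A) u).card + (diffNbrs G (splitGraph A) v).card := by
        exact_mod_cast Finset.card_union_le _ _
      linarith [hγ u, hγ v]
    have := card_maps_one_one_mem_le hpq (Ne.symm hr.1) (Ne.symm hr.2) u v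
      (diffNbrs G (splitGraph A) u ∪ diffNbrs G (splitGraph A) v) S' (by
        intro φ hφ
        obtain ⟨h1, hp, hq⟩ := hS' φ hφ
        refine ⟨hp, hq, ?_⟩
        simp only [copiesThroughPair, Finset.mem_filter, mem_copies] at h1
        rw [Finset.mem_union, mem_diffNbrs, mem_diffNbrs]
        by_contra! hcon
        refine mem_diffPairs.1 huv ?_
        obtain ⟨c1, c2⟩ := hcon
        have bool : ∀ a b c x y z : Bool, (a ≠ c ↔ x ≠ z) → (b ≠ c ↔ y ≠ z) →
            (a ≠ b ↔ x ≠ y) := by decide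
        have a1 := h1.1.2 p r
        have a2 := h1.1.2 q r
        have a3 := h1.1.2 p q
        rw [hp] at a1 a3
        rw [hq] at a2 a3
        have conv : ∀ x y : V, (splitGraph A).Adj x y ↔ decide (x ∈ A) ≠ decide (y ∈ A) := by
          intro x y
          simp
        rw [a1, conv] at c1
        rw [a2, conv] at c2
        rw [a3, conv]
        exact bool _ _ _ _ _ _ c1 c2)
    refine this.trans ?_
    simp only [Fintype.card_sum, Fintype.card_fin]
    refine mul_le_mul_of_nonneg_right ?_ (by positivity)
    rw [div_le_div_iff₀ (by positivity) (by positivity)]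
    calc _ ≤ 2 * γ * Fintype.card V * (Fintype.card V : ℝ) ^ 2 :=
          mul_le_mul_of_nonneg_right hT (by positivity)
      _ = _ := by ring

theorem prod_ite_two {κ : Type} [Fintype κ] [DecidableEq κ] {p q : κ} (hpq : p ≠ q) (c : ℝ) :
    ∏ r : κ, (if r = p ∨ r = q then 1 else c) = c ^ (Fintype.card κ - 2) := by
  rw [Finset.prod_ite, Finset.prod_const_one, one_mul, Finset.prod_const]
  congr 1
  have : (Finset.univ.filter fun r => ¬ (r = p ∨ r = q)) = Finset.univ \ {p, q} := by
    ext r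
    simp
  rw [this, Finset.card_sdiff_of_subset (Finset.subset_univ _), Finset.card_univ,
    Finset.card_pair hpq]

/-- A lower bound for the number of copies through a pair on which `G` agrees with a complete
bipartite graph `splitGraph O` to which it is close. -/
theorem le_card_copiesThroughPair [Fintype V] [Nonempty V] [DecidableEq V] {s t : ℕ} {G G₀ : SimpleGraph V}
    {O : Finset V} {u v : V} (huv : u ≠ v) {p q : Fin s ⊕ Fin t} (hpq : p ≠ q)
    (hp : u ∈ O ↔ bipSide s t p = true) (hq : v ∈ O ↔ bipSide s t q = true)
    (hsub : diffPairs G (splitGraph O) ⊆ diffPairs G₀ (splitGraph O))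
    (hgood : (u, v) ∉ diffPairs G (splitGraph O)) {θ γ : ℝ}
    (hγ : ∀ w, ((diffNbrs G₀ (splitGraph O) w).card : ℝ) ≤ γ * Fintype.card V) (hθ0 : 0 ≤ θ)
    (hθ : θ * Fintype.card V ≤ O.card) (hθ' : θ * Fintype.card V ≤ Oᶜ.card) :
    (θ ^ (s + t - 2) - ((s : ℝ) + t) ^ 2 * (γ + 1 / Fintype.card V +
      ((diffPairs G₀ (splitGraph O)).card / (Fintype.card V : ℝ) ^ 2 + 1 / Fintype.card V))) /
        (Fintype.card V : ℝ) ^ 2 * (Fintype.card V : ℝ) ^ (s + t) ≤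
      (copiesThroughPair (bipSide s t) G u v).card := by
  classical
  have hn : (0 : ℝ) < Fintype.card V := by exact_mod_cast Fintype.card_pos
  have hγ0 : 0 ≤ γ := by
    have := (Nat.cast_nonneg _).trans (hγ u)
    exact nonneg_of_mul_nonneg_left this hn
  set n : ℝ := (Fintype.card V : ℝ) with hn_def
  set K := splitGraph O
  -- Candidate maps: `p` and `q` go to `u` and `v`, every other vertex goes anywhere in its own
  -- part. There are at least `(θ * n) ^ (s + t - 2)` of them, and the ones that fail to be copies
  -- are subtracted.
  set S : Finset (Fin s ⊕ Fin t → V) := Fintype.piFinset fun r =>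
    if r = p then {u} else if r = q then {v} else if bipSide s t r then O else Oᶜ with hS
  have hSp : ∀ φ ∈ S, φ p = u := by
    intro φ hφ
    have := Fintype.mem_piFinset.1 hφ p
    simpa using this
  have hSq : ∀ φ ∈ S, φ q = v := by
    intro φ hφ
    have := Fintype.mem_piFinset.1 hφ q
    simpa [hpq.symm] using this
  have hSO : ∀ φ ∈ S, ∀ r, φ r ∈ O ↔ bipSide s t r = true := by
    intro φ hφ r
    by_cases h1 : r = p
    · rw [h1, hSp φ hφ, hp]
    by_cases h2 : r = q
    · rw [h2, hSq φ hφ, hq]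
    have := Fintype.mem_piFinset.1 hφ r
    rw [if_neg h1, if_neg h2] at this
    split_ifs at this with h3
    · simp [this, h3]
    · rw [Finset.mem_compl] at this
      simp [this, h3]
  have hK : ∀ φ ∈ S, ∀ a b, K.Adj (φ a) (φ b) ↔ bipSide s t a ≠ bipSide s t b := by
    intro φ hφ a b
    rw [splitGraph_adj, hSO φ hφ, hSO φ hφ]
    cases bipSide s t a <;> cases bipSide s t b <;> simp
  have hk : 2 ≤ s + t := by
    have : 1 < Fintype.card (Fin s ⊕ Fin t) := Fintype.one_lt_card_iff.2 ⟨p, q, hpq⟩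
    simp only [Fintype.card_sum, Fintype.card_fin] at this
    omega
  have hcard : θ ^ (s + t - 2) / n ^ 2 * n ^ (s + t) ≤ S.card := by
    have e : θ ^ (s + t - 2) / n ^ 2 * n ^ (s + t) = (θ * n) ^ (s + t - 2) := by
      obtain ⟨k, hk'⟩ := Nat.exists_eq_add_of_le hk
      rw [hk', Nat.add_sub_cancel_left, mul_pow, pow_add]
      field_simp
    have e2 := prod_ite_two hpq (θ * n)
    rw [Fintype.card_sum, Fintype.card_fin, Fintype.card_fin] at e2
    rw [e, ← e2, hS, Fintype.card_piFinset]
    push_cast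
    refine Finset.prod_le_prod (fun r _ => by positivity) fun r _ => ?_
    by_cases h1 : r = p
    · simp [h1]
    by_cases h2 : r = q
    · simp [h2, hpq.symm]
    simp only [h1, h2, or_self, if_false]
    split_ifs
    · exact hθ
    · exact hθ'
  -- The diagonal is added to the wrong pairs to account for failures of injectivity.
  set D : Finset (V × V) := diffPairs G K ∪ Finset.univ.image fun w => (w, w)
  have hD : (D.card : ℝ) ≤ (diffPairs G₀ K).card + n := by
    have h1 := Finset.card_union_le (diffPairs G K) (Finset.univ.image fun w => (w, w))
    have h2 := Finset.card_le_card hsub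
    have h3 : (Finset.univ.image fun w : V => (w, w)).card ≤ Fintype.card V :=
      Finset.card_image_le
    rw [hn_def]
    exact_mod_cast (h1.trans (add_le_add h2 h3))
  -- `b₁` bounds the maps with a bad pair at positions of which exactly one is `p` or `q`, `b₂`
  -- those with a bad pair away from `p` and `q`. The pair `(u, v)` itself is not bad.
  set b₁ : ℝ := (γ * n + 1) / n ^ 3 * n ^ (s + t)
  set b₂ : ℝ := ((diffPairs G₀ K).card + n) / n ^ 4 * n ^ (s + t)
  have hb₁ : 0 ≤ b₁ := by positivity
  have hb₂ : 0 ≤ b₂ := by positivity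
  have hTcard : ∀ w, ((insert w (diffNbrs G₀ K w)).card : ℝ) ≤ γ * n + 1 := by
    intro w
    have : ((insert w (diffNbrs G₀ K w)).card : ℝ) ≤ (diffNbrs G₀ K w).card + 1 := by
      exact_mod_cast Finset.card_insert_le _ _
    linarith [hγ w]
  have hDT : ∀ x y, (x, y) ∈ D → y ∈ insert x (diffNbrs G₀ K x) := by
    intro x y h
    rcases Finset.mem_union.1 h with h | h
    · refine Finset.mem_insert_of_mem (mem_diffNbrs.2 (mem_diffPairs.1 (hsub h)))
    · simp only [Finset.mem_image, Finset.mem_univ, true_and, Prod.mk.injEq] at h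
      obtain ⟨w, rfl, rfl⟩ := h
      simp
  have hDsymm : ∀ x y, (x, y) ∈ D → (y, x) ∈ D := by
    intro x y h
    rcases Finset.mem_union.1 h with h | h
    · refine Finset.mem_union_left _ ?_
      rw [mem_diffPairs] at h ⊢
      rwa [G.adj_comm, K.adj_comm]
    · simp only [Finset.mem_image, Finset.mem_univ, true_and, Prod.mk.injEq] at h
      obtain ⟨w, rfl, rfl⟩ := h
      exact Finset.mem_union_right _ (by simp)
  have huvD : (u, v) ∉ D := by
    simp only [D, Finset.mem_union, hgood, false_or, Finset.mem_image, Finset.mem_univ, true_and,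
      Prod.mk.injEq, not_exists]
    rintro w ⟨rfl, h⟩
    exact huv h
  have hbad : ((S \ copiesThroughPair (bipSide s t) G u v).card : ℝ) ≤
      ((s : ℝ) + t) ^ 2 * (b₁ + b₂) := by
    have := card_le_of_cover (X := (Fin s ⊕ Fin t) × (Fin s ⊕ Fin t))
      (S \ copiesThroughPair (bipSide s t) G u v)
      (fun z φ => z.1 ≠ z.2 ∧ (φ z.1, φ z.2) ∈ D) (b := b₁ + b₂) ?_ ?_
    · simpa [sq] using this
    · intro φ hφ
      rw [Finset.mem_sdiff] at hφ
      obtain ⟨hφS, hφ⟩ := hφ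
      by_contra! hcon
      refine hφ ?_
      simp only [copiesThroughPair, Finset.mem_filter, mem_copies]
      refine ⟨⟨fun a b hab => ?_, fun a b => ?_⟩, ⟨p, hSp φ hφS⟩, q, hSq φ hφS⟩
      · by_contra hne
        refine hcon (a, b) hne (Finset.mem_union_right _ ?_)
        simp [hab]
      · by_cases hne : a = b
        · simp [hne]
        · have := hcon (a, b) hne
          rw [Finset.mem_union, not_or, mem_diffPairs, not_not] at this
          rw [this.1, hK φ hφS]
    · rintro ⟨a, b⟩ S' hS'
      have hS'S : ∀ φ ∈ S', φ ∈ S := fun φ hφ => (Finset.mem_sdiff.1 (hS' φ hφ).1).1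
      have one : ∀ {a' : Fin s ⊕ Fin t}, p ≠ a' → q ≠ a' → ∀ w,
          (∀ φ ∈ S', φ a' ∈ insert w (diffNbrs G₀ K w)) → (S'.card : ℝ) ≤ b₁ + b₂ := by
        intro a' h1 h2 w h3
        have := card_maps_one_one_mem_le hpq h1 h2 u v (insert w (diffNbrs G₀ K w)) S'
          fun φ hφ => ⟨hSp φ (hS'S φ hφ), hSq φ (hS'S φ hφ), h3 φ hφ⟩
        rw [Fintype.card_sum, Fintype.card_fin, Fintype.card_fin] at this
        have h4 : ((insert w (diffNbrs G₀ K w)).card : ℝ) / n ^ 3 * n ^ (s + t) ≤ b₁ := by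
          refine mul_le_mul_of_nonneg_right (div_le_div_of_nonneg_right (hTcard w) ?_) ?_ <;>
            positivity
        linarith
      have none : (∀ φ ∈ S', False) → (S'.card : ℝ) ≤ b₁ + b₂ := by
        intro h
        rw [Finset.eq_empty_of_forall_notMem h]
        simp only [Finset.card_empty, Nat.cast_zero]
        positivity
      by_cases hab : a = b
      · exact none fun φ hφ => (hS' φ hφ).2.1 hab
      by_cases hap : a = p
      · by_cases hbq : b = q
        · refine none fun φ hφ => huvD ?_
          have := (hS' φ hφ).2.2
          rwa [hap, hbq, hSp φ (hS'S φ hφ), hSq φ (hS'S φ hφ)] at this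
        · refine one (hap ▸ hab) (Ne.symm hbq) u fun φ hφ => hDT _ _ ?_
          have := (hS' φ hφ).2.2
          rwa [hap, hSp φ (hS'S φ hφ)] at this
      by_cases haq : a = q
      · by_cases hbp : b = p
        · refine none fun φ hφ => huvD (hDsymm _ _ ?_)
          have := (hS' φ hφ).2.2
          rwa [haq, hbp, hSp φ (hS'S φ hφ), hSq φ (hS'S φ hφ)] at this
        · refine one (Ne.symm hbp) (haq ▸ hab) v fun φ hφ => hDT _ _ ?_
          have := (hS' φ hφ).2.2
          rwa [haq, hSq φ (hS'S φ hφ)] at this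
      by_cases hbp : b = p
      · refine one (Ne.symm hap) (Ne.symm haq) u fun φ hφ => hDT _ _ (hDsymm _ _ ?_)
        have := (hS' φ hφ).2.2
        rwa [hbp, hSp φ (hS'S φ hφ)] at this
      by_cases hbq : b = q
      · refine one (Ne.symm hap) (Ne.symm haq) v fun φ hφ => hDT _ _ (hDsymm _ _ ?_)
        have := (hS' φ hφ).2.2
        rwa [hbq, hSq φ (hS'S φ hφ)] at this
      have := card_maps_one_one_pair_le hpq (Ne.symm hap) (Ne.symm haq) (Ne.symm hbp)
        (Ne.symm hbq) hab u v D S' fun φ hφ =>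
          ⟨hSp φ (hS'S φ hφ), hSq φ (hS'S φ hφ), (hS' φ hφ).2.2⟩
      rw [Fintype.card_sum, Fintype.card_fin, Fintype.card_fin] at this
      have h4 : (D.card : ℝ) / n ^ 4 * n ^ (s + t) ≤ b₂ := by
        refine mul_le_mul_of_nonneg_right (div_le_div_of_nonneg_right hD ?_) ?_ <;> positivity
      linarith
  have hfin : (S.card : ℝ) ≤ (S \ copiesThroughPair (bipSide s t) G u v).card +
      (copiesThroughPair (bipSide s t) G u v).card := by
    have hsub : S ⊆ (S \ copiesThroughPair (bipSide s t) G u v) ∪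
        copiesThroughPair (bipSide s t) G u v := by
      intro φ hφ
      by_cases h : φ ∈ copiesThroughPair (bipSide s t) G u v <;> simp [h, hφ]
    exact_mod_cast (Finset.card_le_card hsub).trans (Finset.card_union_le _ _)
  have e : (θ ^ (s + t - 2) - ((s : ℝ) + t) ^ 2 * (γ + 1 / n +
      ((diffPairs G₀ K).card / n ^ 2 + 1 / n))) / n ^ 2 * n ^ (s + t) =
      θ ^ (s + t - 2) / n ^ 2 * n ^ (s + t) - ((s : ℝ) + t) ^ 2 * (b₁ + b₂) := by
    simp only [b₁, b₂]
    field_simp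
  rw [e]
  linarith

end Flip

/-! ### Gainful edits near the optimal bipartition. -/

section Improvement

variable {V : Type} [Fintype V] [Nonempty V]

/-- Replacing a vertex with few copies by a clone of one with many. -/
theorem exists_clone_improvement {s t : ℕ} (hst : 3 ≤ s + t) {G : SimpleGraph V} (v : V)
    {M δ D : ℝ} (hG : (M - δ) * (Fintype.card V : ℝ) ^ (s + t) ≤ (copies (bipSide s t) G).card)
    (hv : ((copiesThrough (bipSide s t) G v).card : ℝ) ≤
      D / Fintype.card V * (Fintype.card V : ℝ) ^ (s + t)) :
    ∃ G', (diffPairs G G').card ≤ 2 * Fintype.card V ∧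
      (copies (bipSide s t) G).card + (((s : ℝ) + t) * (M - δ) - D -
        ((s : ℝ) + t) ^ 2 / Fintype.card V) / Fintype.card V * (Fintype.card V : ℝ) ^ (s + t) ≤
      (copies (bipSide s t) G').card := by
  classical
  have hn : (0 : ℝ) < Fintype.card V := by exact_mod_cast Fintype.card_pos
  -- Replacing `v` by a clone of `w` gains at least the average number of copies per vertex, up to
  -- the copies through `v` and those through both vertices.
  obtain ⟨w, hw⟩ := exists_card_copiesThrough_ge (bipSide s t) G
  set n : ℝ := (Fintype.card V : ℝ) with hn_def
  have hK : (0 : ℝ) < (s : ℝ) + t := by exact_mod_cast (by omega : 0 < s + t)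
  have hpow : 0 < n ^ (s + t) := by positivity
  have hw' : ((s : ℝ) + t) * (copies (bipSide s t) G).card ≤
      n * (copiesThrough (bipSide s t) G w).card := by
    rw [Fintype.card_sum, Fintype.card_fin, Fintype.card_fin] at hw
    rw [hn_def]
    exact_mod_cast hw
  have hw2 : ((s : ℝ) + t) * (M - δ) / n * n ^ (s + t) ≤
      (copiesThrough (bipSide s t) G w).card := by
    rw [div_mul_eq_mul_div, div_le_iff₀ hn]
    calc _ = ((s : ℝ) + t) * ((M - δ) * n ^ (s + t)) := by ring
      _ ≤ ((s : ℝ) + t) * (copies (bipSide s t) G).card := mul_le_mul_of_nonneg_left hG hK.le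
      _ ≤ _ := hw'.trans_eq (mul_comm _ _)
  have hsplit : (((s : ℝ) + t) * (M - δ) - D - ((s : ℝ) + t) ^ 2 / n) / n * n ^ (s + t) =
      ((s : ℝ) + t) * (M - δ) / n * n ^ (s + t) - D / n * n ^ (s + t) -
      ((s : ℝ) + t) ^ 2 * (1 / n ^ 2 * n ^ (s + t)) := by
    field_simp
  have hnonneg : 0 ≤ ((s : ℝ) + t) ^ 2 * (1 / n ^ 2 * n ^ (s + t)) := by positivity
  by_cases hvw : v = w
  · subst hvw
    refine ⟨G, by simp [diffPairs_self], ?_⟩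
    rw [hsplit]
    linarith
  · refine ⟨G.replaceVertex w v, card_diffPairs_replaceVertex G v w, ?_⟩
    have h1 := card_copies_clone (bipSide s t) G hvw
    have h2 := card_copiesThroughPair_le (bipSide s t) G hvw
    rw [Fintype.card_sum, Fintype.card_fin, Fintype.card_fin, Nat.cast_add, ← hn_def] at h2
    have h3 : ((copies (bipSide s t) G).card : ℝ) + (copiesThrough (bipSide s t) G w).card ≤
        (copies (bipSide s t) (G.replaceVertex w v)).card +
          (copiesThrough (bipSide s t) G v).card +
          (copiesThroughPair (bipSide s t) G v w).card := by
      exact_mod_cast (le_of_add_le_left h1)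
    rw [hsplit]
    linarith

/-- Correcting a wrong pair, when all wrong degrees are small. -/
theorem exists_flip_improvement [DecidableEq V] {s t : ℕ} (hs : 1 ≤ s) (ht : 2 ≤ t)
    {G : SimpleGraph V} {A : Finset V} {u v : V} (huv : (u, v) ∈ diffPairs G (splitGraph A))
    {θ γ : ℝ} (hγ : ∀ w, ((diffNbrs G (splitGraph A) w).card : ℝ) ≤ γ * Fintype.card V)
    (hθ0 : 0 ≤ θ) (hθ : θ * Fintype.card V ≤ A.card) (hθ' : θ * Fintype.card V ≤ Aᶜ.card) :
    ∃ G', (diffPairs G G').card ≤ 2 ∧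
      (copies (bipSide s t) G).card + (θ ^ (s + t - 2) - ((s : ℝ) + t) ^ 2 *
        (3 * γ + (diffPairs G (splitGraph A)).card / (Fintype.card V : ℝ) ^ 2 +
          2 / Fintype.card V)) / (Fintype.card V : ℝ) ^ 2 * (Fintype.card V : ℝ) ^ (s + t) ≤
      (copies (bipSide s t) G').card := by
  have hn : (0 : ℝ) < Fintype.card V := by exact_mod_cast Fintype.card_pos
  have hne : u ≠ v := by
    rintro rfl
    simp [mem_diffPairs] at huv
  set G' := adjustPair G (splitGraph A) u v
  refine ⟨G', card_diffPairs_adjustPair_le _ _ _ _, ?_⟩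
  have hupper := card_copiesThroughPair_wrong_le (show 3 ≤ s + t by omega) huv hγ
  have hc := card_copies_adjustPair (bipSide s t) G (splitGraph A) u v
  have hlower : (θ ^ (s + t - 2) - ((s : ℝ) + t) ^ 2 * (γ + 1 / Fintype.card V +
      ((diffPairs G (splitGraph A)).card / (Fintype.card V : ℝ) ^ 2 + 1 / Fintype.card V))) /
        (Fintype.card V : ℝ) ^ 2 * (Fintype.card V : ℝ) ^ (s + t) ≤
      (copiesThroughPair (bipSide s t) G' u v).card := by
    have hsub : diffPairs G' (splitGraph A) ⊆ diffPairs G (splitGraph A) :=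
      diffPairs_adjustPair_subset G (splitGraph A) u v
    have hgood : (u, v) ∉ diffPairs G' (splitGraph A) := by
      rw [mem_diffPairs, not_not]
      exact adjustPair_adj G (splitGraph A) u v
    have hin : ∀ p q : Fin s ⊕ Fin t, p ≠ q → (u ∈ A ↔ bipSide s t p = true) →
        (v ∈ A ↔ bipSide s t q = true) → _ := fun p q hpq hp hq =>
      le_card_copiesThroughPair hne hpq hp hq hsub hgood hγ hθ0 hθ hθ'
    have hout : ∀ p q : Fin s ⊕ Fin t, p ≠ q → (u ∈ Aᶜ ↔ bipSide s t p = true) →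
        (v ∈ Aᶜ ↔ bipSide s t q = true) → _ := fun p q hpq hp hq => by
      rw [← splitGraph_compl A] at hsub hgood hγ
      have := le_card_copiesThroughPair hne hpq hp hq hsub hgood hγ hθ0 hθ' (by simpa using hθ)
      rwa [splitGraph_compl A] at this
    -- A pair across the partition is placed on the two sides. A pair inside a part is placed on the
    -- side of size `t`, which has two vertices; that side is mapped outside `O`, so `O` is then the
    -- other part.
    have p₀ : (Sum.inl ⟨0, hs⟩ : Fin s ⊕ Fin t) ≠ Sum.inr ⟨0, by omega⟩ := by simp
    have p₁ : (Sum.inr ⟨0, by omega⟩ : Fin s ⊕ Fin t) ≠ Sum.inr ⟨1, by omega⟩ := by simp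
    by_cases hu : u ∈ A <;> by_cases hv : v ∈ A
    · exact hout _ _ p₁ (by simp [hu]) (by simp [hv])
    · exact hin _ _ p₀ (by simp [hu]) (by simp [hv])
    · exact hout _ _ p₀ (by simp [hu]) (by simp [hv])
    · exact hin _ _ p₁ (by simp [hu]) (by simp [hv])
  have hc' : ((copies (bipSide s t) G').card : ℝ) + (copiesThroughPair (bipSide s t) G u v).card =
      (copies (bipSide s t) G).card + (copiesThroughPair (bipSide s t) G' u v).card := by
    exact_mod_cast hc
  have hsplit : (θ ^ (s + t - 2) - ((s : ℝ) + t) ^ 2 *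
        (3 * γ + (diffPairs G (splitGraph A)).card / (Fintype.card V : ℝ) ^ 2 +
          2 / Fintype.card V)) / (Fintype.card V : ℝ) ^ 2 * (Fintype.card V : ℝ) ^ (s + t) =
      (θ ^ (s + t - 2) - ((s : ℝ) + t) ^ 2 * (γ + 1 / Fintype.card V +
      ((diffPairs G (splitGraph A)).card / (Fintype.card V : ℝ) ^ 2 + 1 / Fintype.card V))) /
        (Fintype.card V : ℝ) ^ 2 * (Fintype.card V : ℝ) ^ (s + t) - ((s : ℝ) + t) ^ 2 *
      (2 * γ / (Fintype.card V : ℝ) ^ 2 * (Fintype.card V : ℝ) ^ (s + t)) := by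
    ring
  rw [hsplit]
  linarith

theorem nbrProportion_nonneg (G : SimpleGraph V) (A : Finset V) (v : V) :
    0 ≤ nbrProportion G A v := by
  unfold nbrProportion
  positivity

theorem nbrProportion_le (G : SimpleGraph V) (A : Finset V) (v : V) :
    nbrProportion G A v ≤ A.card / Fintype.card V := by
  classical
  unfold nbrProportion
  gcongr
  exact Finset.filter_subset _ _

/-- A graph close to an optimal complete bipartite graph, but not complete bipartite, has an edit
whose gain is at least proportional to its size. -/
theorem exists_improvement {s t : ℕ} (hs : 1 ≤ s) (hst : s ≤ t) (ht : 2 ≤ t) {α : ℝ}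
    (hα : IsOptimalSplit s t α) :
    ∃ ε > 0, ∃ δ > 0, ∃ c > 0, ∃ N : ℝ, ∀ (V : Type) [Fintype V] [Nonempty V]
      (G : SimpleGraph V), N ≤ Fintype.card V →
      (∃ A, ((diffPairs G (splitGraph A)).card : ℝ) ≤ ε * (Fintype.card V : ℝ) ^ 2) →
      (fKst s t α - δ) * (Fintype.card V : ℝ) ^ (s + t) ≤ (copies (bipSide s t) G).card →
      (∀ A, G ≠ splitGraph A) →
      ∃ G', ((copies (bipSide s t) G).card : ℝ) +
        c * ((diffPairs G G').card / (Fintype.card V : ℝ) ^ 2 * (Fintype.card V : ℝ) ^ (s + t)) <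
          (copies (bipSide s t) G').card := by
  have h1α := hα.lt_one
  have h2α := hα.half_le
  -- If the proportion of `A` is within `θ` of `α`, then both parts have proportion at least `θ`,
  -- because `1 - α ≤ α`.
  set θ : ℝ := (1 - α) / 2 with hθ
  have hθ0 : 0 < θ := by rw [hθ]; linarith
  set κ : ℝ := θ ^ (s + t - 2)
  have hκ : 0 < κ := by positivity
  set K : ℝ := (s : ℝ) + t with hK
  have hK1 : 1 ≤ K := by
    have : (1 : ℝ) ≤ s := by exact_mod_cast hs
    have : (0 : ℝ) ≤ t := Nat.cast_nonneg t
    linarith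
  have hK0 : 0 < K := by linarith
  -- With this choice the loss `3 * K ^ 2 * γ` in a flip is `κ / 4`.
  set γ : ℝ := κ / (12 * K ^ 2) with hγ
  have hγ0 : 0 < γ := by positivity
  obtain ⟨c, hc, hattach⟩ := exists_attachDensity_le hs hst ht hα hγ0
  obtain ⟨δ', hδ', hnear⟩ := exists_nearSplit hs hst ht hα (η := min c θ) (lt_min hc hθ0)
  -- The error terms become at most `c / 8` or `κ / 16` each. A clone then gains more than `c / 4`
  -- and a flip more than `κ / 4`, in their respective scales, while edits of `2 * n` and `2`
  -- ordered pairs are charged at most these amounts. The bounds by `δ'` force the proportions of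
  -- the best partition to be near `α` and `1 - α`.
  set ε : ℝ := min (κ / (16 * K ^ 2)) (min (c / (8 * K ^ 3)) (δ' / (2 * K ^ 2))) with hε
  have hε0 : 0 < ε := by positivity
  set δ : ℝ := min (c / (8 * K)) (δ' / 2)
  have hδ0 : 0 < δ := by positivity
  set τ : ℝ := min (κ / (16 * K ^ 2)) (c / (8 * K ^ 2))
  have hτ0 : 0 < τ := by positivity
  have eε1 : K ^ 2 * ε ≤ κ / 16 := by
    have := min_le_left (κ / (16 * K ^ 2)) (min (c / (8 * K ^ 3)) (δ' / (2 * K ^ 2)))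
    rw [← hε, le_div_iff₀ (by positivity)] at this
    linarith
  have eε2 : K ^ 3 * ε ≤ c / 8 := by
    have := (min_le_right (κ / (16 * K ^ 2)) (min (c / (8 * K ^ 3)) (δ' / (2 * K ^ 2)))).trans
      (min_le_left _ _)
    rw [← hε, le_div_iff₀ (by positivity)] at this
    linarith
  have eε3 : K ^ 2 * ε ≤ δ' / 2 := by
    have := (min_le_right (κ / (16 * K ^ 2)) (min (c / (8 * K ^ 3)) (δ' / (2 * K ^ 2)))).trans
      (min_le_right _ _)
    rw [← hε, le_div_iff₀ (by positivity)] at this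
    linarith
  have eδ1 : K * δ ≤ c / 8 := by
    have : δ ≤ c / (8 * K) := min_le_left _ _
    rw [le_div_iff₀ (by positivity)] at this
    linarith
  have eδ2 : δ ≤ δ' / 2 := min_le_right _ _
  have eτ1 : K ^ 2 * τ ≤ κ / 16 := by
    have : τ ≤ κ / (16 * K ^ 2) := min_le_left _ _
    rw [le_div_iff₀ (by positivity)] at this
    linarith
  have eτ2 : K ^ 2 * τ ≤ c / 8 := by
    have : τ ≤ c / (8 * K ^ 2) := min_le_right _ _
    rw [le_div_iff₀ (by positivity)] at this
    linarith
  have eγ : K ^ 2 * γ = κ / 12 := by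
    rw [hγ]
    field_simp
  refine ⟨ε, hε0, δ, hδ0, min (c / 8) (κ / 8), by positivity, 2 / τ, ?_⟩
  intro V _ _ G hN hclose hG hne
  classical
  have hn : (0 : ℝ) < Fintype.card V := by exact_mod_cast Fintype.card_pos
  have hst3 : 3 ≤ s + t := by omega
  -- choose the best partition, with the part `A` of size about `α n`
  obtain ⟨A, hA, hAα⟩ : ∃ A : Finset V,
      (∀ A', (diffPairs G (splitGraph A)).card ≤ (diffPairs G (splitGraph A')).card) ∧
      |(A.card : ℝ) / Fintype.card V - α| < min c θ := by
    obtain ⟨A, -, hA⟩ := Finset.exists_min_image (Finset.univ : Finset (Finset V))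
      (fun A => (diffPairs G (splitGraph A)).card) Finset.univ_nonempty
    have hopt : ∀ A', (diffPairs G (splitGraph A)).card ≤ (diffPairs G (splitGraph A')).card :=
      fun A' => hA A' (Finset.mem_univ _)
    set x : ℝ := (A.card : ℝ) / Fintype.card V with hx
    have hxc : (Aᶜ.card : ℝ) / Fintype.card V = 1 - x := by
      rw [hx, Finset.card_compl, Nat.cast_sub (Finset.card_le_univ A), sub_div, div_self hn.ne']
    have hw : ((diffPairs G (splitGraph A)).card : ℝ) / (Fintype.card V : ℝ) ^ 2 ≤ ε := by
      obtain ⟨A₀, hA₀⟩ := hclose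
      rw [div_le_iff₀ (by positivity)]
      exact (Nat.cast_le.2 (hopt A₀)).trans hA₀
    have h1 := card_copies_le_add (bipSide s t) G (splitGraph A)
    have h2 := card_copies_splitGraph_le hs (by omega : 1 ≤ t) A
    rw [Fintype.card_sum, Fintype.card_fin, Fintype.card_fin, Nat.cast_add, ← hK] at h1
    rw [← hx] at h2
    have hpow : (0 : ℝ) < (Fintype.card V : ℝ) ^ (s + t) := by positivity
    have h3 : (fKst s t α - δ) * (Fintype.card V : ℝ) ^ (s + t) ≤
        (fKst s t x + K ^ 2 * ε) * (Fintype.card V : ℝ) ^ (s + t) := by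
      have : K ^ 2 * (((diffPairs G (splitGraph A)).card : ℝ) / (Fintype.card V : ℝ) ^ 2 *
          (Fintype.card V : ℝ) ^ (s + t)) ≤ K ^ 2 * (ε * (Fintype.card V : ℝ) ^ (s + t)) := by
        gcongr
      linarith
    have h4 := le_of_mul_le_mul_right h3 hpow
    have hx0 : 0 ≤ x := by positivity
    have hx1 : 0 ≤ 1 - x := by
      rw [← hxc]
      positivity
    obtain ⟨p, q, rest, he, hp, hq⟩ := hnear (x ::ₘ (1 - x) ::ₘ 0) (by simp [hx0]; linarith)
      (by simp) (by
        rw [partiteDensity_pair]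
        change _ ≤ fKst s t x
        linarith)
    have hmem : p ∈ x ::ₘ (1 - x) ::ₘ 0 := by rw [he]; simp
    simp only [Multiset.mem_cons, Multiset.notMem_zero, or_false] at hmem
    -- Either `A` or its complement, which defines the same graph, has proportion near `α`.
    rcases hmem with rfl | rfl
    · exact ⟨A, hopt, hp⟩
    · refine ⟨Aᶜ, fun A' => ?_, by rwa [hxc]⟩
      rw [splitGraph_compl]
      exact hopt A'
  have hw : ((diffPairs G (splitGraph A)).card : ℝ) / (Fintype.card V : ℝ) ^ 2 ≤ ε := by
    obtain ⟨A₀, hA₀⟩ := hclose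
    rw [div_le_iff₀ (by positivity)]
    exact (Nat.cast_le.2 (hA A₀)).trans hA₀
  set n : ℝ := (Fintype.card V : ℝ) with hn_def
  have hpow : (0 : ℝ) < n ^ (s + t) := by positivity
  have hnτ : 2 / n ≤ τ := by
    rw [div_le_iff₀ hn]
    rw [div_le_iff₀ hτ0] at hN
    linarith
  set x : ℝ := (A.card : ℝ) / n with hx
  have hxc : (Aᶜ.card : ℝ) / n = 1 - x := by
    rw [hx, Finset.card_compl, Nat.cast_sub (Finset.card_le_univ A), sub_div, div_self hn.ne']
  have hAα' := abs_lt.1 hAα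
  have hminc : min c θ ≤ c := min_le_left _ _
  have hminθ : min c θ ≤ θ := min_le_right _ _
  have hxθ : θ ≤ x := by linarith
  have hxθ' : θ ≤ 1 - x := by linarith
  have hc8 : min (c / 8) (κ / 8) ≤ c / 8 := min_le_left _ _
  have hκ8 : min (c / 8) (κ / 8) ≤ κ / 8 := min_le_right _ _
  -- A vertex of large wrong degree is replaced by a clone of a better one; if there is none, any
  -- wrong pair can be corrected with profit.
  by_cases hbad : ∃ v, γ * n < (diffNbrs G (splitGraph A) v).card
  · obtain ⟨v, hv⟩ := hbad
    obtain ⟨g1, g2⟩ := le_of_optimal_of_le_card_diffNbrs hA hv.le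
    have hD := hattach x (nbrProportion G A v) (nbrProportion G Aᶜ v) (hAα.le.trans hminc)
      (by linarith) (by linarith) (nbrProportion_nonneg _ _ _) (nbrProportion_le _ _ _)
      (nbrProportion_nonneg _ _ _) (by rw [← hxc]; exact nbrProportion_le _ _ _) g1 g2
    obtain ⟨G', hd, hgain⟩ := exists_clone_improvement hst3 v hG
      (card_copiesThrough_le hst3 G A v)
    refine ⟨G', lt_of_lt_of_le (add_lt_add_right ?_ _) hgain⟩
    rw [← mul_assoc]
    refine mul_lt_mul_of_pos_right ?_ hpow
    have hd' : ((diffPairs G G').card : ℝ) ≤ 2 * n := by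
      rw [hn_def]
      exact_mod_cast hd
    have e1 : K ^ 3 * (((diffPairs G (splitGraph A)).card : ℝ) / n ^ 2) ≤ c / 8 :=
      (mul_le_mul_of_nonneg_left hw (by positivity)).trans eε2
    have e2 : K ^ 2 / n ≤ c / 8 := by
      have : K ^ 2 / n = K ^ 2 * (2 / n) / 2 := by ring
      have := mul_le_mul_of_nonneg_left hnτ (show 0 ≤ K ^ 2 by positivity)
      have : 0 ≤ K ^ 2 * (2 / n) := by positivity
      linarith
    calc min (c / 8) (κ / 8) * (((diffPairs G G').card : ℝ) / n ^ 2)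
        ≤ c / 8 * (2 * n / n ^ 2) := by gcongr
      _ = (c / 4) / n := by field_simp; norm_num
      _ < _ := by
        refine div_lt_div_of_pos_right ?_ hn
        rw [← hx]
        linarith
  · push Not at hbad
    obtain ⟨⟨u, v⟩, huv⟩ : ∃ z, z ∈ diffPairs G (splitGraph A) := by
      by_contra! h
      exact hne A (eq_of_diffPairs_eq_empty (Finset.eq_empty_of_forall_notMem h))
    obtain ⟨G', hd, hgain⟩ := exists_flip_improvement hs ht huv hbad hθ0.le
      ((le_div_iff₀ hn).1 hxθ) ((le_div_iff₀ hn).1 (hxθ'.trans_eq hxc.symm))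
    refine ⟨G', lt_of_lt_of_le (add_lt_add_right ?_ _) hgain⟩
    rw [← mul_assoc]
    refine mul_lt_mul_of_pos_right ?_ hpow
    have hd' : ((diffPairs G G').card : ℝ) ≤ 2 := by exact_mod_cast hd
    have e1 := (mul_le_mul_of_nonneg_left hw (show 0 ≤ K ^ 2 by positivity)).trans eε1
    have e2 := (mul_le_mul_of_nonneg_left hnτ (show 0 ≤ K ^ 2 by positivity)).trans eτ1
    calc min (c / 8) (κ / 8) * (((diffPairs G G').card : ℝ) / n ^ 2)
        ≤ κ / 8 * (2 / n ^ 2) := by gcongr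
      _ = (κ / 4) / n ^ 2 := by ring
      _ < _ := by
        refine div_lt_div_of_pos_right ?_ (by positivity)
        linarith

end Improvement

/-! ### From local improvements to linear stability. -/

theorem SimpleGraph.IsCompleteMultipartite.exists_coloring {V : Type} {G : SimpleGraph V}
    (hG : G.IsCompleteMultipartite) :
    ∃ (κ : Type) (c : V → κ), ∀ v w, G.Adj v w ↔ c v ≠ c w := by
  refine ⟨Quotient hG.setoid, fun v => Quotient.mk _ v, fun v w => ?_⟩
  rw [Ne, Quotient.eq]
  exact not_not.symm

section Stability

variable {V : Type} [Fintype V]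

/-- Every nonempty set of graphs contains a complete partite graph, or a graph that a single
symmetrisation step takes out of the set. -/
theorem exists_multipartite_or_step {ι : Type} [Fintype ι] (l : ι → Bool)
    {S : Set (SimpleGraph V)} (hS : S.Nonempty) :
    ∃ G ∈ S, G.IsCompleteMultipartite ∨ ∃ G' ∉ S, (diffPairs G G').card ≤ 2 * Fintype.card V ∧
      (copies l G).card ≤ (copies l G').card := by
  -- A lexicographic maximum replaces a chain of symmetrisations: a step from it must leave `S`.
  obtain ⟨G, hG, hmax⟩ := Set.exists_max_image S
    (fun G => toLex ((copies l G).card, twinCount G)) S.toFinite hS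
  refine ⟨G, hG, or_iff_not_imp_left.2 fun hm => ?_⟩
  obtain ⟨G', hd, hle, ht⟩ := exists_symmetrisation_step l hm
  refine ⟨G', fun hG' => ?_, hd, hle⟩
  have := hmax G' hG'
  rw [Prod.Lex.toLex_le_toLex] at this
  rcases this with h | ⟨h1, h2⟩
  · exact absurd hle (not_le.2 h)
  · exact absurd (ht h1.symm) (not_lt.2 h2)

theorem exists_mem_of_nearSplit {κ : Type} {α η : ℝ} {I : Finset κ} {f : κ → ℝ}
    (h : NearSplit α η (I.val.map f)) :
    ∃ i ∈ I, ∃ j ∈ I, i ≠ j ∧ |f i - α| < η ∧ |f j - (1 - α)| < η := by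
  classical
  obtain ⟨p, q, rest, he, hp, hq⟩ := h
  have h1 : p ∈ I.val.map f := by rw [he]; simp
  obtain ⟨i, hi, rfl⟩ := Multiset.mem_map.1 h1
  have hI : I.val = i ::ₘ (I.erase i).val := by
    rw [Finset.erase_val, Multiset.cons_erase hi]
  rw [hI, Multiset.map_cons, Multiset.cons_inj_right] at he
  have h2 : q ∈ (I.erase i).val.map f := by rw [he]; simp
  obtain ⟨j, hj, rfl⟩ := Multiset.mem_map.1 h2
  have hj' := Finset.mem_erase.1 (Finset.mem_def.2 hj)
  exact ⟨i, hi, j, hj'.2, hj'.1.symm, hp, hq⟩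

variable [Nonempty V]

/-- The maximum number of copies is attained asymptotically by a complete bipartite graph. -/
theorem card_copies_le {s t : ℕ} (hs : 1 ≤ s) (hst : s ≤ t) (ht : 2 ≤ t) {α : ℝ}
    (hα : IsOptimalSplit s t α) (G : SimpleGraph V) :
    ((copies (bipSide s t) G).card : ℝ) ≤ fKst s t α * (Fintype.card V : ℝ) ^ (s + t) := by
  classical
  -- A symmetrisation step cannot leave this set, so it contains a complete partite graph.
  obtain ⟨G₁, hG₁, h | ⟨G₂, hG₂, -, h⟩⟩ := exists_multipartite_or_step (bipSide s t)
    (S := {H | (copies (bipSide s t) G).card ≤ (copies (bipSide s t) H).card}) ⟨G, by simp⟩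
  · obtain ⟨κ, c, hc⟩ := h.exists_coloring
    have hI : ∀ v, c v ∈ Finset.univ.image c := fun v => by simp
    have h1 := card_copies_multipartite_le hs (by omega : 1 ≤ t) hc hI
    have h2 := partiteDensity_le hs hst ht hα (classProportions_nonneg c (Finset.univ.image c))
      (sum_classProportions hI)
    refine (Nat.cast_le.2 hG₁).trans (h1.trans ?_)
    rw [mul_comm]
    exact mul_le_mul_of_nonneg_right h2 (by positivity)
  · exact absurd (le_trans hG₁ h) hG₂

/-- A complete partite graph with a nearly maximum number of copies has two classes of nearly the
optimal proportions. -/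
theorem exists_classes_of_multipartite {s t : ℕ} (hs : 1 ≤ s) (hst : s ≤ t) (ht : 2 ≤ t) {α : ℝ}
    (hα : IsOptimalSplit s t α) {η : ℝ} (hη : 0 < η) :
    ∃ δ > 0, ∀ (V κ : Type) [Fintype V] [Nonempty V] [DecidableEq κ] (G : SimpleGraph V)
      (c : V → κ), (∀ v w, G.Adj v w ↔ c v ≠ c w) →
      (fKst s t α - δ) * (Fintype.card V : ℝ) ^ (s + t) ≤ (copies (bipSide s t) G).card →
      ∃ i j, i ≠ j ∧
        |((Finset.univ.filter fun v => c v = i).card : ℝ) / Fintype.card V - α| < η ∧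
        |((Finset.univ.filter fun v => c v = j).card : ℝ) / Fintype.card V - (1 - α)| < η := by
  obtain ⟨δ, hδ, h⟩ := exists_nearSplit hs hst ht hα hη
  refine ⟨δ, hδ, fun V κ _ _ _ G c hc hG => ?_⟩
  have hn : (0 : ℝ) < Fintype.card V := by exact_mod_cast Fintype.card_pos
  have hI : ∀ v, c v ∈ Finset.univ.image c := fun v => by simp
  have h1 := card_copies_multipartite_le hs (by omega : 1 ≤ t) hc hI
  have h2 : fKst s t α - δ ≤ partiteDensity s t (classProportions c (Finset.univ.image c)) := by
    refine le_of_mul_le_mul_right ?_ (pow_pos hn (s + t))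
    rw [mul_comm (partiteDensity _ _ _)]
    exact hG.trans h1
  obtain ⟨i, -, j, -, hij, hi, hj⟩ := exists_mem_of_nearSplit
    (h _ (classProportions_nonneg _ _) (sum_classProportions hI) h2)
  exact ⟨i, j, hij, hi, hj⟩

/-- At most `2 * η * n` vertices lie outside the two classes, and every pair on which the graphs
differ contains one of them. -/
theorem exists_splitGraph_of_classes {κ : Type} [DecidableEq κ] {G : SimpleGraph V} {c : V → κ}
    (hc : ∀ v w, G.Adj v w ↔ c v ≠ c w) {i j : κ} (hij : i ≠ j) {α η : ℝ}
    (hi : |((Finset.univ.filter fun v => c v = i).card : ℝ) / Fintype.card V - α| < η)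
    (hj : |((Finset.univ.filter fun v => c v = j).card : ℝ) / Fintype.card V - (1 - α)| < η) :
    ∃ A, ((diffPairs G (splitGraph A)).card : ℝ) ≤ 4 * η * (Fintype.card V : ℝ) ^ 2 := by
  classical
  have hn : (0 : ℝ) < Fintype.card V := by exact_mod_cast Fintype.card_pos
  set A := Finset.univ.filter fun v => c v = i
  set B := Finset.univ.filter fun v => c v = j
  have hdisj : Disjoint A B := by
    rw [Finset.disjoint_left]
    intro v h1 h2
    simp only [A, B, Finset.mem_filter, Finset.mem_univ, true_and] at h1 h2
    exact hij (h1.symm.trans h2)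
  set R := (A ∪ B)ᶜ
  have hR : (R.card : ℝ) = Fintype.card V - A.card - B.card := by
    rw [Finset.card_compl, Nat.cast_sub (Finset.card_le_univ _),
      Finset.card_union_of_disjoint hdisj]
    push_cast
    ring
  have hR' : (R.card : ℝ) ≤ 2 * η * Fintype.card V := by
    have h1 := (abs_lt.1 hi).1
    have h2 := (abs_lt.1 hj).1
    have : (R.card : ℝ) / Fintype.card V ≤ 2 * η := by
      rw [hR, sub_div, sub_div, div_self hn.ne']
      linarith
    exact (div_le_iff₀ hn).1 this
  refine ⟨A, ?_⟩
  have hsub : diffPairs G (splitGraph A) ⊆ (R ×ˢ Finset.univ) ∪ (Finset.univ ×ˢ R) := by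
    rintro ⟨x, y⟩ h
    rw [mem_diffPairs, hc, splitGraph_adj] at h
    simp only [R, A, B, Finset.mem_union, Finset.mem_product, Finset.mem_compl, Finset.mem_filter,
      Finset.mem_univ, true_and, and_true] at h ⊢
    by_contra! hcon
    obtain ⟨hx, hy⟩ := hcon
    rcases hx with hx | hx <;> rcases hy with hy | hy <;> simp [hx, hy, hij, hij.symm] at h
  have hcard : ((diffPairs G (splitGraph A)).card : ℝ) ≤
      R.card * Fintype.card V + Fintype.card V * R.card := by
    have := (Finset.card_le_card hsub).trans (Finset.card_union_le _ _)
    rw [Finset.card_product, Finset.card_product, Finset.card_univ] at this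
    exact_mod_cast this
  nlinarith

/-- Stability for graphs that are already close to a complete bipartite graph. -/
theorem exists_linear_stability_of_close {s t : ℕ} (hs : 1 ≤ s) (hst : s ≤ t) (ht : 2 ≤ t) {α : ℝ}
    (hα : IsOptimalSplit s t α) :
    ∃ ε > 0, ∃ δ > 0, ∃ c > 0, ∃ N : ℝ, ∀ (V : Type) [Fintype V] [Nonempty V]
      (G : SimpleGraph V), N ≤ Fintype.card V →
      (∃ A, ((diffPairs G (splitGraph A)).card : ℝ) ≤ ε * (Fintype.card V : ℝ) ^ 2) →
      (fKst s t α - δ) * (Fintype.card V : ℝ) ^ (s + t) ≤ (copies (bipSide s t) G).card →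
      ∃ A, ((copies (bipSide s t) G).card : ℝ) + c * ((diffPairs G (splitGraph A)).card /
        (Fintype.card V : ℝ) ^ 2 * (Fintype.card V : ℝ) ^ (s + t)) ≤
          (copies (bipSide s t) (splitGraph A)).card := by
  obtain ⟨ε, hε, δ, hδ, c, hc, N, h⟩ := exists_improvement hs hst ht hα
  refine ⟨ε / 2, by positivity, min δ (c * ε / 2), by positivity, c, hc, N, ?_⟩
  intro V _ _ G hN ⟨A₀, hA₀⟩ hG
  have hn : (0 : ℝ) < Fintype.card V := by exact_mod_cast Fintype.card_pos
  set n : ℝ := (Fintype.card V : ℝ) with hn_def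
  have hpow : 0 < n ^ (s + t) := by positivity
  -- a graph maximising the number of copies penalised by the distance to `G`
  obtain ⟨G', hmax⟩ := Finite.exists_max fun G' : SimpleGraph V =>
    ((copies (bipSide s t) G').card : ℝ) - c * ((diffPairs G G').card / n ^ 2 * n ^ (s + t))
  have hGG' := hmax G
  simp only [diffPairs_self, Finset.card_empty, Nat.cast_zero, zero_div, zero_mul, mul_zero,
    sub_zero] at hGG'
  have hle := card_copies_le hs hst ht hα G'
  rw [← hn_def] at hle
  have hmin1 : min δ (c * ε / 2) ≤ δ := min_le_left _ _
  have hmin2 : min δ (c * ε / 2) ≤ c * ε / 2 := min_le_right _ _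
  -- The penalised count of `G'` is at least that of `G`, so its penalty is at most the deficit of
  -- `G`; the bound `c * ε / 2` keeps `G'` within `ε / 2` of `G`.
  have hdiff : ((diffPairs G G').card : ℝ) ≤ ε / 2 * n ^ 2 := by
    rw [← div_le_iff₀ (by positivity)]
    have h1 : (c * ((diffPairs G G').card / n ^ 2)) * n ^ (s + t) ≤ (c * ε / 2) * n ^ (s + t) := by
      have := mul_le_mul_of_nonneg_right hmin2 hpow.le
      linarith
    have h2 := le_of_mul_le_mul_right h1 hpow
    refine le_of_mul_le_mul_left ?_ hc
    linarith
  by_cases hsplit : ∃ A, G' = splitGraph A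
  · obtain ⟨A, rfl⟩ := hsplit
    exact ⟨A, by linarith⟩
  · push Not at hsplit
    have hnonneg : 0 ≤ c * ((diffPairs G G').card / n ^ 2 * n ^ (s + t)) := by positivity
    obtain ⟨G'', hG''⟩ := h V G' hN ⟨A₀, by
      have : ((diffPairs G' (splitGraph A₀)).card : ℝ) ≤
          (diffPairs G G').card + (diffPairs G (splitGraph A₀)).card := by
        rw [diffPairs_comm G G']
        exact_mod_cast card_diffPairs_triangle G' G (splitGraph A₀)
      linarith⟩ (by
        have := mul_le_mul_of_nonneg_right hmin1 hpow.le
        linarith) hsplit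
    have h1 := hmax G''
    -- By the triangle inequality the extra penalty of `G''` is less than its gain over `G'`,
    -- against the choice of `G'`.
    have h2 : c * ((diffPairs G G'').card / n ^ 2 * n ^ (s + t)) ≤
        c * ((diffPairs G G').card / n ^ 2 * n ^ (s + t)) +
        c * ((diffPairs G' G'').card / n ^ 2 * n ^ (s + t)) := by
      have : ((diffPairs G G'').card : ℝ) ≤ (diffPairs G G').card + (diffPairs G' G'').card := by
        exact_mod_cast card_diffPairs_triangle G G' G''
      rw [← mul_add, ← add_mul, ← add_div]
      gcongr
    linarith

/-- Every graph with a nearly maximum number of copies is beaten by a complete bipartite graph, by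
an amount that is at least proportional to the distance between them. -/
theorem exists_linear_stability {s t : ℕ} (hs : 1 ≤ s) (hst : s ≤ t) (ht : 2 ≤ t) {α : ℝ}
    (hα : IsOptimalSplit s t α) :
    ∃ δ > 0, ∃ c > 0, ∃ N : ℝ, ∀ (V : Type) [Fintype V] [Nonempty V]
      (G : SimpleGraph V), N ≤ Fintype.card V →
      (fKst s t α - δ) * (Fintype.card V : ℝ) ^ (s + t) ≤ (copies (bipSide s t) G).card →
      ∃ A, ((copies (bipSide s t) G).card : ℝ) + c * ((diffPairs G (splitGraph A)).card /
        (Fintype.card V : ℝ) ^ 2 * (Fintype.card V : ℝ) ^ (s + t)) ≤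
          (copies (bipSide s t) (splitGraph A)).card := by
  obtain ⟨ε, hε, δ₁, hδ₁, c, hc, N, h⟩ := exists_linear_stability_of_close hs hst ht hα
  obtain ⟨δ₂, hδ₂, hclasses⟩ := exists_classes_of_multipartite hs hst ht hα
    (η := ε / 16) (by positivity)
  set δ := min (min δ₁ δ₂) (c * ε / 4)
  have hδ1 : δ ≤ δ₁ := (min_le_left _ _).trans (min_le_left _ _)
  have hδ2 : δ ≤ δ₂ := (min_le_left _ _).trans (min_le_right _ _)
  have hδ3 : δ ≤ c * ε / 4 := min_le_right _ _
  refine ⟨δ, by positivity, c, hc, max N (4 / ε), fun V _ _ G hN hG => ?_⟩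
  classical
  have hn : (0 : ℝ) < Fintype.card V := by exact_mod_cast Fintype.card_pos
  set n : ℝ := (Fintype.card V : ℝ) with hn_def
  have hpow : 0 < n ^ (s + t) := by positivity
  have hN1 : N ≤ n := (le_max_left _ _).trans hN
  have hN2 : 4 ≤ n * ε := (div_le_iff₀ hε).1 ((le_max_right _ _).trans hN)
  have hmono : ∀ {δ'} (H : SimpleGraph V), δ ≤ δ' →
      (fKst s t α - δ) * n ^ (s + t) ≤ (copies (bipSide s t) H).card →
      (fKst s t α - δ') * n ^ (s + t) ≤ (copies (bipSide s t) H).card := by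
    intro δ' H hd hH
    have := mul_le_mul_of_nonneg_right hd hpow.le
    linarith
  by_cases hclose : ∃ A, ((diffPairs G (splitGraph A)).card : ℝ) ≤ ε * n ^ 2
  · exact h V G hN1 hclose (hmono G hδ1 hG)
  · exfalso
    push Not at hclose
    -- A near-optimal complete partite graph is within `ε / 4` of a split graph, so it is not in
    -- this set. Hence some step crosses the threshold `ε / 2`; it changes at most `2 * n ≤ ε / 2 *
    -- n ^ 2` pairs, so its start `G₁` is within `ε` of a split graph. Local stability, with a
    -- deficit of at most `c * ε / 4`, then puts `G₁` within `ε / 4` of one, a contradiction.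
    obtain ⟨G₁, ⟨hG₁, hfar⟩, hm | ⟨G₂, hG₂, hd, hle⟩⟩ := exists_multipartite_or_step (bipSide s t)
      (S := {H | (fKst s t α - δ) * n ^ (s + t) ≤ (copies (bipSide s t) H).card ∧
        ∀ A, ε / 2 * n ^ 2 < (diffPairs H (splitGraph A)).card})
      ⟨G, hG, fun A => lt_of_le_of_lt (by nlinarith [sq_nonneg n]) (hclose A)⟩
    · obtain ⟨κ, col, hcol⟩ := hm.exists_coloring
      obtain ⟨i, j, hij, hi, hj⟩ := hclasses V κ G₁ col hcol (hmono G₁ hδ2 hG₁)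
      obtain ⟨A, hA⟩ := exists_splitGraph_of_classes hcol hij hi hj
      have := hfar A
      rw [← hn_def] at hA
      nlinarith [pow_pos hn 2]
    · have hG₂' : (fKst s t α - δ) * n ^ (s + t) ≤ (copies (bipSide s t) G₂).card :=
        hG₁.trans (by exact_mod_cast hle)
      have : ∃ A, ((diffPairs G₂ (splitGraph A)).card : ℝ) ≤ ε / 2 * n ^ 2 := by
        by_contra! hcon
        exact hG₂ ⟨hG₂', hcon⟩
      obtain ⟨A, hA⟩ := this
      have htri : ((diffPairs G₁ (splitGraph A)).card : ℝ) ≤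
          (diffPairs G₁ G₂).card + (diffPairs G₂ (splitGraph A)).card := by
        exact_mod_cast card_diffPairs_triangle G₁ G₂ (splitGraph A)
      have hd' : ((diffPairs G₁ G₂).card : ℝ) ≤ 2 * n := by
        rw [hn_def]
        exact_mod_cast hd
      obtain ⟨A', hA'⟩ := h V G₁ hN1 ⟨A, by nlinarith⟩ (hmono G₁ hδ1 hG₁)
      have hub := card_copies_le hs hst ht hα (splitGraph A')
      rw [← hn_def] at hub hA'
      have h1 : (c * ((diffPairs G₁ (splitGraph A')).card / n ^ 2)) * n ^ (s + t) ≤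
          (c * (ε / 4)) * n ^ (s + t) := by
        have := mul_le_mul_of_nonneg_right hδ3 hpow.le
        linarith
      have h2 := le_of_mul_le_mul_left (le_of_mul_le_mul_right h1 hpow) hc
      rw [div_le_iff₀ (by positivity)] at h2
      have := hfar A'
      nlinarith [pow_pos hn 2]

end Stability

/-! ### Limits of copy densities. -/

section Asymptotics

theorem tendsto_descFactorial_div_pow {X : Type} {f : Filter X} {a n : X → ℕ} {x : ℝ}
    (hn : Tendsto n f atTop) (ha : Tendsto (fun k => (a k : ℝ) / n k) f (𝓝 x)) (r : ℕ) :
    Tendsto (fun k => ((a k).descFactorial r : ℝ) / (n k : ℝ) ^ r) f (𝓝 (x ^ r)) := by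
  induction r with
  | zero => simpa using tendsto_const_nhds
  | succ r ih =>
    have hsub : Tendsto (fun k => ((a k - r : ℕ) : ℝ) / n k) f (𝓝 x) := by
      have h0 : Tendsto (fun k => (r : ℝ) / n k) f (𝓝 0) :=
        tendsto_const_nhds.div_atTop (tendsto_natCast_atTop_atTop.comp hn)
      have h1 : Tendsto (fun k => (a k : ℝ) / n k - r / n k) f (𝓝 x) := by
        simpa using ha.sub h0
      refine tendsto_of_tendsto_of_tendsto_of_le_of_le h1 ha (fun k => ?_) fun k => ?_
      · simp only [← sub_div]
        have : (a k : ℝ) ≤ ((a k - r : ℕ) : ℝ) + r := by exact_mod_cast (by omega)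
        gcongr
        linarith
      · simp only
        gcongr
        exact Nat.sub_le _ _
    have := hsub.mul ih
    rw [← pow_succ'] at this
    refine this.congr fun k => ?_
    rw [Nat.descFactorial_succ, Nat.cast_mul, pow_succ', mul_div_mul_comm]

theorem tendsto_choose_div_pow {X : Type} {f : Filter X} {n : X → ℕ} (hn : Tendsto n f atTop)
    (k : ℕ) :
    Tendsto (fun i => ((n i).choose k : ℝ) / (n i : ℝ) ^ k) f (𝓝 (1 / k.factorial)) := by
  have h1 : Tendsto (fun i => (n i : ℝ) / n i) f (𝓝 1) := by
    refine tendsto_const_nhds.congr' ?_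
    filter_upwards [hn.eventually_gt_atTop 0] with i hi
    exact (div_self (by positivity)).symm
  have := (tendsto_descFactorial_div_pow hn h1 k).div_const (k.factorial : ℝ)
  rw [one_pow] at this
  refine this.congr fun i => ?_
  rw [Nat.descFactorial_eq_factorial_mul_choose, Nat.cast_mul]
  have : (k.factorial : ℝ) ≠ 0 := by positivity
  field_simp

/-- Copies in complete bipartite graphs whose first parts have proportion tending to `x`. -/
theorem tendsto_card_copies_splitGraph {s t : ℕ} (hs : 1 ≤ s) (ht : 1 ≤ t)
    {A : ∀ n : ℕ, Finset (Fin n)} {x : ℝ}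
    (hA : Tendsto (fun n => ((A n).card : ℝ) / n) atTop (𝓝 x)) :
    Tendsto (fun n => ((copies (bipSide s t) (splitGraph (A n))).card : ℝ) / (n : ℝ) ^ (s + t))
      atTop (𝓝 (fKst s t x)) := by
  have hAc : Tendsto (fun n => ((A n)ᶜ.card : ℝ) / n) atTop (𝓝 (1 - x)) := by
    refine (tendsto_const_nhds.sub hA).congr' ?_
    filter_upwards [eventually_gt_atTop 0] with n hn
    have hn' : (n : ℝ) ≠ 0 := by positivity
    rw [Finset.card_compl, Nat.cast_sub (Finset.card_le_univ _), Fintype.card_fin, sub_div,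
      div_self hn']
  have d := fun (B : ∀ n : ℕ, Finset (Fin n)) (y : ℝ)
    (hB : Tendsto (fun n => ((B n).card : ℝ) / n) atTop (𝓝 y)) (r : ℕ) =>
    tendsto_descFactorial_div_pow (n := fun n : ℕ => n) tendsto_id hB r
  have := ((d _ _ hA s).mul (d _ _ hAc t)).add ((d _ _ hA t).mul (d _ _ hAc s))
  refine this.congr fun n => ?_
  rw [card_copies_splitGraph hs ht, pow_add]
  push_cast
  ring

/-- A sequence of vertex sets of proportions tending to `x`. -/
theorem exists_tendsto_proportion {x : ℝ} (h0 : 0 ≤ x) (h1 : x ≤ 1) :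
    ∃ A : ∀ n : ℕ, Finset (Fin n), (∀ n, (A n).card = ⌈x * n⌉₊) ∧
      Tendsto (fun n => ((A n).card : ℝ) / n) atTop (𝓝 x) := by
  have : ∀ n : ℕ, ∃ A : Finset (Fin n), A.card = ⌈x * n⌉₊ := by
    intro n
    have : ⌈x * n⌉₊ ≤ (Finset.univ : Finset (Fin n)).card := by
      rw [Finset.card_univ, Fintype.card_fin, Nat.ceil_le]
      exact mul_le_of_le_one_left (Nat.cast_nonneg n) h1
    obtain ⟨A, -, hA⟩ := Finset.exists_subset_card_eq this
    exact ⟨A, hA⟩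
  choose A hA using this
  refine ⟨A, hA, ?_⟩
  simp only [hA]
  exact (tendsto_nat_ceil_mul_div_atTop h0).comp tendsto_natCast_atTop_atTop

end Asymptotics

/-! ### Inducibility and perfect stability of the density parameter. -/

section Parameter

variable {s t : ℕ}

/-- The number of automorphisms of `K_{s,t}`. -/
noncomputable def autCount (s t : ℕ) : ℝ :=
  (copies (bipSide s t) (completeBipartiteGraph (Fin s) (Fin t))).card

theorem autCount_eq (hs : 1 ≤ s) (ht : 1 ≤ t) :
    autCount s t = (if s = t then 2 else 1) * (s.factorial * t.factorial) := by
  rw [autCount, card_copies_self hs ht]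
  push_cast
  rfl

theorem autCount_pos (hs : 1 ≤ s) (ht : 1 ≤ t) : 0 < autCount s t := by
  rw [autCount_eq hs ht]
  split_ifs <;> positivity

theorem densityParameter_eq (hs : 1 ≤ s) (ht : 1 ≤ t) (n : ℕ) (G : SimpleGraph (Fin n)) :
    densityParameter (completeBipartiteGraph (Fin s) (Fin t)) n G =
      (copies (bipSide s t) G).card / (autCount s t * n.choose (s + t)) := by
  have h := card_copies_eq (completeBipartiteGraph_adj_iff_bipSide s t) G
  have h' : ((copies (bipSide s t) G).card : ℝ) =
      inducedCount (completeBipartiteGraph (Fin s) (Fin t)) G * autCount s t := by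
    rw [autCount]
    exact_mod_cast h
  have hpos := autCount_pos hs ht
  simp only [densityParameter, inducedDensity, Fintype.card_sum, Fintype.card_fin]
  rw [h', mul_comm (autCount s t), mul_div_mul_right _ _ hpos.ne']

theorem le_maxValue (lam : GraphParameter) (n : ℕ) (G : SimpleGraph (Fin n)) :
    lam n G ≤ maxValue lam n :=
  le_ciSup (Set.finite_range _).bddAbove G

/-- The maximum is squeezed between split graphs of proportion tending to `α` and the bound
`card_copies_le`. -/
theorem tendsto_maxValue (hs : 1 ≤ s) (hst : s ≤ t) (ht : 2 ≤ t) {α : ℝ}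
    (hα : IsOptimalSplit s t α) :
    Tendsto (maxValue (densityParameter (completeBipartiteGraph (Fin s) (Fin t)))) atTop
      (𝓝 ((s + t).factorial * fKst s t α / autCount s t)) := by
  have ht1 : 1 ≤ t := by omega
  have haut := autCount_pos hs ht1
  have hchoose := tendsto_choose_div_pow (n := fun n : ℕ => n) tendsto_id (s + t)
  have hfac : (1 / ((s + t).factorial : ℝ)) ≠ 0 := by positivity
  have hlim : ∀ (u : ℕ → ℝ) (x : ℝ), Tendsto u atTop (𝓝 x) →
      Tendsto (fun n => u n / (n.choose (s + t) / (n : ℝ) ^ (s + t)) / autCount s t) atTop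
        (𝓝 ((s + t).factorial * x / autCount s t)) := by
    intro u x hu
    have := (hu.div hchoose hfac).div_const (autCount s t)
    have e : (s + t).factorial * x / autCount s t =
        x / (1 / ((s + t).factorial : ℝ)) / autCount s t := by
      rw [div_div_eq_mul_div, div_one, mul_comm]
    rw [e]
    exact this
  obtain ⟨A, -, hA⟩ := exists_tendsto_proportion (x := α) (by linarith [hα.half_le]) hα.lt_one.le
  refine tendsto_of_tendsto_of_tendsto_of_le_of_le'
    (hlim _ _ (tendsto_card_copies_splitGraph hs ht1 hA)) (hlim _ _ tendsto_const_nhds) ?_ ?_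
  · filter_upwards [eventually_gt_atTop 0] with n hn
    have hn' : (n : ℝ) ≠ 0 := by positivity
    refine le_of_eq_of_le ?_ (le_maxValue _ n (splitGraph (A n)))
    rw [densityParameter_eq hs ht1]
    field_simp
  · filter_upwards [eventually_gt_atTop 0] with n hn
    have hn' : (n : ℝ) ≠ 0 := by positivity
    have : Nonempty (Fin n) := ⟨⟨0, hn⟩⟩
    refine ciSup_le fun G => ?_
    rw [densityParameter_eq hs ht1, div_div, div_mul_eq_mul_div, div_div_eq_mul_div,
      mul_comm (autCount s t)]
    have := card_copies_le hs hst ht hα G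
    rw [Fintype.card_fin] at this
    gcongr

theorem maxInducedCount_div {W : Type} [Fintype W] (F : SimpleGraph W) (n : ℕ) :
    (maxInducedCount F n : ℝ) / (n.choose (Fintype.card W) : ℝ) =
      maxValue (densityParameter F) n := by
  have hbdd : BddAbove (Set.range fun G : SimpleGraph (Fin n) => inducedCount F G) :=
    (Set.finite_range _).bddAbove
  refine le_antisymm ?_ (ciSup_le fun G => ?_)
  · obtain ⟨G, hG⟩ := exists_eq_ciSup_of_finite (f := fun G : SimpleGraph (Fin n) => inducedCount F G)
    rw [maxInducedCount, ← hG]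
    refine le_of_eq_of_le ?_ (le_maxValue _ n G)
    simp [densityParameter, inducedDensity]
  · simp only [densityParameter, inducedDensity, Fintype.card_fin]
    gcongr
    exact le_ciSup hbdd G

/-- Near the maximum, linear stability applies. Any other graph has a density gap bounded away from
`0`, and since normalised distances are at most `2`, any complete partite graph will do once `C` is
large. -/
theorem exists_perfect_stability (hs : 1 ≤ s) (hst : s ≤ t) (ht : 2 ≤ t) {α : ℝ}
    (hα : IsOptimalSplit s t α) :
    PerfectlyStable (densityParameter (completeBipartiteGraph (Fin s) (Fin t))) := by
  have ht1 : 1 ≤ t := by omega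
  have haut := autCount_pos hs ht1
  obtain ⟨δ, hδ, c, hc, N, hstab⟩ := exists_linear_stability hs hst ht hα
  obtain ⟨A, -, hA⟩ := exists_tendsto_proportion (x := α) (by linarith [hα.half_le]) hα.lt_one.le
  have hlow := (tendsto_card_copies_splitGraph hs ht1 hA).eventually_const_lt
    (show fKst s t α - δ / 2 < fKst s t α by linarith)
  obtain ⟨N₁, hN₁⟩ := eventually_atTop.1 hlow
  -- The first three entries are thresholds on `n`, with `s + t` making the binomial coefficient
  -- positive; the last two convert a density gap into a distance in the two cases.
  set C : ℝ := max (max (max N N₁) (s + t)) (max (2 * autCount s t / c) (4 * autCount s t / δ))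
  have hC1 : N ≤ C := (le_max_left _ _).trans ((le_max_left _ _).trans (le_max_left _ _))
  have hC2 : (N₁ : ℝ) ≤ C := (le_max_right _ _).trans ((le_max_left _ _).trans (le_max_left _ _))
  have hC3 : (s : ℝ) + t ≤ C := (le_max_right _ _).trans (le_max_left _ _)
  have hC4 : 2 * autCount s t / c ≤ C := (le_max_left _ _).trans (le_max_right _ _)
  have hC5 : 4 * autCount s t / δ ≤ C := (le_max_right _ _).trans (le_max_right _ _)
  have hC0 : 0 < C := lt_of_lt_of_le (by positivity) hC4
  refine ⟨C, hC0, fun n hn G => ?_⟩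
  have hn0 : 0 < n := by exact_mod_cast hC0.trans_le hn
  have hnR : (0 : ℝ) < n := by exact_mod_cast hn0
  have : Nonempty (Fin n) := ⟨⟨0, hn0⟩⟩
  have hkn : s + t ≤ n := by exact_mod_cast hC3.trans hn
  have hpow : (0 : ℝ) < (n : ℝ) ^ (s + t) := by positivity
  have hch : (0 : ℝ) < n.choose (s + t) := by exact_mod_cast Nat.choose_pos hkn
  have hch' : (n.choose (s + t) : ℝ) ≤ (n : ℝ) ^ (s + t) := by
    exact_mod_cast Nat.choose_le_pow n (s + t)
  have hdist : ∀ H : SimpleGraph (Fin n),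
      normalisedEditDistance G H ≤ 2 * ((diffPairs G H).card / (n : ℝ) ^ 2) := by
    intro H
    have h1 : editDistance G H ≤ (diffPairs G H).card := by
      classical
      refine (ciInf_le (OrderBot.bddBelow _) (1 : Equiv.Perm (Fin n))).trans ?_
      have hsub : symmDiff H.edgeSet (G.map (1 : Equiv.Perm (Fin n))).edgeSet ⊆
          ((diffPairs G H).image fun z => s(z.1, z.2) : Finset (Sym2 (Fin n))) := by
        have hmap : ∀ x y, (G.map (1 : Equiv.Perm (Fin n))).Adj x y ↔ G.Adj x y := by
          intro x y
          simp
        intro e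
        induction e with
        | _ x y =>
          intro h
          simp only [Set.mem_symmDiff, SimpleGraph.mem_edgeSet, hmap] at h
          simp only [Finset.coe_image, Set.mem_image, Finset.mem_coe]
          exact ⟨(x, y), mem_diffPairs.2 (by tauto), rfl⟩
      calc _ ≤ (((diffPairs G H).image fun z => s(z.1, z.2) : Finset (Sym2 (Fin n))) :
            Set (Sym2 (Fin n))).ncard := Set.ncard_le_ncard hsub (Finset.finite_toSet _)
        _ ≤ _ := by
          rw [Set.ncard_coe_finset]
          exact Finset.card_image_le
    have h1' : (editDistance G H : ℝ) ≤ (diffPairs G H).card := by exact_mod_cast h1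
    rw [normalisedEditDistance, div_mul_eq_mul_div, mul_div_assoc]
    gcongr
  -- a gap in the number of copies gives a gap in density
  have hgap : ∀ (H : SimpleGraph (Fin n)) (g : ℝ), 0 ≤ g →
      ((copies (bipSide s t) G).card : ℝ) + g * (n : ℝ) ^ (s + t) ≤
        (copies (bipSide s t) H).card →
      g / autCount s t ≤
        maxValue (densityParameter (completeBipartiteGraph (Fin s) (Fin t))) n -
          densityParameter (completeBipartiteGraph (Fin s) (Fin t)) n G := by
    intro H g hg hH
    have h1 := le_maxValue (densityParameter (completeBipartiteGraph (Fin s) (Fin t))) n H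
    rw [densityParameter_eq hs ht1] at h1 ⊢
    have h2 : g / autCount s t ≤ ((copies (bipSide s t) H).card : ℝ) /
        (autCount s t * n.choose (s + t)) - (copies (bipSide s t) G).card /
        (autCount s t * n.choose (s + t)) := by
      rw [← sub_div, div_le_div_iff₀ haut (by positivity)]
      have : g * n.choose (s + t) ≤ g * (n : ℝ) ^ (s + t) := by gcongr
      nlinarith
    linarith
  by_cases hG : (fKst s t α - δ) * (n : ℝ) ^ (s + t) ≤ (copies (bipSide s t) G).card
  · obtain ⟨A', hA'⟩ := hstab (Fin n) G (by rw [Fintype.card_fin]; exact hC1.trans hn)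
      (by rwa [Fintype.card_fin])
    rw [Fintype.card_fin] at hA'
    refine ⟨splitGraph A', ⟨fun x y z h1 h2 => ?_⟩, (hdist _).trans ?_⟩
    · simp only [splitGraph_adj, not_not] at h1 h2 ⊢
      exact h1.trans h2
    · have h1 := hgap (splitGraph A') (c * ((diffPairs G (splitGraph A')).card / (n : ℝ) ^ 2))
        (by positivity) (by rw [mul_assoc]; exact hA')
      calc 2 * (((diffPairs G (splitGraph A')).card : ℝ) / (n : ℝ) ^ 2)
          = 2 * autCount s t / c *
            (c * ((diffPairs G (splitGraph A')).card / (n : ℝ) ^ 2) / autCount s t) := by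
              field_simp
        _ ≤ C * (maxValue (densityParameter (completeBipartiteGraph (Fin s) (Fin t))) n -
          densityParameter (completeBipartiteGraph (Fin s) (Fin t)) n G) := by
            gcongr
  · push Not at hG
    refine ⟨⊥, SimpleGraph.bot_isCompleteMultipartite, (hdist _).trans ?_⟩
    have hn1 : N₁ ≤ n := by exact_mod_cast hC2.trans hn
    have h1 := hN₁ n hn1
    rw [lt_div_iff₀ hpow] at h1
    have h2 := hgap (splitGraph (A n)) (δ / 2) (by positivity) (by linarith)
    have h3 : ((diffPairs G ⊥).card : ℝ) / (n : ℝ) ^ 2 ≤ 1 := by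
      rw [div_le_one (by positivity)]
      have : (diffPairs G ⊥).card ≤ n ^ 2 := by
        have := Finset.card_le_univ (diffPairs G ⊥)
        rwa [Fintype.card_prod, Fintype.card_fin, ← sq] at this
      exact_mod_cast this
    calc 2 * (((diffPairs G ⊥).card : ℝ) / (n : ℝ) ^ 2) ≤ 2 * 1 := by gcongr
      _ = 4 * autCount s t / δ * (δ / 2 / autCount s t) := by field_simp; norm_num
      _ ≤ C * (maxValue (densityParameter (completeBipartiteGraph (Fin s) (Fin t))) n -
          densityParameter (completeBipartiteGraph (Fin s) (Fin t)) n G) := by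
            gcongr

end Parameter

/-! ### Maximisers. -/

section Maximisers

theorem classSize_eq {m : ℕ} (c : Fin m → ℕ) (i : ℕ) :
    classSize c i = (Finset.univ.filter fun v => c v = i).card := by
  rw [classSize, ← Set.ncard_coe_finset]
  congr 1
  ext v
  simp

theorem sum_classSize_le {m : ℕ} (c : Fin m → ℕ) (I : Finset ℕ) :
    ∑ i ∈ I, classSize c i ≤ m := by
  simp only [classSize_eq]
  have := Finset.card_eq_sum_card_fiberwise (f := c)
    (s := Finset.univ.filter fun v => c v ∈ I) (t := I) (fun v hv => by simpa using hv)
  have h2 : ∀ i ∈ I, ((Finset.univ.filter fun v => c v ∈ I).filter fun v => c v = i) =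
      Finset.univ.filter fun v => c v = i := by
    intro i hi
    ext v
    simp only [Finset.mem_filter, Finset.mem_univ, true_and, and_iff_right_iff_imp]
    rintro rfl
    exact hi
  rw [Finset.sum_congr rfl fun i hi => congrArg Finset.card (h2 i hi).symm, ← this]
  simpa using Finset.card_le_univ (Finset.univ.filter fun v => c v ∈ I)

theorem twoPartSequence_of_two_le (a : ℝ) {r : ℕ} (hr : 2 ≤ r) : twoPartSequence a r = 0 := by
  obtain ⟨r, rfl⟩ := Nat.exists_eq_add_of_le' hr
  rfl

/-- If two colour classes have nearly the optimal proportions, then so do the two largest. -/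
theorem abs_classSize_sub_lt {m : ℕ} (hm : 0 < m) {c : Fin m → ℕ} (hc : Antitone (classSize c))
    {α η : ℝ} (hα : 1 / 2 ≤ α) {i j : ℕ} (hij : i ≠ j)
    (hi : |(classSize c i : ℝ) / m - α| < η) (hj : |(classSize c j : ℝ) / m - (1 - α)| < η)
    (r : ℕ) : |(classSize c r : ℝ) / m - twoPartSequence α r| < 2 * η := by
  have hmR : (0 : ℝ) < m := by exact_mod_cast hm
  have hanti : ∀ a b : ℕ, a ≤ b → (classSize c b : ℝ) / m ≤ (classSize c a : ℝ) / m := by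
    intro a b hab
    have : (classSize c b : ℝ) ≤ classSize c a := by exact_mod_cast hc hab
    gcongr
  have hsum : ∀ I : Finset ℕ, ∑ a ∈ I, (classSize c a : ℝ) / m ≤ 1 := by
    intro I
    rw [← Finset.sum_div, div_le_one hmR]
    exact_mod_cast sum_classSize_le c I
  have hnn : ∀ a, 0 ≤ (classSize c a : ℝ) / m := fun a => by positivity
  have hi' := abs_lt.1 hi
  have hj' := abs_lt.1 hj
  have h01 := hsum {0, 1}
  rw [Finset.sum_pair (by simp)] at h01
  have l0 : α - η < (classSize c 0 : ℝ) / m := by linarith [hanti 0 i (Nat.zero_le i)]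
  -- Whichever of `i`, `j` is nonzero bounds the second class from below, since `1 - α ≤ α`. All
  -- upper bounds then follow from the total being at most `1`.
  have l1 : 1 - α - η < (classSize c 1 : ℝ) / m := by
    rcases Nat.eq_zero_or_pos i with h | h
    · linarith [hanti 1 j (by omega)]
    · linarith [hanti 1 i h]
  rw [abs_lt]
  rcases r with _ | _ | r
  · change -(2 * η) < _ - α ∧ _ - α < 2 * η
    constructor <;> linarith
  · change -(2 * η) < _ - (1 - α) ∧ _ - (1 - α) < 2 * η
    simp only [zero_add]
    constructor <;> linarith
  · change -(2 * η) < _ - 0 ∧ _ - 0 < 2 * η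
    have h2 := hsum {0, 1, r + 1 + 1}
    rw [Finset.sum_insert (by simp), Finset.sum_pair (by simp)] at h2
    have := hnn (r + 1 + 1)
    constructor <;> linarith

theorem twoPartSequence_mem_partiteLimitSpace {α : ℝ} (h0 : 1 / 2 ≤ α) (h1 : α ≤ 1) :
    twoPartSequence α ∈ partiteLimitSpace := by
  have hz : ∀ r ∉ Finset.range 2, twoPartSequence α r = 0 := fun r hr =>
    twoPartSequence_of_two_le α (by rwa [Finset.mem_range, not_lt] at hr)
  refine ⟨antitone_nat_of_succ_le fun r => ?_, fun r => ?_, summable_of_ne_finset_zero hz, ?_⟩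
  · rcases r with _ | _ | r
    · change 1 - α ≤ α
      linarith
    · change 0 ≤ 1 - α
      linarith
    · exact le_rfl
  · rcases r with _ | _ | r
    · change 0 ≤ α
      linarith
    · change 0 ≤ 1 - α
      linarith
    · exact le_rfl
  · rw [tsum_eq_sum hz, Finset.sum_range_succ, Finset.sum_range_one]
    simp [twoPartSequence]

variable {s t : ℕ}

/-- Asymptotically optimal complete partite graphs have ordered part proportions converging to the
two-part sequence, and limits are unique; split graphs with a part of size `⌈α * n⌉₊` realise it. -/
theorem maximisers_eq (hs : 1 ≤ s) (hst : s ≤ t) (ht : 2 ≤ t) {α : ℝ}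
    (hα : IsOptimalSplit s t α) :
    maximisers (densityParameter (completeBipartiteGraph (Fin s) (Fin t))) =
      {twoPartSequence α} := by
  have ht1 : 1 ≤ t := by omega
  have haut := autCount_pos hs ht1
  have hfac : (0 : ℝ) < (s + t).factorial := by positivity
  have hlim := tendsto_maxValue hs hst ht hα
  have hα1 := hα.half_le
  have hα2 := hα.lt_one
  ext x
  rw [Set.mem_singleton_iff]
  constructor
  · rintro ⟨-, lamMax, hmax, n, H, c, hc, hn, hH, hx⟩
    obtain rfl := tendsto_nhds_unique hmax hlim
    have hcopies : Tendsto (fun k => ((copies (bipSide s t) (H k)).card : ℝ) /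
        (n k : ℝ) ^ (s + t)) atTop (𝓝 (fKst s t α)) := by
      have := (hH.mul (tendsto_choose_div_pow hn (s + t))).const_mul (autCount s t)
      have e : autCount s t * ((s + t).factorial * fKst s t α / autCount s t *
          (1 / (s + t).factorial)) = fKst s t α := by
        field_simp
      rw [e] at this
      refine this.congr' ?_
      filter_upwards [hn.eventually_ge_atTop (s + t)] with k hk
      have : (0 : ℝ) < (n k).choose (s + t) := by exact_mod_cast Nat.choose_pos hk
      rw [densityParameter_eq hs ht1]
      field_simp
    have key : Tendsto (fun k => fun r => (classSize (c k) r : ℝ) / n k) atTop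
        (𝓝 (twoPartSequence α)) := by
      rw [tendsto_pi_nhds]
      intro r
      rw [Metric.tendsto_atTop']
      intro ε hε
      obtain ⟨δ, hδ, hcl⟩ := exists_classes_of_multipartite hs hst ht hα (η := ε / 2)
        (by positivity)
      have h1 := hcopies.eventually_const_lt (show fKst s t α - δ < fKst s t α by linarith)
      obtain ⟨N, hN⟩ := eventually_atTop.1 (h1.and (hn.eventually_gt_atTop 0))
      refine ⟨N, fun k hk => ?_⟩
      obtain ⟨h2, hpos⟩ := hN k hk.le
      have : Nonempty (Fin (n k)) := ⟨⟨0, hpos⟩⟩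
      have hposR : (0 : ℝ) < n k := by exact_mod_cast hpos
      rw [lt_div_iff₀ (by positivity)] at h2
      obtain ⟨i, j, hij, hi, hj⟩ := hcl (Fin (n k)) ℕ (H k) (c k) (hc k).1
        (by rw [Fintype.card_fin]; exact h2.le)
      rw [← classSize_eq, Fintype.card_fin] at hi hj
      have := abs_classSize_sub_lt hpos (hc k).2 hα1 hij hi hj r
      rw [Real.dist_eq]
      linarith
    funext r
    exact tendsto_nhds_unique (hx r) ((tendsto_pi_nhds.1 key) r)
  · rintro rfl
    refine ⟨twoPartSequence_mem_partiteLimitSpace hα1 hα2.le, _, hlim, ?_⟩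
    obtain ⟨A, hAcard, hA⟩ := exists_tendsto_proportion (x := α) (by linarith) hα2.le
    have hsize : ∀ n, classSize (fun v : Fin n => if v ∈ A n then 0 else 1) 0 = (A n).card ∧
        classSize (fun v : Fin n => if v ∈ A n then 0 else 1) 1 = n - (A n).card ∧
        ∀ r, classSize (fun v : Fin n => if v ∈ A n then 0 else 1) (r + 2) = 0 := by
      intro n
      refine ⟨?_, ?_, fun r => ?_⟩
      · rw [classSize_eq]
        congr 1
        ext v
        simp
      · rw [classSize_eq]
        have : n - (A n).card = (A n)ᶜ.card := by rw [Finset.card_compl, Fintype.card_fin]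
        rw [this]
        congr 1
        ext v
        simp
      · rw [classSize_eq, Finset.card_eq_zero, Finset.filter_eq_empty_iff]
        intro v _
        by_cases h : v ∈ A n <;> simp [h]
    refine ⟨fun n => n, fun n => splitGraph (A n), fun n v => if v ∈ A n then 0 else 1,
      fun n => ⟨fun v w => ?_, antitone_nat_of_succ_le fun r => ?_⟩, tendsto_id, ?_, fun r => ?_⟩
    · rw [splitGraph_adj]
      by_cases h1 : v ∈ A n <;> by_cases h2 : w ∈ A n <;> simp [h1, h2]
    · obtain ⟨h0, h1, h2⟩ := hsize n
      rcases r with _ | _ | r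
      -- Rounding up makes the first class at least half of all vertices; rounding down would fail
      -- for `α = 1/2` and odd `n`.
      · rw [zero_add, h0, h1, hAcard]
        have : (n : ℝ) ≤ 2 * (⌈α * n⌉₊ : ℝ) := by
          have h3 := Nat.le_ceil (α * n)
          have : 1 / 2 * (n : ℝ) ≤ α * n := by gcongr
          linarith
        have : n ≤ 2 * ⌈α * n⌉₊ := by exact_mod_cast this
        omega
      · rw [zero_add, h2 0]
        exact Nat.zero_le _
      · rw [h2 (r + 1)]
        exact Nat.zero_le _
    · have h1 := (tendsto_card_copies_splitGraph hs ht1 hA).div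
        (tendsto_choose_div_pow (n := fun n : ℕ => n) tendsto_id (s + t)) (by positivity)
      have h2 := h1.div_const (autCount s t)
      have e : (s + t).factorial * fKst s t α / autCount s t =
          fKst s t α / (1 / ((s + t).factorial : ℝ)) / autCount s t := by
        rw [div_div_eq_mul_div, div_one, mul_comm]
      rw [e]
      refine h2.congr' ?_
      filter_upwards [eventually_gt_atTop 0] with n hn
      have hn' : (n : ℝ) ≠ 0 := by positivity
      rw [densityParameter_eq hs ht1]
      simp only [Pi.div_apply]
      field_simp
    · rcases r with _ | _ | r
      · simp only [(hsize _).1]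
        exact hA
      · simp only [zero_add, (hsize _).2.1]
        refine (tendsto_const_nhds.sub hA).congr' ?_
        filter_upwards [eventually_gt_atTop 0] with n hn
        have hn' : (n : ℝ) ≠ 0 := by positivity
        have hle : (A n).card ≤ n := by simpa using Finset.card_le_univ (A n)
        rw [Nat.cast_sub hle, sub_div, div_self hn']
      · simp only [(hsize _).2.2 r, Nat.cast_zero, zero_div]
        exact tendsto_const_nhds

end Maximisers

/-! ### Exchanging the sides, and the theorem. -/

theorem inducedCount_congr {W W' V : Type} [Fintype W] [Fintype W'] [Fintype V]
    {F : SimpleGraph W} {F' : SimpleGraph W'} (e : F ≃g F') (G : SimpleGraph V) :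
    inducedCount F G = inducedCount F' G := by
  have h1 : Fintype.card W = Fintype.card W' := Fintype.card_congr e.toEquiv
  have h2 : ∀ X : Finset V, Nonempty (G.induce (X : Set V) ≃g F) ↔
      Nonempty (G.induce (X : Set V) ≃g F') := fun X =>
    ⟨fun ⟨f⟩ => ⟨f.trans e⟩, fun ⟨f⟩ => ⟨f.trans e.symm⟩⟩
  simp only [inducedCount, h1, h2]

/-- Exchanging the two sides of a complete bipartite graph. -/
def completeBipartiteGraphComm (s t : ℕ) :
    completeBipartiteGraph (Fin s) (Fin t) ≃g completeBipartiteGraph (Fin t) (Fin s) where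
  toEquiv := Equiv.sumComm _ _
  map_rel_iff' := by
    intro a b
    rcases a with a | a <;> rcases b with b | b <;> simp [completeBipartiteGraph]

theorem theorem1p4 (s t : ℕ) (hst : 2 ≤ s * t) :
    PerfectlyStable (densityParameter (completeBipartiteGraph (Fin s) (Fin t))) ∧
    HasInducibility (completeBipartiteGraph (Fin s) (Fin t))
      (((s + t).choose s : ℝ) * MKst s t) ∧
    ∃ a : ℝ, a ∈ Set.Icc (1 / 2 : ℝ) 1 ∧
      IsMaxOn (fKst s t) (Set.Icc (1 / 2) 1) a ∧
      (∀ b ∈ Set.Icc (1 / 2 : ℝ) 1, IsMaxOn (fKst s t) (Set.Icc (1 / 2) 1) b → b = a) ∧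
      maximisers (densityParameter (completeBipartiteGraph (Fin s) (Fin t))) =
        {twoPartSequence a} := by
  wlog hle : s ≤ t generalizing s t
  · have h := this t s (by rwa [mul_comm]) (by omega)
    have hcount : ∀ (n : ℕ) (G : SimpleGraph (Fin n)),
        inducedCount (completeBipartiteGraph (Fin t) (Fin s)) G =
          inducedCount (completeBipartiteGraph (Fin s) (Fin t)) G := fun n G =>
      inducedCount_congr (completeBipartiteGraphComm t s) G
    have hcard : Fintype.card (Fin t ⊕ Fin s) = Fintype.card (Fin s ⊕ Fin t) :=
      Fintype.card_congr (Equiv.sumComm _ _)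
    have hpar : densityParameter (completeBipartiteGraph (Fin t) (Fin s)) =
        densityParameter (completeBipartiteGraph (Fin s) (Fin t)) := by
      funext n G
      simp only [densityParameter, inducedDensity, hcount, hcard]
    have hM : MKst t s = MKst s t := by
      simp only [MKst, fKst_swap t s, eq_comm]
    have hch : (t + s).choose t = (s + t).choose s := by
      rw [add_comm t s, ← Nat.choose_symm_add]
    rw [hpar, fKst_swap t s, hM, hch] at h
    refine ⟨h.1, ?_, h.2.2⟩
    have := h.2.1
    simp only [HasInducibility, maxInducedCount, hcount, hcard] at this ⊢
    exact this
  have hs : 1 ≤ s := by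
    by_contra! h
    simp [show s = 0 by omega] at hst
  have ht : 2 ≤ t := by
    by_contra! h
    have := Nat.mul_le_mul (show s ≤ 1 by omega) (show t ≤ 1 by omega)
    omega
  obtain ⟨α, hα⟩ := exists_isOptimalSplit hs hle
  have hα1 := hα.half_le
  have hα2 := hα.lt_one
  have hmem : α ∈ Set.Icc (1 / 2 : ℝ) 1 := ⟨hα1, hα2.le⟩
  have hmax : IsMaxOn (fKst s t) (Set.Icc (1 / 2) 1) α := fun x hx =>
    hα.le_max x ⟨by linarith [hx.1], hx.2⟩
  refine ⟨exists_perfect_stability hs hle ht hα, ?_, α, hmem, hmax, fun b hb hbmax => ?_,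
    maximisers_eq hs hle ht hα⟩
  · have hsup : sSup (fKst s t '' Set.Icc (1 / 2) 1) = fKst s t α := by
      refine IsGreatest.csSup_eq ⟨Set.mem_image_of_mem _ hmem, ?_⟩
      rintro _ ⟨x, hx, rfl⟩
      exact hmax hx
    -- The factor `1/2` in `MKst s s` is the factor `2` in `autCount`, from automorphisms exchanging
    -- the sides of `K_{s,s}`.
    have hconst : ((s + t).choose s : ℝ) * MKst s t =
        (s + t).factorial * fKst s t α / autCount s t := by
      have hc : (((s + t).choose s : ℕ) : ℝ) * (s.factorial * t.factorial) =
          (s + t).factorial := by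
        rw [← Nat.add_choose_mul_factorial_mul_factorial s t, Nat.choose_symm_add]
        push_cast
        ring
      rw [autCount_eq hs (by omega), MKst, hsup, ← hc]
      split_ifs <;> field_simp
    rw [HasInducibility, hconst]
    refine (tendsto_maxValue hs hle ht hα).congr fun n => ?_
    rw [← maxInducedCount_div]
  · have he : fKst s t b = fKst s t α := le_antisymm (hmax hb) (hbmax hmem)
    rcases hα.eq_or_eq b ⟨by linarith [hb.1], hb.2⟩ he with h | h
    · exact h
    -- Both `α` and `b = 1 - α` are at least `1/2`, so both are `1/2`.
    · linarith [hb.1]
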